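/- Let $r<s$ be coprime positive integers. For rational $\alpha>0$ let $d_\alpha(n)$ be the $n$-th Dirichlet coefficient of $\zeta(u)^\alpha$, i.e. the multiplicative function with $d_\alpha(p^k)=\alpha(\alpha+1)\cdots(\alpha+k-1)/k!$. For a prime $q$, a Dirichlet character $\chi$ modulo $q$ and real $x,y>1$ put $$P_\alpha(\chi)=\sum_{n\le x}\frac{d_\alpha(n)\chi(n)}{\sqrt n}\,\frac{\log(x/n)}{\log x},\qquad M_\alpha(\chi)=\frac12\sum_{n\le y}\frac{d_\alpha(n)\mu(n)\chi(n)}{\sqrt n}\,\frac{\log^2(y/n)}{\log^2y},$$ $$S_l=\sum_{\chi\ne\chi_0}L(\tfrac12,\chi)\,\overline{P_{1/2s}(\chi)}^{\,2s}\,|M_{1/s}(\chi)|^{2(s-r)},$$ the sum being over the non-principal characters modulo $q$. Let $X=q^{5/4}$. Powers $\zeta^\alpha(u)=\exp(\alpha\log\zeta(u))$, $\operatorname{Re}u>1$, are taken with the branch of $\log\zeta$ that is real for real $u>1$. Write $\vec w=(w_1,\dots,w_{2s})$, $\vec z_1=(z_1,\dots,z_{s-r})$, $\vec z_2=(z_{s-r+1},\dots,z_{2(s-r)})$,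 $\vec z=(\vec z_1,\vec z_2)$, and $$\sigma_{\vec w}(n)=\sum_{n_1\cdots n_{2s}=n}\ \prod_{i}\frac{d_{1/2s}(n_i)}{n_i^{w_i}},\qquad \rho_{\vec z_\nu}(a)=\sum_{a_1\cdots a_{s-r}=a}\ \prod_{j}\frac{d_{1/s}(a_j)\mu(a_j)}{a_j^{(\vec z_\nu)_j}}\quad(\nu=1,2).$$ Let $\eta_l(w_0,\vec w,\vec z)=\prod_p\eta_{l,p}(w_0,\vec w,\vec z)$ be the Euler product with factors $$\eta_{l,p}=\Bigg(\sum_{\substack{m,n,a,b\in\{1,p,p^2,\dots\}\\ ma=nb}}\frac{\sigma_{\vec w}(n)\rho_{\vec z_1}(a)\rho_{\vec z_2}(b)}{\sqrt{mnab}\;m^{w_0}}\Bigg)\cdot\frac{\prod_{i\le 2s}(1-p^{-1-w_0-w_i})^{1/2s}\prod_{j,k\le s-r}(1-p^{-1-z_j-z_{s-r+k}})^{1/s^2}}{\prod_{i\le 2s,\,j\le s-r}(1-p^{-1-w_i-z_j})^{1/2s^2}\prod_{k\le s-r}(1-p^{-1-w_0-z_{s-r+k}})^{1/s}}$$ (principal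 branches). Then: (i) whenever all of $w_0,w_1,\dots,w_{2s},z_1,\dots,z_{2(s-r)}$ have real part $\ge-3/16$, the series defining each $\eta_{l,p}$ converges absolutely and the Euler product converges absolutely, i.e. $\sum_p|\eta_{l,p}-1|<\infty$; (ii) for every prime $q$, all real $1<y\le x$ with $x^{4s}\le q^{1/20}$, and every $c>0$, $$S_l=\frac{\phi(q)\,I_l}{(\log x)^{2s}(\log y)^{4s-4r}}+O\!\left(\frac{q}{\log q}\right),$$ with an implied constant that depends only on $r$ and $s$, where $$I_l=\frac1{(2\pi i)^{4s-2r+1}}\int_{(c)^{4s-2r+1}}\frac{\prod_{i\le2s}\zeta^{1/2s}(1+w_0+w_i)\prod_{j,k\le s-r}\zeta^{1/s^2}(1+z_j+z_{s-r+k})}{\prod_{i\le2s,\,j\le s-r}\zeta^{1/2s^2}(1+w_i+z_j)\prod_{k\le s-r}\zeta^{1/s}(1+w_0+z_{s-r+k})}\,X^{w_0}\Gamma(w_0)\,\frac{x^{w_1+\cdots+w_{2s}}\,y^{z_1+\cdots+z_{2(s-r)}}}{w_1^2\cdots w_{2s}^2\,z_1^3\cdots z_{2(s-r)}^3}\,\eta_l(w_0,\vec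 w,\vec z)\,dw_0\,d\vec w\,d\vec z,$$ an absolutely convergent integral over the lines of real part $c$. -/

import Mathlib

namespace FracMoment

/-- The generalised divisor function `d_α(n)`: the `n`-th Dirichlet coefficient of `ζ(s)^α`, i.e. the
multiplicative function with `d_α(p^k) = α (α + 1) ⋯ (α + k - 1) / k!`. -/
noncomputable def genDivisor (α : ℝ) (n : ℕ) : ℝ :=
  n.factorization.prod fun _ k => (ascPochhammer ℝ k).eval α / (k.factorial : ℝ)

/-- `P_α(χ) = ∑_{n ≤ x} d_α(n) χ(n) n^{-1/2} log(x/n) / log x`. -/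
noncomputable def dirPoly {q : ℕ} (χ : DirichletCharacter ℂ q) (α x : ℝ) : ℂ :=
  ∑ n ∈ Finset.Icc 1 ⌊x⌋₊,
    (genDivisor α n : ℂ) * χ (n : ZMod q) / (Real.sqrt n : ℂ)
      * ((Real.log (x / n) / Real.log x : ℝ) : ℂ)

/-- `M_α(χ) = (1/2) ∑_{n ≤ y} d_α(n) μ(n) χ(n) n^{-1/2} log²(y/n) / log² y`. -/
noncomputable def mollifier {q : ℕ} (χ : DirichletCharacter ℂ q) (α y : ℝ) : ℂ :=
  (1 / 2 : ℂ) * ∑ n ∈ Finset.Icc 1 ⌊y⌋₊,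
    (genDivisor α n : ℂ) * (ArithmeticFunction.moebius n : ℂ) * χ (n : ZMod q)
      / (Real.sqrt n : ℂ) * ((Real.log (y / n) ^ 2 / Real.log y ^ 2 : ℝ) : ℂ)

open Classical in
/-- `S_l = ∑_{χ ≠ χ₀} L(1/2, χ) conj(P_{1/2s}(χ))^{2s} |M_{1/s}(χ)|^{2(s-r)}`, the sum being over the
non-principal Dirichlet characters modulo `q`. -/
noncomputable def lowerMoment (r s q : ℕ) [NeZero q] (x y : ℝ) : ℂ :=
  ∑ χ : DirichletCharacter ℂ q with χ ≠ 1,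
    DirichletCharacter.LFunction χ (1 / 2)
      * (starRingEnd ℂ (dirPoly χ (1 / (2 * (s : ℝ))) x)) ^ (2 * s)
      * ((‖mollifier χ (1 / (s : ℝ)) y‖ ^ (2 * (s - r)) : ℝ) : ℂ)

/-- The branch of `log ζ` on `Re u > 1` that is real on the real axis. -/
noncomputable def logZeta (u : ℂ) : ℂ :=
  ∑' p : Nat.Primes, -Complex.log (1 - (p : ℂ) ^ (-u))

theorem exp_logZeta {u : ℂ} (hu : 1 < u.re) : Complex.exp (logZeta u) = riemannZeta u :=
  riemannZeta_eulerProduct_exp_log hu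

/-- The fractional power `ζ(u)^α = exp(α log ζ(u))` for `Re u > 1`. -/
noncomputable def zetaPow (α : ℝ) (u : ℂ) : ℂ := Complex.exp ((α : ℂ) * logZeta u)

/-- `σ_{w_1,…,w_k}(n) = ∑_{n_1 ⋯ n_k = n} ∏_i d_{1/2s}(n_i) n_i^{-w_i}`. -/
noncomputable def sigmaW (s : ℕ) {k : ℕ} (w : Fin k → ℂ) (n : ℕ) : ℂ :=
  ∑ f ∈ Nat.finMulAntidiag k n,
    ∏ i, (genDivisor (1 / (2 * (s : ℝ))) (f i) : ℂ) / ((f i : ℂ) ^ (w i))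

/-- `ρ_{z_1,…,z_k}(a) = ∑_{a_1 ⋯ a_k = a} ∏_i d_{1/s}(a_i) μ(a_i) a_i^{-z_i}`. -/
noncomputable def rhoZ (s : ℕ) {k : ℕ} (z : Fin k → ℂ) (a : ℕ) : ℂ :=
  ∑ f ∈ Nat.finMulAntidiag k a,
    ∏ i, (genDivisor (1 / (s : ℝ)) (f i) : ℂ) * (ArithmeticFunction.moebius (f i) : ℂ)
      / ((f i : ℂ) ^ (z i))

/-- The summand `(mnab)^{-1/2} m^{-w₀} σ_w(n) ρ_{z¹}(a) ρ_{z²}(b)` of the diagonal Dirichlet series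
over `ma = nb`. -/
noncomputable def diagTerm (s : ℕ) {k l : ℕ} (w₀ : ℂ) (w : Fin k → ℂ) (z₁ z₂ : Fin l → ℂ)
    (m n a b : ℕ) : ℂ :=
  sigmaW s w n * rhoZ s z₁ a * rhoZ s z₂ b
    / ((Real.sqrt ((m : ℝ) * n * a * b) : ℂ) * (m : ℂ) ^ w₀)

/-- The exponents `(i, j, k, l)` with `p^i p^k = p^j p^l`, i.e. the `p`-part of `ma = nb`. -/
abbrev DiagExp : Type := {e : ℕ × ℕ × ℕ × ℕ // e.1 + e.2.2.1 = e.2.1 + e.2.2.2}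

/-- The terms of the local factor at `p` of the diagonal Dirichlet series. -/
noncomputable def localTerm (s : ℕ) {k l : ℕ} (w₀ : ℂ) (w : Fin k → ℂ) (z₁ z₂ : Fin l → ℂ)
    (p : ℕ) (e : DiagExp) : ℂ :=
  diagTerm s w₀ w z₁ z₂ (p ^ e.1.1) (p ^ e.1.2.1) (p ^ e.1.2.2.1) (p ^ e.1.2.2.2)

/-- The factor `(1 - p^{-u})^α`, principal branch. -/
noncomputable def eulerPow (α : ℝ) (p : ℕ) (u : ℂ) : ℂ := (1 - (p : ℂ) ^ (-u)) ^ (α : ℂ)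

/-- The Euler factor at `p` of `η_l`: the local factor of the diagonal Dirichlet series divided by
the local factors of the fractional powers of `ζ` occurring in the integrand. -/
noncomputable def etaFactor (s : ℕ) {k l : ℕ} (w₀ : ℂ) (w : Fin k → ℂ) (z₁ z₂ : Fin l → ℂ)
    (p : ℕ) : ℂ :=
  (∑' e : DiagExp, localTerm s w₀ w z₁ z₂ p e)
    * (((∏ i, eulerPow (1 / (2 * (s : ℝ))) p (1 + w₀ + w i))
        * ∏ j, ∏ h, eulerPow (1 / (s : ℝ) ^ 2) p (1 + z₁ j + z₂ h))
      / ((∏ i, ∏ j, eulerPow (1 / (2 * (s : ℝ) ^ 2)) p (1 + w i + z₁ j))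
        * ∏ h, eulerPow (1 / (s : ℝ)) p (1 + w₀ + z₂ h)))

/-- The Euler product `η_l(w₀, w, z)`. -/
noncomputable def etaL (s : ℕ) {k l : ℕ} (w₀ : ℂ) (w : Fin k → ℂ) (z₁ z₂ : Fin l → ℂ) : ℂ :=
  ∏' p : Nat.Primes, etaFactor s w₀ w z₁ z₂ p

/-- The integrand of `I_l`, with `X = q^{5/4}`. -/
noncomputable def integrandL (r s q : ℕ) (x y : ℝ) (w₀ : ℂ) (w : Fin (2 * s) → ℂ)
    (z₁ z₂ : Fin (s - r) → ℂ) : ℂ :=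
  ((∏ i, zetaPow (1 / (2 * (s : ℝ))) (1 + w₀ + w i))
      * ∏ j, ∏ h, zetaPow (1 / (s : ℝ) ^ 2) (1 + z₁ j + z₂ h))
    / ((∏ i, ∏ j, zetaPow (1 / (2 * (s : ℝ) ^ 2)) (1 + w i + z₁ j))
      * ∏ h, zetaPow (1 / (s : ℝ)) (1 + w₀ + z₂ h))
    * (((q : ℝ) ^ (5 / 4 : ℝ) : ℝ) : ℂ) ^ w₀ * Complex.Gamma w₀
    * ((x : ℂ) ^ (∑ i, w i) * (y : ℂ) ^ ((∑ j, z₁ j) + ∑ h, z₂ h)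
      / ((∏ i, w i ^ 2) * (∏ j, z₁ j ^ 3) * ∏ h, z₂ h ^ 3))
    * etaL s w₀ w z₁ z₂

/-- The integrand of `I_l` on the vertical lines of real part `c`, as a function of the imaginary
parts of the `4s - 2r + 1` variables. -/
noncomputable def lineIntegrand (r s q : ℕ) (x y c : ℝ)
    (t : ℝ × (Fin (2 * s) → ℝ) × (Fin (s - r) → ℝ) × (Fin (s - r) → ℝ)) : ℂ :=
  integrandL r s q x y (c + t.1 * Complex.I) (fun i => c + t.2.1 i * Complex.I)
    (fun j => c + t.2.2.1 j * Complex.I) (fun h => c + t.2.2.2 h * Complex.I)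

/-- `I_l`; each of the `4s - 2r + 1` variables `u = c + it` contributes `du = i dt`. -/
noncomputable def integralL (r s q : ℕ) (x y c : ℝ) : ℂ :=
  1 / (2 * (Real.pi : ℂ) * Complex.I) ^ (4 * s - 2 * r + 1)
    * ∫ t, lineIntegrand r s q x y c t * Complex.I ^ (4 * s - 2 * r + 1)

end FracMoment

/-! ### Coefficient bounds and multiplicativity of the diagonal series -/

namespace FracMoment

open Finset

/-! Both parts rest on one Dirichlet series. On ma = nb = N one has √(mnab) = N, so the diagonal sum
over quadruples is ∑ A(N)B(N)/N, where A and B (`leftAF`, `rightAF`) are Dirichlet convolutions in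
(m, a) and (n, b). The coefficients `diagCoeff` are multiplicative and bounded by d(N)^K N^(-1-2σ)
when all variables have real part at least σ.

Part (i). With σ = -3/16 the coefficient at p^N is at most (N+1)^K p^(-5N/8), so the local series is
1 + A(p)B(p)/p + O(p^(-5/4)). The exponents of the zeta factors are exactly those that cancel
A(p)B(p)/p (`diagCoeff_prime`); what remains is 1 + O(p^(-5/4)), and this is summable over primes.

Part (ii), the integral. For positive real parts the zeta factors times η_l give back ∑ `diagCoeff`
N, absolutely convergent (`zeta_ratio_mul_etaL`). Integrated term by term, the kernels x^u/u²,
y^u/u³ and X^u Γ(u) become log⁺, (log⁺)²/2 and e^(-m/X). Hence for every c > 0, and without moving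
any contour, I_l is the sum over ma = nb of the coefficients of the powers of P and M, cleared of
logarithms, against e^(-m/X)/√(mnab) (`integralL_eq`).

Part (ii), the moment. Expanding the powers (`lowerMoment_mul_eq`) leaves the sums ∑ L(1/2, χ) χ(a)
conj χ(nb). Pólya–Vinogradov and summation by parts replace L(1/2, χ) by ∑ χ(m) m^(-1/2) e^(-m/X),
and orthogonality restricts to ma ≡ nb mod q. The solutions of ma = nb reproduce I_l; all others
have m ≥ q^(19/20) and contribute little. Each twist costs O(q^(93/100))
(`exists_twistedMoment_le`), and the coefficients, once divided by the logarithms, cost at most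
q^(1/20), for a total of O(q^(49/50)). -/

theorem ascPochhammer_eval_div_factorial_mem {α : ℝ} (h0 : 0 ≤ α) (h1 : α ≤ 1) (k : ℕ) :
    0 ≤ (ascPochhammer ℝ k).eval α / (k.factorial : ℝ) ∧
      (ascPochhammer ℝ k).eval α / (k.factorial : ℝ) ≤ 1 := by
  induction k with
  | zero => simp
  | succ k ih =>
    have hk : (0 : ℝ) < k + 1 := by positivity
    have e : (ascPochhammer ℝ (k + 1)).eval α / ((k + 1).factorial : ℝ)
        = (ascPochhammer ℝ k).eval α / (k.factorial : ℝ) * ((α + k) / (k + 1)) := by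
      rw [ascPochhammer_succ_eval, Nat.factorial_succ]
      push_cast
      field_simp
    have h2 : 0 ≤ (α + k) / (k + 1) := by positivity
    have h3 : (α + k) / (k + 1) ≤ 1 := by rw [div_le_one hk]; linarith
    rw [e]
    exact ⟨mul_nonneg ih.1 h2, mul_le_one₀ ih.2 h2 h3⟩

theorem genDivisor_nonneg {α : ℝ} (h0 : 0 ≤ α) (h1 : α ≤ 1) (n : ℕ) : 0 ≤ genDivisor α n := by
  unfold genDivisor Finsupp.prod
  exact Finset.prod_nonneg fun _ _ => (ascPochhammer_eval_div_factorial_mem h0 h1 _).1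

theorem genDivisor_le_one {α : ℝ} (h0 : 0 ≤ α) (h1 : α ≤ 1) (n : ℕ) : genDivisor α n ≤ 1 := by
  unfold genDivisor Finsupp.prod
  exact Finset.prod_le_one (fun _ _ => (ascPochhammer_eval_div_factorial_mem h0 h1 _).1)
    fun _ _ => (ascPochhammer_eval_div_factorial_mem h0 h1 _).2

@[simp] theorem genDivisor_one (α : ℝ) : genDivisor α 1 = 1 := by simp [genDivisor]

theorem genDivisor_prime (α : ℝ) {p : ℕ} (hp : p.Prime) : genDivisor α p = α := by
  simp [genDivisor, hp.factorization, Finsupp.prod_single_index]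

theorem genDivisor_mul_of_coprime (α : ℝ) {m n : ℕ} (h : m.Coprime n) :
    genDivisor α (m * n) = genDivisor α m * genDivisor α n := by
  unfold genDivisor
  rw [Nat.factorization_mul_of_coprime h, Finsupp.prod_add_index_of_disjoint]
  exact h.disjoint_primeFactors

/-- The arithmetic function `n ↦ h(n) n^{-v}`. -/
noncomputable def twist (h : ℕ → ℂ) (v : ℂ) : ArithmeticFunction ℂ :=
  ⟨fun n => if n = 0 then 0 else h n / (n : ℂ) ^ v, by simp⟩

theorem twist_apply (h : ℕ → ℂ) (v : ℂ) {n : ℕ} (hn : n ≠ 0) :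
    twist h v n = h n / (n : ℂ) ^ v := by simp [twist, hn]

theorem isMultiplicative_twist {h : ℕ → ℂ} (v : ℂ) (h1 : h 1 = 1)
    (hm : ∀ m n, m.Coprime n → h (m * n) = h m * h n) : (twist h v).IsMultiplicative := by
  rw [ArithmeticFunction.IsMultiplicative.iff_ne_zero]
  refine ⟨by simp [twist, h1], fun {m n} hm0 hn0 hmn => ?_⟩
  rw [twist_apply _ _ hm0, twist_apply _ _ hn0, twist_apply _ _ (mul_ne_zero hm0 hn0), hm _ _ hmn,
    Nat.cast_mul, Complex.natCast_mul_natCast_cpow]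
  ring

/-- The coefficients `d_α(n)`, as complex numbers. -/
noncomputable def divCoeff (α : ℝ) (n : ℕ) : ℂ := (genDivisor α n : ℂ)

/-- The coefficients `d_α(n) μ(n)`, as complex numbers. -/
noncomputable def divMuCoeff (α : ℝ) (n : ℕ) : ℂ :=
  (genDivisor α n : ℂ) * (ArithmeticFunction.moebius n : ℂ)

theorem norm_divCoeff_le {α : ℝ} (h0 : 0 ≤ α) (h1 : α ≤ 1) (n : ℕ) : ‖divCoeff α n‖ ≤ 1 := by
  rw [divCoeff, Complex.norm_real, Real.norm_of_nonneg (genDivisor_nonneg h0 h1 n)]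
  exact genDivisor_le_one h0 h1 n

theorem norm_divMuCoeff_le {α : ℝ} (h0 : 0 ≤ α) (h1 : α ≤ 1) (n : ℕ) :
    ‖divMuCoeff α n‖ ≤ 1 := by
  rw [divMuCoeff, norm_mul]
  refine mul_le_one₀ (norm_divCoeff_le h0 h1 n) (norm_nonneg _) ?_
  rw [Complex.norm_intCast]
  exact_mod_cast ArithmeticFunction.abs_moebius_le_one

theorem isMultiplicative_twist_divCoeff (α : ℝ) (v : ℂ) :
    (twist (divCoeff α) v).IsMultiplicative :=
  isMultiplicative_twist v (by simp [divCoeff]) fun m n h => by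
    simp [divCoeff, genDivisor_mul_of_coprime α h]

theorem isMultiplicative_twist_divMuCoeff (α : ℝ) (v : ℂ) :
    (twist (divMuCoeff α) v).IsMultiplicative :=
  isMultiplicative_twist v (by simp [divMuCoeff]) fun m n h => by
    simp only [divMuCoeff, genDivisor_mul_of_coprime α h,
      ArithmeticFunction.isMultiplicative_moebius.map_mul_of_coprime h]
    push_cast
    ring

/-- Exhibits `sigmaW` and `rhoZ` as iterated Dirichlet convolutions, so that multiplicativity and
divisor bounds are inherited from single factors. The induction splits off the first entry of a
factorization. -/
theorem prod_apply_finMulAntidiag {R : Type*} [CommSemiring R] {k : ℕ}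
    (F : Fin k → ArithmeticFunction R) (n : ℕ) :
    (∏ i, F i) n = ∑ f ∈ Nat.finMulAntidiag k n, ∏ i, F i (f i) := by
  induction k generalizing n with
  | zero =>
    rcases eq_or_ne n 1 with rfl | hn
    · simp [Nat.finMulAntidiag_one]
    · simp [Nat.finMulAntidiag_zero_left hn, ArithmeticFunction.one_apply_ne hn]
  | succ k ih =>
    rw [Fin.prod_univ_succ, ArithmeticFunction.mul_apply]
    simp_rw [ih, Finset.mul_sum]
    rw [Finset.sum_sigma']
    refine Finset.sum_bij' (fun x _ => Fin.cons x.1.1 x.2)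
      (fun f _ => ⟨(f 0, ∏ i : Fin k, f i.succ), fun i => f i.succ⟩) ?_ ?_ ?_ ?_ ?_
    · rintro ⟨⟨a, b⟩, g⟩ h
      simp only [Finset.mem_sigma, Nat.mem_divisorsAntidiagonal, Nat.mem_finMulAntidiag] at h
      simp only [Nat.mem_finMulAntidiag, Fin.prod_univ_succ, Fin.cons_zero, Fin.cons_succ]
      rw [h.2.1]
      exact h.1
    · intro f h
      simp only [Nat.mem_finMulAntidiag, Fin.prod_univ_succ] at h
      simp only [Finset.mem_sigma, Nat.mem_divisorsAntidiagonal, Nat.mem_finMulAntidiag]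
      refine ⟨h, trivial, fun h0 => h.2 ?_⟩
      rw [← h.1, h0, mul_zero]
    · rintro ⟨⟨a, b⟩, g⟩ h
      simp only [Finset.mem_sigma, Nat.mem_divisorsAntidiagonal, Nat.mem_finMulAntidiag] at h
      obtain ⟨-, h2, -⟩ := h
      subst h2
      simp
    · intro f h
      exact Fin.cons_self_tail f
    · rintro ⟨⟨a, b⟩, g⟩ h
      simp [Fin.prod_univ_succ]

theorem isMultiplicative_prod {R ι : Type*} [CommSemiring R] (t : Finset ι)
    (F : ι → ArithmeticFunction R) (h : ∀ i, (F i).IsMultiplicative) :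
    (∏ i ∈ t, F i).IsMultiplicative := by
  classical
  induction t using Finset.induction_on with
  | empty => simp [ArithmeticFunction.isMultiplicative_one]
  | insert a t ha ih => rw [Finset.prod_insert ha]; exact (h a).mul ih

theorem sigmaW_eq (s : ℕ) {k : ℕ} (w : Fin k → ℂ) (n : ℕ) :
    sigmaW s w n = (∏ i, twist (divCoeff (1 / (2 * (s : ℝ)))) (w i)) n := by
  rw [prod_apply_finMulAntidiag, sigmaW]
  refine Finset.sum_congr rfl fun f hf => Finset.prod_congr rfl fun i _ => ?_
  rw [twist_apply _ _ (Nat.ne_zero_of_mem_finMulAntidiag hf i), divCoeff]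

theorem rhoZ_eq (s : ℕ) {k : ℕ} (z : Fin k → ℂ) (n : ℕ) :
    rhoZ s z n = (∏ i, twist (divMuCoeff (1 / (s : ℝ))) (z i)) n := by
  rw [prod_apply_finMulAntidiag, rhoZ]
  refine Finset.sum_congr rfl fun f hf => Finset.prod_congr rfl fun i _ => ?_
  rw [twist_apply _ _ (Nat.ne_zero_of_mem_finMulAntidiag hf i), divMuCoeff]

/-- `|F(n)| ≤ d(n)^j n^{-σ}` for all `n ≥ 1`. -/
def DivBound (F : ArithmeticFunction ℂ) (j : ℕ) (σ : ℝ) : Prop :=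
  ∀ n : ℕ, n ≠ 0 → ‖F n‖ ≤ (n.divisors.card : ℝ) ^ j * (n : ℝ) ^ (-σ)

theorem one_le_card_divisors {n : ℕ} (hn : n ≠ 0) : (1 : ℝ) ≤ n.divisors.card := by
  exact_mod_cast Finset.card_pos.mpr ⟨1, by simp [hn]⟩

theorem divBound_twist {h : ℕ → ℂ} {v : ℂ} {σ : ℝ} (hh : ∀ n, ‖h n‖ ≤ 1) (hv : σ ≤ v.re) :
    DivBound (twist h v) 0 σ := by
  intro n hn
  have h1 : (1 : ℝ) ≤ n := by exact_mod_cast Nat.one_le_iff_ne_zero.mpr hn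
  rw [twist_apply _ _ hn, norm_div, Complex.norm_natCast_cpow_of_pos (Nat.pos_of_ne_zero hn),
    pow_zero, one_mul, div_eq_mul_inv, ← Real.rpow_neg (by positivity)]
  refine (mul_le_of_le_one_left (by positivity) (hh n)).trans ?_
  exact Real.rpow_le_rpow_of_exponent_le h1 (by linarith)

/-- The convolution at n has d(n) terms, which accounts for the extra 1 in the exponent; d is
monotone under divisibility, and n^(-σ) splits over each factorization. -/
theorem DivBound.mul {F G : ArithmeticFunction ℂ} {j k : ℕ} {σ : ℝ} (hF : DivBound F j σ)
    (hG : DivBound G k σ) : DivBound (F * G) (j + k + 1) σ := by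
  intro n hn
  rw [ArithmeticFunction.mul_apply]
  calc ‖∑ x ∈ n.divisorsAntidiagonal, F x.1 * G x.2‖
      ≤ ∑ x ∈ n.divisorsAntidiagonal, (n.divisors.card : ℝ) ^ (j + k) * (n : ℝ) ^ (-σ) := by
        refine (norm_sum_le _ _).trans (Finset.sum_le_sum fun x hx => ?_)
        obtain ⟨hx1, -⟩ := Nat.mem_divisorsAntidiagonal.mp hx
        have h1 : x.1 ≠ 0 := fun h => hn (by rw [← hx1, h, zero_mul])
        have h2 : x.2 ≠ 0 := fun h => hn (by rw [← hx1, h, mul_zero])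
        have c1 : (x.1.divisors.card : ℝ) ≤ n.divisors.card := by
          exact_mod_cast Finset.card_le_card
            (Nat.divisors_subset_of_dvd hn (hx1 ▸ Dvd.intro _ rfl))
        have c2 : (x.2.divisors.card : ℝ) ≤ n.divisors.card := by
          exact_mod_cast Finset.card_le_card
            (Nat.divisors_subset_of_dvd hn (hx1 ▸ Dvd.intro_left _ rfl))
        have e : (n : ℝ) ^ (-σ) = (x.1 : ℝ) ^ (-σ) * (x.2 : ℝ) ^ (-σ) := by
          rw [← Real.mul_rpow (by positivity) (by positivity), ← hx1]; push_cast; rfl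
        rw [norm_mul, e, pow_add]
        calc ‖F x.1‖ * ‖G x.2‖ ≤ ((x.1.divisors.card : ℝ) ^ j * (x.1 : ℝ) ^ (-σ)) *
              ((x.2.divisors.card : ℝ) ^ k * (x.2 : ℝ) ^ (-σ)) := by
              gcongr
              · exact hF _ h1
              · exact hG _ h2
          _ ≤ ((n.divisors.card : ℝ) ^ j * (x.1 : ℝ) ^ (-σ)) *
              ((n.divisors.card : ℝ) ^ k * (x.2 : ℝ) ^ (-σ)) := by gcongr
          _ = _ := by ring
    _ = _ := by
        rw [Finset.sum_const, ← Nat.map_div_right_divisors, Finset.card_map, nsmul_eq_mul]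
        ring

theorem divBound_prod {k : ℕ} (F : Fin k → ArithmeticFunction ℂ) {σ : ℝ}
    (hF : ∀ i, DivBound (F i) 0 σ) : DivBound (∏ i, F i) k σ := by
  induction k with
  | zero =>
    intro n hn
    rcases eq_or_ne n 1 with rfl | h
    · simp
    · simp [ArithmeticFunction.one_apply_ne h]; positivity
  | succ k ih =>
    rw [Fin.prod_univ_succ]
    have := (hF 0).mul (ih (fun i => F i.succ) fun i => hF _)
    rwa [zero_add] at this

theorem DivBound.prime_pow {F : ArithmeticFunction ℂ} {j : ℕ} {σ : ℝ} (hF : DivBound F j σ)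
    {p : ℕ} (hp : p.Prime) (e : ℕ) : ‖F (p ^ e)‖ ≤ ((e : ℝ) + 1) ^ j * ((p : ℝ) ^ (-σ)) ^ e := by
  have := hF (p ^ e) (pow_ne_zero _ hp.ne_zero)
  rw [Nat.divisors_prime_pow hp, Finset.card_map, Finset.card_range] at this
  push_cast at this
  rwa [← Real.rpow_natCast (_ ^ (-σ)), ← Real.rpow_mul (by positivity), mul_comm (-σ),
    Real.rpow_mul (by positivity), Real.rpow_natCast]

theorem divBound_sigma {s : ℕ} (hs : 0 < s) {k : ℕ} {w : Fin k → ℂ} {σ : ℝ}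
    (hw : ∀ i, σ ≤ (w i).re) :
    DivBound (∏ i, twist (divCoeff (1 / (2 * (s : ℝ)))) (w i)) k σ := by
  have h1 : (1 : ℝ) ≤ s := by exact_mod_cast hs
  refine divBound_prod _ fun i => divBound_twist (norm_divCoeff_le (by positivity) ?_) (hw i)
  rw [div_le_one (by positivity)]; linarith

theorem divBound_rho {s : ℕ} (hs : 0 < s) {k : ℕ} {z : Fin k → ℂ} {σ : ℝ}
    (hz : ∀ i, σ ≤ (z i).re) :
    DivBound (∏ i, twist (divMuCoeff (1 / (s : ℝ))) (z i)) k σ := by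
  have h1 : (1 : ℝ) ≤ s := by exact_mod_cast hs
  refine divBound_prod _ fun i => divBound_twist (norm_divMuCoeff_le (by positivity) ?_) (hz i)
  rw [div_le_one (by positivity)]; linarith

/-- The Dirichlet series coefficients `∑_{ma = N} ρ_z(a) m^{-w₀}`. -/
noncomputable def leftAF (s : ℕ) {l : ℕ} (w₀ : ℂ) (z₁ : Fin l → ℂ) : ArithmeticFunction ℂ :=
  twist 1 w₀ * ∏ i, twist (divMuCoeff (1 / (s : ℝ))) (z₁ i)

/-- The Dirichlet series coefficients `∑_{nb = N} σ_w(n) ρ_z(b)`. -/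
noncomputable def rightAF (s : ℕ) {k l : ℕ} (w : Fin k → ℂ) (z₂ : Fin l → ℂ) :
    ArithmeticFunction ℂ :=
  (∏ i, twist (divCoeff (1 / (2 * (s : ℝ)))) (w i)) *
    ∏ i, twist (divMuCoeff (1 / (s : ℝ))) (z₂ i)

/-- The part of the diagonal Dirichlet series with `ma = nb = N`. -/
noncomputable def diagCoeff (s : ℕ) {k l : ℕ} (w₀ : ℂ) (w : Fin k → ℂ) (z₁ z₂ : Fin l → ℂ)
    (N : ℕ) : ℂ :=
  leftAF s w₀ z₁ N * rightAF s w z₂ N / N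

theorem isMultiplicative_leftAF (s : ℕ) {l : ℕ} (w₀ : ℂ) (z₁ : Fin l → ℂ) :
    (leftAF s w₀ z₁).IsMultiplicative :=
  (isMultiplicative_twist _ (by simp) (by simp)).mul
    (isMultiplicative_prod _ _ fun _ => isMultiplicative_twist_divMuCoeff _ _)

theorem isMultiplicative_rightAF (s : ℕ) {k l : ℕ} (w : Fin k → ℂ) (z₂ : Fin l → ℂ) :
    (rightAF s w z₂).IsMultiplicative :=
  (isMultiplicative_prod _ _ fun _ => isMultiplicative_twist_divCoeff _ _).mul
    (isMultiplicative_prod _ _ fun _ => isMultiplicative_twist_divMuCoeff _ _)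

section

variable (s : ℕ) {k l : ℕ} (w₀ : ℂ) (w : Fin k → ℂ) (z₁ z₂ : Fin l → ℂ)

theorem diagCoeff_zero : diagCoeff s w₀ w z₁ z₂ 0 = 0 := by simp [diagCoeff]

theorem diagCoeff_one : diagCoeff s w₀ w z₁ z₂ 1 = 1 := by
  simp [diagCoeff, (isMultiplicative_leftAF s w₀ z₁).map_one,
    (isMultiplicative_rightAF s w z₂).map_one]

theorem diagCoeff_mul_of_coprime {m n : ℕ} (h : m.Coprime n) :
    diagCoeff s w₀ w z₁ z₂ (m * n) = diagCoeff s w₀ w z₁ z₂ m * diagCoeff s w₀ w z₁ z₂ n := by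
  simp only [diagCoeff, (isMultiplicative_leftAF s w₀ z₁).map_mul_of_coprime h,
    (isMultiplicative_rightAF s w z₂).map_mul_of_coprime h, Nat.cast_mul]
  rw [← mul_div_mul_comm]
  ring

/-- Since mnab = (ma)(nb) = N², the square root is N. This decouples (m, a) from (n, b). -/
theorem diagTerm_eq {m n a b N : ℕ} (h1 : m * a = N) (h2 : n * b = N) (hN : N ≠ 0) :
    diagTerm s w₀ w z₁ z₂ m n a b
      = (twist 1 w₀ m * rhoZ s z₁ a) * (sigmaW s w n * rhoZ s z₂ b) / N := by
  have hm : m ≠ 0 := fun h => hN (by rw [← h1, h, zero_mul])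
  have e : Real.sqrt ((m : ℝ) * n * a * b) = N := by
    rw [show (m : ℝ) * n * a * b = ((m * a : ℕ) : ℝ) * ((n * b : ℕ) : ℝ) by push_cast; ring,
      h1, h2, Real.sqrt_mul_self (by positivity)]
  rw [diagTerm, e, twist_apply _ _ hm]
  simp only [Pi.one_apply, Complex.ofReal_natCast]
  field_simp

theorem diagCoeff_eq_sum {N : ℕ} (hN : N ≠ 0) :
    diagCoeff s w₀ w z₁ z₂ N = ∑ x ∈ N.divisorsAntidiagonal, ∑ y ∈ N.divisorsAntidiagonal,
      diagTerm s w₀ w z₁ z₂ x.1 y.1 x.2 y.2 := by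
  rw [diagCoeff, leftAF, rightAF, ArithmeticFunction.mul_apply, ArithmeticFunction.mul_apply,
    Finset.sum_mul_sum, Finset.sum_div]
  refine Finset.sum_congr rfl fun x hx => ?_
  rw [Finset.sum_div]
  refine Finset.sum_congr rfl fun y hy => ?_
  rw [diagTerm_eq s w₀ w z₁ z₂ (Nat.mem_divisorsAntidiagonal.mp hx).1
    (Nat.mem_divisorsAntidiagonal.mp hy).1 hN, rhoZ_eq, rhoZ_eq, sigmaW_eq]

variable {s w₀ w z₁ z₂} in
theorem norm_diagCoeff_le (hs : 0 < s) {σ : ℝ} (h0 : σ ≤ w₀.re) (hw : ∀ i, σ ≤ (w i).re)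
    (h1 : ∀ i, σ ≤ (z₁ i).re) (h2 : ∀ i, σ ≤ (z₂ i).re) {N : ℕ} (hN : N ≠ 0) :
    ‖diagCoeff s w₀ w z₁ z₂ N‖
      ≤ (N.divisors.card : ℝ) ^ (k + 2 * l + 2) * (N : ℝ) ^ (-1 - 2 * σ) := by
  have hN' : (0 : ℝ) < N := by exact_mod_cast Nat.pos_of_ne_zero hN
  have hA : DivBound (leftAF s w₀ z₁) (0 + l + 1) σ :=
    (divBound_twist (by simp) h0).mul (divBound_rho hs h1)
  have hB : DivBound (rightAF s w z₂) (k + l + 1) σ :=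
    (divBound_sigma hs hw).mul (divBound_rho hs h2)
  rw [diagCoeff, norm_div, norm_mul, Complex.norm_natCast]
  calc ‖leftAF s w₀ z₁ N‖ * ‖rightAF s w z₂ N‖ / N
      ≤ ((N.divisors.card : ℝ) ^ (0 + l + 1) * (N : ℝ) ^ (-σ)) *
        ((N.divisors.card : ℝ) ^ (k + l + 1) * (N : ℝ) ^ (-σ)) / N := by
        gcongr
        · exact hA N hN
        · exact hB N hN
    _ = _ := by
        rw [show (-1 - 2 * σ) = -σ + -σ - 1 by ring, Real.rpow_sub_one hN'.ne',
          Real.rpow_add hN']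
        ring

end

/-- The divisor bound `d(n) ≪ n^ε`. -/
theorem exists_card_divisors_le {ε : ℝ} (hε : 0 < ε) :
    ∃ C : ℝ, 0 ≤ C ∧ ∀ n : ℕ, n ≠ 0 → (n.divisors.card : ℝ) ≤ C * (n : ℝ) ^ ε := by
  -- Primes p ≥ 2^(1/ε) have p^ε ≥ 2, so v + 1 ≤ 2^v ≤ p^(εv) at no cost. Each prime below P costs a
  -- factor B, by 1 + εv log 2 ≤ 2^(εv); there are at most P of them, whence the constant B^P.
  obtain ⟨P, hP⟩ := exists_nat_ge ((2 : ℝ) ^ (1 / ε))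
  set B : ℝ := max 1 (1 / (ε * Real.log 2)) with hB
  have hB1 : 1 ≤ B := le_max_left _ _
  have hl : 0 < ε * Real.log 2 := mul_pos hε (Real.log_pos one_lt_two)
  have key : ∀ p : ℕ, p.Prime → ∀ v : ℕ,
      ((v : ℝ) + 1) ≤ (if p < P then B else 1) * ((p : ℝ) ^ ε) ^ v := by
    intro p hp v
    have hp2 : (2 : ℝ) ≤ p := by exact_mod_cast hp.two_le
    split_ifs with h
    · have h2 : (2 : ℝ) ^ ε ≤ (p : ℝ) ^ ε := Real.rpow_le_rpow (by norm_num) hp2 hε.le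
      have h3 : ((2 : ℝ) ^ ε) ^ v = Real.exp (ε * Real.log 2 * v) := by
        rw [Real.rpow_def_of_pos two_pos, ← Real.exp_nat_mul]; ring_nf
      have h4 : ε * Real.log 2 * v + 1 ≤ Real.exp (ε * Real.log 2 * v) := Real.add_one_le_exp _
      have h5 : 1 ≤ B * (ε * Real.log 2) := by
        calc (1 : ℝ) = 1 / (ε * Real.log 2) * (ε * Real.log 2) := by field_simp
          _ ≤ _ := by gcongr; exact le_max_right _ _
      calc (v : ℝ) + 1 ≤ B * (ε * Real.log 2 * v + 1) := by
            have : (0 : ℝ) ≤ v := by positivity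
            nlinarith
        _ ≤ B * ((p : ℝ) ^ ε) ^ v := by
            gcongr
            exact (h4.trans h3.ge).trans (by gcongr)
    · have h2 : (2 : ℝ) ≤ (p : ℝ) ^ ε := by
        have : (2 : ℝ) ^ (1 / ε) ≤ p := hP.trans (by exact_mod_cast not_lt.mp h)
        calc (2 : ℝ) = ((2 : ℝ) ^ (1 / ε)) ^ ε := by
              rw [← Real.rpow_mul (by norm_num), one_div_mul_cancel hε.ne', Real.rpow_one]
          _ ≤ _ := Real.rpow_le_rpow (by positivity) this hε.le
      rw [one_mul]
      calc (v : ℝ) + 1 ≤ 2 ^ v := by exact_mod_cast Nat.lt_two_pow_self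
        _ ≤ _ := by gcongr
  refine ⟨B ^ P, by positivity, fun n hn => ?_⟩
  rw [Nat.card_divisors hn]
  have e : (n : ℝ) ^ ε = ∏ p ∈ n.primeFactors, ((p : ℝ) ^ ε) ^ (n.factorization p) := by
    conv_lhs => rw [← Nat.prod_factorization_pow_eq_self hn]
    rw [Finsupp.prod, Nat.support_factorization]
    push_cast
    rw [← Real.finsetProd_rpow _ _ (fun _ _ => by positivity)]
    refine Finset.prod_congr rfl fun p _ => ?_
    rw [← Real.rpow_natCast, ← Real.rpow_natCast, ← Real.rpow_mul (by positivity),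
      ← Real.rpow_mul (by positivity), mul_comm]
  rw [e]
  push_cast
  calc ∏ p ∈ n.primeFactors, ((n.factorization p : ℝ) + 1)
      ≤ ∏ p ∈ n.primeFactors, ((if p < P then B else 1) * ((p : ℝ) ^ ε) ^ (n.factorization p)) :=
        Finset.prod_le_prod (fun _ _ => by positivity)
          fun p hp => key p (Nat.prime_of_mem_primeFactors hp) _
    _ ≤ _ := by
        rw [Finset.prod_mul_distrib]
        gcongr
        rw [Finset.prod_ite, Finset.prod_const, Finset.prod_const_one, mul_one]
        refine pow_le_pow_right₀ hB1 ?_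
        calc _ ≤ (Finset.range P).card := Finset.card_le_card fun p hp => by
                simpa using (Finset.mem_filter.mp hp).2
          _ = P := Finset.card_range P

theorem summable_card_divisors_pow_mul_rpow (K : ℕ) {σ : ℝ} (hσ : 1 < σ) :
    Summable fun n : ℕ => (n.divisors.card : ℝ) ^ K * (n : ℝ) ^ (-σ) := by
  -- Small enough that εK ≤ (σ - 1)/2; the remaining exponent is then at most -(σ + 1)/2 < -1.
  set ε : ℝ := (σ - 1) / (2 * (K + 1)) with hε
  have hK : (0 : ℝ) < K + 1 := by positivity
  have hε0 : 0 < ε := div_pos (by linarith) (by positivity)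
  obtain ⟨C, hC, h⟩ := exists_card_divisors_le hε0
  have hεK : ε * K ≤ (σ - 1) / 2 := by
    rw [hε, div_mul_eq_mul_div, div_le_div_iff₀ (by positivity) (by positivity)]
    nlinarith
  have hs : Summable fun n : ℕ => C ^ K * (n : ℝ) ^ (-((σ + 1) / 2)) :=
    (Real.summable_nat_rpow.mpr (by linarith)).mul_left _
  refine hs.of_nonneg_of_le (fun n => by positivity) fun n => ?_
  rcases eq_or_ne n 0 with rfl | hn
  · simp only [Nat.divisors_zero, Finset.card_empty, Nat.cast_zero]
    rw [Real.zero_rpow (by linarith), mul_zero]; positivity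
  have hn1 : (1 : ℝ) ≤ n := by exact_mod_cast Nat.one_le_iff_ne_zero.mpr hn
  calc (n.divisors.card : ℝ) ^ K * (n : ℝ) ^ (-σ) ≤ (C * (n : ℝ) ^ ε) ^ K * (n : ℝ) ^ (-σ) := by
        gcongr; exact h n hn
    _ = C ^ K * ((n : ℝ) ^ (ε * K - σ)) := by
        rw [mul_pow, ← Real.rpow_natCast (_ ^ ε), ← Real.rpow_mul (by positivity), mul_assoc,
          ← Real.rpow_add (by linarith), sub_eq_add_neg]
    _ ≤ _ := by
        gcongr
        linarith

end FracMoment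

/-! ### Local factors: absolute convergence and regrouping -/

namespace FracMoment

open Finset

theorem sum_divisorsAntidiagonal_prime_pow {M : Type*} [AddCommMonoid M] (F : ℕ → ℕ → M) {p : ℕ}
    (hp : p.Prime) (e : ℕ) :
    ∑ x ∈ (p ^ e).divisorsAntidiagonal, F x.1 x.2
      = ∑ x ∈ Finset.HasAntidiagonal.antidiagonal e, F (p ^ x.1) (p ^ x.2) := by
  have hinj := Nat.pow_right_injective hp.two_le
  symm
  refine Finset.sum_bij (fun x _ => (p ^ x.1, p ^ x.2)) ?_ ?_ ?_ ?_
  · intro x hx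
    rw [Finset.HasAntidiagonal.mem_antidiagonal] at hx
    simp [← pow_add, hx, hp.ne_zero]
  · intro x _ y _ h
    simp only [Prod.mk.injEq] at h
    exact Prod.ext (hinj h.1) (hinj h.2)
  · rintro ⟨a, b⟩ h
    obtain ⟨h1, -⟩ := Nat.mem_divisorsAntidiagonal.mp h
    obtain ⟨i, -, rfl⟩ := (Nat.dvd_prime_pow hp).mp (h1 ▸ Dvd.intro _ rfl : a ∣ p ^ e)
    obtain ⟨j, -, rfl⟩ := (Nat.dvd_prime_pow hp).mp (h1 ▸ Dvd.intro_left _ rfl : b ∣ p ^ e)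
    simp only [← pow_add] at h1
    exact ⟨(i, j), by simpa using hinj h1, rfl⟩
  · intro _ _
    rfl

/-- The exponents in `DiagExp`, grouped by the exponent of `ma = nb`. -/
def diagExpEquiv :
    (Σ N : ℕ, {x : ℕ × ℕ // x ∈ Finset.HasAntidiagonal.antidiagonal N} ×
      {x : ℕ × ℕ // x ∈ Finset.HasAntidiagonal.antidiagonal N})
      ≃ DiagExp where
  toFun x := ⟨(x.2.1.1.1, x.2.2.1.1, x.2.1.1.2, x.2.2.1.2), by
    have h1 := Finset.HasAntidiagonal.mem_antidiagonal.mp x.2.1.2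
    have h2 := Finset.HasAntidiagonal.mem_antidiagonal.mp x.2.2.2
    simp only
    omega⟩
  invFun e := ⟨e.1.1 + e.1.2.2.1, ⟨(e.1.1, e.1.2.2.1), by simp⟩,
    ⟨(e.1.2.1, e.1.2.2.2), by simp [e.2]⟩⟩
  left_inv := by
    rintro ⟨N, ⟨⟨a, b⟩, h1⟩, ⟨⟨c, d⟩, h2⟩⟩
    obtain rfl := Finset.HasAntidiagonal.mem_antidiagonal.mp h1
    rfl
  right_inv := by
    rintro ⟨⟨a, b, c, d⟩, h⟩
    rfl

theorem summable_add_one_pow_mul_geometric (K : ℕ) {r : ℝ} (h0 : 0 < r) (h1 : r < 1) :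
    Summable fun n : ℕ => ((n : ℝ) + 1) ^ K * r ^ n := by
  have h := (summable_nat_add_iff 1).mpr
    (summable_pow_mul_geometric_of_norm_lt_one K (r := r) (by rwa [Real.norm_of_nonneg h0.le]))
  refine (h.mul_left r⁻¹).congr fun n => ?_
  push_cast
  rw [pow_succ]
  field_simp

section

variable {s : ℕ} {k l : ℕ} {w₀ : ℂ} {w : Fin k → ℂ} {z₁ z₂ : Fin l → ℂ}

/-- Dropping the constraint on the exponents only enlarges the sum. Each exponent picks up p^(-1/2)
from the square root and at most p^(-σ) from its variable, so the sum is dominated by a product of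
four series ∑ (n+1)^K r^n with r = p^(-σ-1/2), and r < 1 because σ > -1/2. -/
theorem summable_norm_localTerm (hs : 0 < s) {σ : ℝ} (hσ : -(1 / 2) < σ) (h0 : σ ≤ w₀.re)
    (hw : ∀ i, σ ≤ (w i).re) (h1 : ∀ i, σ ≤ (z₁ i).re) (h2 : ∀ i, σ ≤ (z₂ i).re)
    {p : ℕ} (hp : p.Prime) :
    Summable fun e : DiagExp => ‖localTerm s w₀ w z₁ z₂ p e‖ := by
  have hp0 : (0 : ℝ) < p := by exact_mod_cast hp.pos
  have hp1 : (1 : ℝ) < p := by exact_mod_cast hp.one_lt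
  set r : ℝ := (p : ℝ) ^ (-σ - 1 / 2) with hr
  have hr0 : 0 < r := Real.rpow_pos_of_pos hp0 _
  have hr1 : r < 1 := Real.rpow_lt_one_of_one_lt_of_neg hp1 (by linarith)
  have hg := fun K => summable_add_one_pow_mul_geometric K hr0 hr1
  have hpos : ∀ K, 0 ≤ fun n : ℕ => ((n : ℝ) + 1) ^ K * r ^ n := fun K n => by
    simp only [Pi.zero_apply]; positivity
  have hsum := (hg 0).mul_of_nonneg ((hg k).mul_of_nonneg ((hg l).mul_of_nonneg (hg l)
    (hpos l) (hpos l)) (hpos k) (fun _ => mul_nonneg (hpos l _) (hpos l _))) (hpos 0)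
    (fun _ => mul_nonneg (hpos k _) (mul_nonneg (hpos l _) (hpos l _)))
  refine (hsum.comp_injective (Subtype.val_injective (p := fun e : ℕ × ℕ × ℕ × ℕ =>
    e.1 + e.2.2.1 = e.2.1 + e.2.2.2))).of_nonneg_of_le (fun _ => norm_nonneg _) ?_
  rintro ⟨⟨i, j, a, b⟩, h⟩
  have hw0 : ‖((p ^ i : ℕ) : ℂ) ^ w₀‖ = ((p ^ i : ℕ) : ℝ) ^ w₀.re :=
    Complex.norm_natCast_cpow_of_pos (pow_pos hp.pos _) _
  have hE : ((p : ℝ) ^ σ) ^ i ≤ ((p ^ i : ℕ) : ℝ) ^ w₀.re := by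
    rw [← Real.rpow_natCast, ← Real.rpow_mul hp0.le, mul_comm, Real.rpow_mul hp0.le,
      Real.rpow_natCast, Nat.cast_pow]
    exact Real.rpow_le_rpow_of_exponent_le (one_le_pow₀ hp1.le) h0
  have hD : Real.sqrt (((p ^ i : ℕ) : ℝ) * ((p ^ j : ℕ) : ℝ) * ((p ^ a : ℕ) : ℝ)
      * ((p ^ b : ℕ) : ℝ)) = ((p : ℝ) ^ (1 / 2 : ℝ)) ^ (i + j + a + b) := by
    push_cast
    rw [← pow_add, ← pow_add, ← pow_add, Real.sqrt_eq_rpow, ← Real.rpow_natCast,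
      ← Real.rpow_natCast, ← Real.rpow_mul hp0.le, ← Real.rpow_mul hp0.le, mul_comm]
  have hB1 := (divBound_sigma hs hw).prime_pow hp j
  have hB2 := (divBound_rho hs h1).prime_pow hp a
  have hB3 := (divBound_rho hs h2).prime_pow hp b
  rw [← sigmaW_eq] at hB1
  rw [← rhoZ_eq] at hB2 hB3
  have er : r = (p : ℝ) ^ (-σ) / (p : ℝ) ^ (1 / 2 : ℝ) := by rw [hr, Real.rpow_sub hp0]
  have es : (p : ℝ) ^ (-σ) = ((p : ℝ) ^ σ)⁻¹ := Real.rpow_neg hp0.le _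
  have hs0 : 0 < (p : ℝ) ^ σ := Real.rpow_pos_of_pos hp0 _
  have hh0 : 0 < (p : ℝ) ^ (1 / 2 : ℝ) := Real.rpow_pos_of_pos hp0 _
  simp only [Function.comp, localTerm, diagTerm, norm_div, norm_mul, Complex.norm_real, hw0,
    hD, Real.norm_of_nonneg (pow_nonneg hh0.le _)]
  calc _ ≤ (((j : ℝ) + 1) ^ k * ((p : ℝ) ^ (-σ)) ^ j) * (((a : ℝ) + 1) ^ l * ((p : ℝ) ^ (-σ)) ^ a)
        * (((b : ℝ) + 1) ^ l * ((p : ℝ) ^ (-σ)) ^ b)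
        / (((p : ℝ) ^ (1 / 2 : ℝ)) ^ (i + j + a + b) * ((p : ℝ) ^ σ) ^ i) := by gcongr
    _ = _ := by
      rw [er, es]
      simp only [div_pow, pow_add, inv_pow, pow_zero, one_mul]
      field_simp

/-- Absolute convergence permits grouping the quadruples by the exponent N of ma = nb = p^N; each
group is the finite sum in `diagCoeff_eq_sum`. -/
theorem tsum_localTerm {p : ℕ} (hp : p.Prime)
    (h : Summable fun e : DiagExp => ‖localTerm s w₀ w z₁ z₂ p e‖) :
    ∑' e : DiagExp, localTerm s w₀ w z₁ z₂ p e = ∑' N : ℕ, diagCoeff s w₀ w z₁ z₂ (p ^ N) := by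
  have h' : Summable fun x => localTerm s w₀ w z₁ z₂ p (diagExpEquiv x) :=
    (diagExpEquiv.summable_iff (f := localTerm s w₀ w z₁ z₂ p)).mpr h.of_norm
  rw [← diagExpEquiv.tsum_eq, h'.tsum_sigma' (fun _ => Summable.of_finite)]
  refine tsum_congr fun N => ?_
  rw [diagCoeff_eq_sum _ _ _ _ _ (pow_ne_zero _ hp.ne_zero),
    sum_divisorsAntidiagonal_prime_pow (fun x1 x2 => ∑ y ∈ (p ^ N).divisorsAntidiagonal,
      diagTerm s w₀ w z₁ z₂ x1 y.1 x2 y.2) hp, tsum_fintype, Fintype.sum_prod_type,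
    ← Finset.sum_coe_sort (Finset.HasAntidiagonal.antidiagonal N)]
  refine Finset.sum_congr rfl fun x _ => ?_
  rw [sum_divisorsAntidiagonal_prime_pow (fun y1 y2 =>
      diagTerm s w₀ w z₁ z₂ (p ^ x.1.1) y1 (p ^ x.1.2) y2) hp,
    ← Finset.sum_coe_sort (Finset.HasAntidiagonal.antidiagonal N)]
  rfl

end

end FracMoment

/-! ### First-order expansion of the Euler factors -/

namespace FracMoment

open Finset Filter Asymptotics Topology

/-- `f(p) = 1 + u(p) + O(p^{-5/4})` with `u(p) = O(p^{-5/8})`, as `p` runs over the primes. -/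
def FirstOrder (f u : Nat.Primes → ℂ) : Prop :=
  ((fun p => f p - 1 - u p) =O[cofinite] fun p : Nat.Primes => ((p : ℝ) ^ (-(5 / 8) : ℝ)) ^ 2) ∧
    u =O[cofinite] fun p : Nat.Primes => (p : ℝ) ^ (-(5 / 8) : ℝ)

theorem tendsto_primes_rpow :
    Tendsto (fun p : Nat.Primes => (p : ℝ) ^ (-(5 / 8) : ℝ)) cofinite (𝓝 0) := by
  have h1 : Tendsto (fun p : Nat.Primes => (p : ℕ)) cofinite atTop := by
    rw [← Nat.cofinite_eq_atTop]
    exact Nat.Primes.coe_nat_injective.tendsto_cofinite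
  exact (tendsto_rpow_neg_atTop (by norm_num : (0 : ℝ) < 5 / 8)).comp
    (tendsto_natCast_atTop_atTop.comp h1)

theorem primes_rpow_isBigO_one :
    (fun p : Nat.Primes => (p : ℝ) ^ (-(5 / 8) : ℝ)) =O[cofinite] fun _ => (1 : ℝ) :=
  tendsto_primes_rpow.isBigO_one ℝ

theorem primes_rpow_sq_isBigO :
    (fun p : Nat.Primes => ((p : ℝ) ^ (-(5 / 8) : ℝ)) ^ 2) =O[cofinite]
      fun p : Nat.Primes => (p : ℝ) ^ (-(5 / 8) : ℝ) := by
  simpa [sq] using primes_rpow_isBigO_one.mul (isBigO_refl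
    (fun p : Nat.Primes => (p : ℝ) ^ (-(5 / 8) : ℝ)) cofinite)

theorem FirstOrder.one : FirstOrder (fun _ => 1) (fun _ => 0) :=
  ⟨by simpa using isBigO_zero _ _, isBigO_zero _ _⟩

/-- From fg - 1 - u - v = (f - 1 - u)g + (1 + u)(g - 1 - v) + uv: linear terms add, and every other
contribution is quadratic in p^(-5/8). -/
theorem FirstOrder.mul {f g u v : Nat.Primes → ℂ} (hf : FirstOrder f u) (hg : FirstOrder g v) :
    FirstOrder (fun p => f p * g p) (fun p => u p + v p) := by
  refine ⟨?_, hf.2.add hg.2⟩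
  have h1 : (fun _ : Nat.Primes => (1 : ℂ)) =O[cofinite] fun _ => (1 : ℝ) :=
    isBigO_const_const _ one_ne_zero _
  have hv : v =O[cofinite] fun _ => (1 : ℝ) := hg.2.trans primes_rpow_isBigO_one
  have hu : u =O[cofinite] fun _ => (1 : ℝ) := hf.2.trans primes_rpow_isBigO_one
  have hgb : g =O[cofinite] fun _ => (1 : ℝ) := by
    have := ((hg.1.trans (primes_rpow_sq_isBigO.trans primes_rpow_isBigO_one)).add h1).add hv
    refine this.congr_left fun p => ?_
    ring
  have a1 := hf.1.mul hgb
  have a2 := (h1.add hu).mul hg.1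
  have a3 := hf.2.mul hg.2
  simp only [mul_one, one_mul, ← sq] at a1 a2 a3
  refine ((a1.add a2).add a3).congr_left fun p => ?_
  ring

theorem FirstOrder.prod {ι : Type*} (t : Finset ι) {f u : ι → Nat.Primes → ℂ}
    (h : ∀ i, FirstOrder (f i) (u i)) :
    FirstOrder (fun p => ∏ i ∈ t, f i p) (fun p => ∑ i ∈ t, u i p) := by
  classical
  induction t using Finset.induction_on with
  | empty => simpa using FirstOrder.one
  | insert a t ha ih =>
    simp only [Finset.prod_insert ha, Finset.sum_insert ha]
    exact (h a).mul ih

/-- Write the power as exp(α log(1 - z)) near z = 0; both the logarithm and the exponential have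
quadratic remainders after their linear terms. -/
theorem isBigO_one_sub_cpow (α : ℂ) :
    (fun z : ℂ => (1 - z) ^ α - 1 + α * z) =O[𝓝 0] fun z => z ^ 2 := by
  have hneg : Tendsto (fun z : ℂ => -z) (𝓝 0) (𝓝 0) := by
    simpa using (continuous_neg (G := ℂ)).tendsto 0
  have hlog : (fun z : ℂ => Complex.log (1 - z) + z) =O[𝓝 0] fun z => z ^ 2 := by
    have := Complex.log_sub_self_isBigO.comp_tendsto hneg
    refine (this.congr (fun z => ?_) fun z => ?_)
    · simp [sub_eq_add_neg]
    · simp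
  have hz2 : (fun z : ℂ => z ^ 2) =O[𝓝 0] fun z : ℂ => z := by
    have : Tendsto (fun z : ℂ => z) (𝓝 0) (𝓝 0) := tendsto_id
    simpa [sq] using (this.isBigO_one ℂ).mul (isBigO_refl (fun z : ℂ => z) (𝓝 0))
  have hlog1 : (fun z : ℂ => α * Complex.log (1 - z)) =O[𝓝 0] fun z => z := by
    refine IsBigO.const_mul_left ?_ α
    refine ((hlog.trans hz2).sub (isBigO_refl (fun z : ℂ => z) (𝓝 0))).congr_left fun z => ?_
    ring
  have ht : Tendsto (fun z : ℂ => α * Complex.log (1 - z)) (𝓝 0) (𝓝 0) :=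
    hlog1.trans_tendsto tendsto_id
  have hexp : (fun x : ℂ => Complex.exp x - 1 - x) =O[𝓝 0] fun x => x ^ 2 := by
    refine IsBigO.of_bound 1 ?_
    filter_upwards [Metric.closedBall_mem_nhds (0 : ℂ) one_pos] with x hx
    rw [one_mul, norm_pow]
    exact Complex.norm_exp_sub_one_sub_id_le (by simpa using hx)
  have h1 := (hexp.comp_tendsto ht).trans (hlog1.pow 2)
  have h2 := h1.add (hlog.const_mul_left α)
  refine h2.congr' ?_ EventuallyEq.rfl
  have hne : ∀ᶠ z : ℂ in 𝓝 0, 1 - z ≠ 0 := by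
    have : ContinuousAt (fun z : ℂ => 1 - z) 0 := by fun_prop
    exact this.eventually_ne (by simp)
  filter_upwards [hne] with z hz
  simp only [Function.comp, Complex.cpow_def_of_ne_zero hz]
  rw [mul_comm (Complex.log _) α]
  ring

theorem norm_prime_cpow_le (p : Nat.Primes) {u : ℂ} (hu : 5 / 8 ≤ u.re) :
    ‖(p : ℂ) ^ (-u)‖ ≤ (p : ℝ) ^ (-(5 / 8) : ℝ) := by
  rw [Complex.norm_natCast_cpow_of_pos p.2.pos]
  exact Real.rpow_le_rpow_of_exponent_le (by exact_mod_cast p.2.one_le) (by simpa using hu)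

/-- The threshold 5/8 = 1 - 2·(3/16) is the least real part of 1 + u + v for u, v in the half-plane
of part (i). -/
theorem firstOrder_one_sub_cpow (α : ℂ) {u : ℂ} (hu : 5 / 8 ≤ u.re) :
    FirstOrder (fun p => (1 - (p : ℂ) ^ (-u)) ^ α) (fun p => -α * (p : ℂ) ^ (-u)) := by
  have hb : (fun p : Nat.Primes => (p : ℂ) ^ (-u)) =O[cofinite]
      fun p : Nat.Primes => (p : ℝ) ^ (-(5 / 8) : ℝ) :=
    IsBigO.of_bound' (Eventually.of_forall fun p => (norm_prime_cpow_le p hu).trans (le_abs_self _))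
  have ht : Tendsto (fun p : Nat.Primes => (p : ℂ) ^ (-u)) cofinite (𝓝 0) :=
    hb.trans_tendsto tendsto_primes_rpow
  refine ⟨?_, hb.const_mul_left _⟩
  refine (((isBigO_one_sub_cpow α).comp_tendsto ht).trans (hb.pow 2)).congr_left fun p => ?_
  simp only [Function.comp]
  ring

theorem firstOrder_eulerPow (α : ℝ) {u : ℂ} (hu : 5 / 8 ≤ u.re) :
    FirstOrder (fun p => eulerPow α p u) (fun p => -α * (p : ℂ) ^ (-u)) :=
  firstOrder_one_sub_cpow α hu

theorem firstOrder_eulerPow_inv (α : ℝ) {u : ℂ} (hu : 5 / 8 ≤ u.re) :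
    FirstOrder (fun p => (eulerPow α p u)⁻¹) (fun p => α * (p : ℂ) ^ (-u)) := by
  have := firstOrder_one_sub_cpow (-α) hu
  simpa only [Complex.cpow_neg, neg_neg, eulerPow] using this

theorem mul_apply_prime {F G : ArithmeticFunction ℂ} (hF : F 1 = 1) (hG : G 1 = 1) {p : ℕ}
    (hp : p.Prime) : (F * G) p = F p + G p := by
  have := sum_divisorsAntidiagonal_prime_pow (fun a b => F a * G b) hp 1
  rw [ArithmeticFunction.mul_apply, ← pow_one p, this]
  simp [Finset.Nat.antidiagonal_succ, hF, hG, add_comm]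

theorem prod_apply_prime {k : ℕ} (F : Fin k → ArithmeticFunction ℂ)
    (hF : ∀ i, (F i).IsMultiplicative) {p : ℕ} (hp : p.Prime) : (∏ i, F i) p = ∑ i, F i p := by
  induction k with
  | zero => simp [ArithmeticFunction.one_apply_ne hp.ne_one]
  | succ k ih =>
    rw [Fin.prod_univ_succ, Fin.sum_univ_succ, mul_apply_prime (hF 0).map_one
      (isMultiplicative_prod _ (fun i : Fin k => F i.succ) fun i => hF _).map_one hp,
      ih (fun i => F i.succ) fun i => hF _]

section

variable {s : ℕ} {k l : ℕ} {w₀ : ℂ} {w : Fin k → ℂ} {z₁ z₂ : Fin l → ℂ}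

theorem leftAF_prime {p : ℕ} (hp : p.Prime) :
    leftAF s w₀ z₁ p = (p : ℂ) ^ (-w₀) - (1 / s) * ∑ j, (p : ℂ) ^ (-z₁ j) := by
  rw [leftAF, mul_apply_prime (isMultiplicative_twist _ (by simp) (by simp)).map_one
    (isMultiplicative_prod _ _ fun _ => isMultiplicative_twist_divMuCoeff _ _).map_one hp,
    prod_apply_prime _ (fun _ => isMultiplicative_twist_divMuCoeff _ _) hp]
  simp only [twist_apply _ _ hp.ne_zero, divMuCoeff, genDivisor_prime _ hp,
    ArithmeticFunction.moebius_apply_prime hp, Complex.cpow_neg, Finset.mul_sum, sub_eq_add_neg,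
    ← Finset.sum_neg_distrib]
  simp [div_eq_mul_inv]

theorem rightAF_prime {p : ℕ} (hp : p.Prime) :
    rightAF s w z₂ p
      = (1 / (2 * s)) * ∑ i, (p : ℂ) ^ (-w i) - (1 / s) * ∑ j, (p : ℂ) ^ (-z₂ j) := by
  rw [rightAF, mul_apply_prime
    (isMultiplicative_prod _ _ fun _ => isMultiplicative_twist_divCoeff _ _).map_one
    (isMultiplicative_prod _ _ fun _ => isMultiplicative_twist_divMuCoeff _ _).map_one hp,
    prod_apply_prime _ (fun _ => isMultiplicative_twist_divMuCoeff _ _) hp,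
    prod_apply_prime _ (fun _ => isMultiplicative_twist_divCoeff _ _) hp]
  simp only [twist_apply _ _ hp.ne_zero, divMuCoeff, divCoeff, genDivisor_prime _ hp,
    ArithmeticFunction.moebius_apply_prime hp, Complex.cpow_neg, Finset.mul_sum, sub_eq_add_neg,
    ← Finset.sum_neg_distrib]
  simp [div_eq_mul_inv]

/-- Multiplying out (p^(-w₀) - (1/s)∑ p^(-z₁ⱼ)) · ((1/2s)∑ p^(-wᵢ) - (1/s)∑ p^(-z₂ₕ)) / p gives four
families of terms, and the four families of zeta factors carry precisely the opposite linear terms.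
This cancellation is what dictates the exponents in η_l. -/
theorem diagCoeff_prime {p : ℕ} (hp : p.Prime) :
    diagCoeff s w₀ w z₁ z₂ p
      + ((∑ i, -((1 / (2 * (s : ℝ)) : ℝ) : ℂ) * (p : ℂ) ^ (-(1 + w₀ + w i)))
        + (∑ j, ∑ h, -((1 / (s : ℝ) ^ 2 : ℝ) : ℂ) * (p : ℂ) ^ (-(1 + z₁ j + z₂ h)))
        + ((∑ i, ∑ j, ((1 / (2 * (s : ℝ) ^ 2) : ℝ) : ℂ) * (p : ℂ) ^ (-(1 + w i + z₁ j)))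
          + ∑ h, ((1 / (s : ℝ) : ℝ) : ℂ) * (p : ℂ) ^ (-(1 + w₀ + z₂ h)))) = 0 := by
  have hp0 : (p : ℂ) ≠ 0 := by exact_mod_cast hp.ne_zero
  have e : ∀ u v : ℂ, (p : ℂ) ^ (-(1 + u + v)) = (p : ℂ) ^ (-u) * (p : ℂ) ^ (-v) / p := by
    intro u v
    rw [show -(1 + u + v) = -u + -v - 1 by ring, Complex.cpow_sub _ _ hp0, Complex.cpow_add _ _ hp0,
      Complex.cpow_one]
  rw [diagCoeff, leftAF_prime hp, rightAF_prime hp]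
  simp only [e]
  have e3 : ∑ i, ∑ j, ((1 / (2 * (s : ℝ) ^ 2) : ℝ) : ℂ) *
        ((p : ℂ) ^ (-w i) * (p : ℂ) ^ (-z₁ j) / p)
      = ((1 / (2 * (s : ℝ) ^ 2) : ℝ) : ℂ) / p *
        ((∑ i, (p : ℂ) ^ (-w i)) * ∑ j, (p : ℂ) ^ (-z₁ j)) := by
    rw [Finset.sum_mul_sum, Finset.mul_sum]
    refine Finset.sum_congr rfl fun i _ => ?_
    rw [Finset.mul_sum]
    exact Finset.sum_congr rfl fun j _ => by ring
  have e2 : ∑ j, ∑ h, -((1 / (s : ℝ) ^ 2 : ℝ) : ℂ) * ((p : ℂ) ^ (-z₁ j) * (p : ℂ) ^ (-z₂ h) / p)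
      = -((1 / (s : ℝ) ^ 2 : ℝ) : ℂ) / p *
        ((∑ j, (p : ℂ) ^ (-z₁ j)) * ∑ h, (p : ℂ) ^ (-z₂ h)) := by
    rw [Finset.sum_mul_sum, Finset.mul_sum]
    refine Finset.sum_congr rfl fun i _ => ?_
    rw [Finset.mul_sum]
    exact Finset.sum_congr rfl fun j _ => by ring
  have e1 : ∀ (m : ℕ) (c : ℂ) (v : Fin m → ℂ),
      ∑ i, c * ((p : ℂ) ^ (-w₀) * (p : ℂ) ^ (-v i) / p)
        = c / p * (p : ℂ) ^ (-w₀) * ∑ i, (p : ℂ) ^ (-v i) := by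
    intro m c v
    rw [Finset.mul_sum]
    exact Finset.sum_congr rfl fun j _ => by ring
  rw [e1, e1, e2, e3]
  push_cast
  ring

theorem norm_diagCoeff_prime_pow_le (hs : 0 < s) (h0 : -(3 / 16) ≤ w₀.re)
    (hw : ∀ i, -(3 / 16) ≤ (w i).re) (h1 : ∀ i, -(3 / 16) ≤ (z₁ i).re)
    (h2 : ∀ i, -(3 / 16) ≤ (z₂ i).re) {p : ℕ} (hp : p.Prime) (N : ℕ) :
    ‖diagCoeff s w₀ w z₁ z₂ (p ^ N)‖
      ≤ ((N : ℝ) + 1) ^ (k + 2 * l + 2) * ((p : ℝ) ^ (-(5 / 8) : ℝ)) ^ N := by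
  have h := norm_diagCoeff_le hs h0 hw h1 h2 (pow_ne_zero N hp.ne_zero)
  rw [Nat.divisors_prime_pow hp, Finset.card_map, Finset.card_range] at h
  refine h.trans (le_of_eq ?_)
  push_cast
  rw [← Real.rpow_natCast (_ ^ (-(5 / 8) : ℝ)), ← Real.rpow_mul (by positivity),
    ← Real.rpow_natCast (p : ℝ), ← Real.rpow_mul (by positivity)]
  ring_nf

theorem prime_rpow_le (p : Nat.Primes) :
    (p : ℝ) ^ (-(5 / 8) : ℝ) ≤ (2 : ℝ) ^ (-(5 / 8) : ℝ) :=
  Real.rpow_le_rpow_of_nonpos two_pos (by exact_mod_cast p.2.two_le) (by norm_num)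

/-- Every term with N ≥ 2 contains ε²; replacing the other powers of ε by powers of r makes the
constant independent of ε. It is applied with ε = p^(-5/8) and r = 2^(-5/8), hence uniformly in p.
-/
theorem norm_tsum_sub_le {a : ℕ → ℂ} {K : ℕ} {ε r : ℝ} (hε : 0 < ε) (hεr : ε ≤ r) (hr : r < 1)
    (h0 : a 0 = 1) (ha : ∀ N, ‖a N‖ ≤ ((N : ℝ) + 1) ^ K * ε ^ N) :
    ‖∑' N, a N - 1 - a 1‖ ≤ (∑' N : ℕ, ((N : ℝ) + 3) ^ K * r ^ N) * ε ^ 2 := by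
  have hr0 : 0 < r := hε.trans_le hεr
  have hsum : Summable fun N => ‖a N‖ :=
    (summable_add_one_pow_mul_geometric K hε (hεr.trans_lt hr)).of_nonneg_of_le
      (fun _ => norm_nonneg _) ha
  have hsum2 : Summable fun N => ‖a (N + 2)‖ := (summable_nat_add_iff 2).mpr hsum
  have hsr : Summable fun N : ℕ => ((N : ℝ) + 3) ^ K * r ^ N := by
    have h := ((summable_nat_add_iff 2).mpr (summable_add_one_pow_mul_geometric K hr0 hr)).mul_left
      (r ^ 2)⁻¹
    refine h.congr fun N => ?_
    have e : ((N + 2 : ℕ) : ℝ) + 1 = N + 3 := by push_cast; ring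
    rw [pow_add r N 2, e]
    field_simp
  have e : ∑' N, a N - 1 - a 1 = ∑' i, a (i + 2) := by
    rw [← hsum.of_norm.sum_add_tsum_nat_add 2, Finset.sum_range_succ, Finset.sum_range_one, h0]
    ring
  rw [e, ← tsum_mul_right]
  refine (norm_tsum_le_tsum_norm hsum2).trans
    (Summable.tsum_le_tsum (fun N => ?_) hsum2 (hsr.mul_right _))
  have h := ha (N + 2)
  have e : ((N + 2 : ℕ) : ℝ) + 1 = N + 3 := by push_cast; ring
  rw [e, pow_add ε N 2, ← mul_assoc] at h
  refine h.trans ?_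
  gcongr

theorem firstOrder_tsum_diagCoeff (hs : 0 < s) (h0 : -(3 / 16) ≤ w₀.re)
    (hw : ∀ i, -(3 / 16) ≤ (w i).re) (h1 : ∀ i, -(3 / 16) ≤ (z₁ i).re)
    (h2 : ∀ i, -(3 / 16) ≤ (z₂ i).re) :
    FirstOrder (fun p => ∑' N : ℕ, diagCoeff s w₀ w z₁ z₂ ((p : ℕ) ^ N))
      (fun p => diagCoeff s w₀ w z₁ z₂ p) := by
  have hb := fun (p : Nat.Primes) N => norm_diagCoeff_prime_pow_le hs h0 hw h1 h2 p.2 N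
  constructor
  · refine IsBigO.of_bound (∑' N : ℕ, ((N : ℝ) + 3) ^ (k + 2 * l + 2) *
      ((2 : ℝ) ^ (-(5 / 8) : ℝ)) ^ N) (Eventually.of_forall fun p => ?_)
    have hε0 : 0 < (p : ℝ) ^ (-(5 / 8) : ℝ) := Real.rpow_pos_of_pos (by exact_mod_cast p.2.pos) _
    have h := norm_tsum_sub_le hε0 (prime_rpow_le p)
      (Real.rpow_lt_one_of_one_lt_of_neg one_lt_two (by norm_num)) (by simp [diagCoeff_one]) (hb p)
    rw [pow_one] at h
    rwa [Real.norm_of_nonneg (by positivity)]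
  · refine IsBigO.of_bound (2 ^ (k + 2 * l + 2)) (Eventually.of_forall fun p => ?_)
    have := hb p 1
    rw [Real.norm_of_nonneg (by positivity)]
    rw [pow_one, pow_one, Nat.cast_one, one_add_one_eq_two] at this
    exact this

theorem summable_norm_etaFactor_sub_one (hs : 0 < s) (h0 : -(3 / 16) ≤ w₀.re)
    (hw : ∀ i, -(3 / 16) ≤ (w i).re) (h1 : ∀ i, -(3 / 16) ≤ (z₁ i).re)
    (h2 : ∀ i, -(3 / 16) ≤ (z₂ i).re) :
    Summable fun p : Nat.Primes => ‖etaFactor s w₀ w z₁ z₂ p - 1‖ := by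
  have hre : ∀ u v : ℂ, -(3 / 16) ≤ u.re → -(3 / 16) ≤ v.re → 5 / 8 ≤ (1 + u + v).re := by
    intro u v hu hv
    simp only [Complex.add_re, Complex.one_re]
    linarith
  have A := firstOrder_tsum_diagCoeff hs h0 hw h1 h2
  have B1 := FirstOrder.prod univ fun i =>
    firstOrder_eulerPow (1 / (2 * (s : ℝ))) (hre w₀ (w i) h0 (hw i))
  have B2 := FirstOrder.prod univ fun j => FirstOrder.prod univ fun h =>
    firstOrder_eulerPow (1 / (s : ℝ) ^ 2) (hre (z₁ j) (z₂ h) (h1 j) (h2 h))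
  have B3 := FirstOrder.prod univ fun i => FirstOrder.prod univ fun j =>
    firstOrder_eulerPow_inv (1 / (2 * (s : ℝ) ^ 2)) (hre (w i) (z₁ j) (hw i) (h1 j))
  have B4 := FirstOrder.prod univ fun h =>
    firstOrder_eulerPow_inv (1 / (s : ℝ)) (hre w₀ (z₂ h) h0 (h2 h))
  -- The linear terms of the five expansions sum to zero by `diagCoeff_prime`, so only the
  -- O(p^(-5/4)) remainder survives.
  have C := (A.mul ((B1.mul B2).mul (B3.mul B4))).1
  refine summable_of_isBigO (g := fun p : Nat.Primes => (p : ℝ) ^ (-(5 / 4) : ℝ))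
    (Nat.Primes.summable_rpow.mpr (by norm_num)) ?_
  refine (C.congr (fun p => ?_) fun p => ?_).norm_left
  · have hloc := tsum_localTerm p.2 (summable_norm_localTerm (w := w) hs
      (by norm_num : -(1 / 2 : ℝ) < -(3 / 16)) h0 hw h1 h2 p.2)
    beta_reduce
    rw [diagCoeff_prime p.2, sub_zero, etaFactor, hloc]
    simp only [Finset.prod_inv_distrib, div_eq_mul_inv (_ * _ : ℂ), mul_inv (_ : ℂ)]
  · rw [← Real.rpow_natCast, ← Real.rpow_mul (by positivity)]
    norm_num

end

end FracMoment

/-! ### Factorization of the diagonal series through powers of ζ -/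

namespace FracMoment

open Finset

theorem summable_log_one_sub_prime_cpow {u : ℂ} (hu : 1 < u.re) :
    Summable fun p : Nat.Primes => -Complex.log (1 - (p : ℂ) ^ (-u)) := by
  refine (DirichletCharacter.summable_neg_log_one_sub_mul_prime_cpow
    (1 : DirichletCharacter ℂ 1) hu).congr fun p => ?_
  rw [MulChar.one_apply (isUnit_of_subsingleton _), one_mul]

theorem one_sub_prime_cpow_ne_zero (p : Nat.Primes) {u : ℂ} (hu : 0 < u.re) :
    1 - (p : ℂ) ^ (-u) ≠ 0 := by
  have h : ‖(p : ℂ) ^ (-u)‖ < 1 := by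
    rw [Complex.norm_natCast_cpow_of_pos p.2.pos]
    exact Real.rpow_lt_one_of_one_lt_of_neg (by exact_mod_cast p.2.one_lt) (by simpa using hu)
  intro h0
  rw [← sub_eq_zero.mp h0, norm_one] at h
  exact lt_irrefl _ h

/-- Since `logZeta` is itself the sum of the principal logarithms of the Euler factors,
exponentiating -α times that convergent sum gives the product of principal powers, with no ambiguity
of branch. -/
theorem hasProd_one_sub_prime_cpow (α : ℂ) {u : ℂ} (hu : 1 < u.re) :
    HasProd (fun p : Nat.Primes => (1 - (p : ℂ) ^ (-u)) ^ α) (Complex.exp (-α * logZeta u)) := by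
  refine ((summable_log_one_sub_prime_cpow hu).hasSum.mul_left (-α)).cexp.congr_fun fun p => ?_
  rw [Function.comp, Complex.cpow_def_of_ne_zero (one_sub_prime_cpow_ne_zero p (by linarith))]
  ring_nf

theorem hasProd_eulerPow (α : ℝ) {u : ℂ} (hu : 1 < u.re) :
    HasProd (fun p : Nat.Primes => eulerPow α p u) (zetaPow α u)⁻¹ := by
  have := hasProd_one_sub_prime_cpow α hu
  rwa [neg_mul, Complex.exp_neg] at this

theorem hasProd_eulerPow_inv (α : ℝ) {u : ℂ} (hu : 1 < u.re) :
    HasProd (fun p : Nat.Primes => (eulerPow α p u)⁻¹) (zetaPow α u) := by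
  have := hasProd_one_sub_prime_cpow (-α) hu
  simp only [Complex.cpow_neg _ (α : ℂ), neg_neg] at this
  exact this

section

variable {s : ℕ} {k l : ℕ} {w₀ : ℂ} {w : Fin k → ℂ} {z₁ z₂ : Fin l → ℂ} {c : ℝ}

theorem summable_diagCoeff_bound (K : ℕ) (hc : 0 < c) :
    Summable fun N : ℕ => (N.divisors.card : ℝ) ^ K * (N : ℝ) ^ (-1 - 2 * c) := by
  rw [show -1 - 2 * c = -(1 + 2 * c) by ring]
  exact summable_card_divisors_pow_mul_rpow K (by linarith)

theorem norm_diagCoeff_le' (hs : 0 < s) (h0 : c ≤ w₀.re) (hw : ∀ i, c ≤ (w i).re)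
    (h1 : ∀ i, c ≤ (z₁ i).re) (h2 : ∀ i, c ≤ (z₂ i).re) (N : ℕ) :
    ‖diagCoeff s w₀ w z₁ z₂ N‖
      ≤ (N.divisors.card : ℝ) ^ (k + 2 * l + 2) * (N : ℝ) ^ (-1 - 2 * c) := by
  rcases eq_or_ne N 0 with rfl | hN
  · rw [diagCoeff_zero, norm_zero]; positivity
  · exact norm_diagCoeff_le hs h0 hw h1 h2 hN

/-- The diagonal Dirichlet series equals the product of the fractional powers of `ζ` and `η_l`. -/
theorem zeta_ratio_mul_etaL (hs : 0 < s) (hc : 0 < c) (h0 : c ≤ w₀.re) (hw : ∀ i, c ≤ (w i).re)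
    (h1 : ∀ i, c ≤ (z₁ i).re) (h2 : ∀ i, c ≤ (z₂ i).re) :
    ((∏ i, zetaPow (1 / (2 * (s : ℝ))) (1 + w₀ + w i))
      * ∏ j, ∏ h, zetaPow (1 / (s : ℝ) ^ 2) (1 + z₁ j + z₂ h))
    / ((∏ i, ∏ j, zetaPow (1 / (2 * (s : ℝ) ^ 2)) (1 + w i + z₁ j))
      * ∏ h, zetaPow (1 / (s : ℝ)) (1 + w₀ + z₂ h)) * etaL s w₀ w z₁ z₂
      = ∑' N : ℕ, diagCoeff s w₀ w z₁ z₂ N := by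
  have hre : ∀ u v : ℂ, c ≤ u.re → c ≤ v.re → 1 < (1 + u + v).re := by
    intro u v hu hv
    simp only [Complex.add_re, Complex.one_re]
    linarith
  have hsum : Summable fun N => ‖diagCoeff s w₀ w z₁ z₂ N‖ :=
    (summable_diagCoeff_bound _ hc).of_nonneg_of_le (fun _ => norm_nonneg _)
      (norm_diagCoeff_le' hs h0 hw h1 h2)
  have A := EulerProduct.eulerProduct_hasProd (diagCoeff_one s w₀ w z₁ z₂)
    (fun h => diagCoeff_mul_of_coprime s w₀ w z₁ z₂ h) hsum (diagCoeff_zero s w₀ w z₁ z₂)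
  have B1 := hasProd_prod (s := univ) fun i _ =>
    hasProd_eulerPow (1 / (2 * (s : ℝ))) (hre w₀ (w i) h0 (hw i))
  have B2 := hasProd_prod (s := univ) fun j _ => hasProd_prod (s := univ) fun h _ =>
    hasProd_eulerPow (1 / (s : ℝ) ^ 2) (hre (z₁ j) (z₂ h) (h1 j) (h2 h))
  have B3 := hasProd_prod (s := univ) fun i _ => hasProd_prod (s := univ) fun j _ =>
    hasProd_eulerPow_inv (1 / (2 * (s : ℝ) ^ 2)) (hre (w i) (z₁ j) (hw i) (h1 j))
  have B4 := hasProd_prod (s := univ) fun h _ =>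
    hasProd_eulerPow_inv (1 / (s : ℝ)) (hre w₀ (z₂ h) h0 (h2 h))
  -- All five products converge separately, so multiplying them factor by factor evaluates `etaL`
  -- directly; part (i) is not needed here.
  have C := A.mul ((B1.mul B2).mul (B3.mul B4))
  have hC := C.tprod_eq
  simp only [Finset.prod_inv_distrib] at hC
  have hE : etaL s w₀ w z₁ z₂ = _ := tprod_congr fun p => by
    have hloc := tsum_localTerm p.2 (summable_norm_localTerm (w := w) hs
      (by linarith : -(1 / 2 : ℝ) < c) h0 hw h1 h2 p.2)
    rw [etaFactor, hloc, div_eq_mul_inv (_ : ℂ) (_ * _), mul_inv (_ : ℂ)]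
  have hz : ∀ α u, zetaPow α u ≠ 0 := fun α u => Complex.exp_ne_zero _
  rw [hE, hC]
  have n1 : ∏ i, zetaPow (1 / (2 * (s : ℝ))) (1 + w₀ + w i) ≠ 0 :=
    Finset.prod_ne_zero_iff.mpr fun _ _ => hz _ _
  have n2 : ∏ j, ∏ h, zetaPow (1 / (s : ℝ) ^ 2) (1 + z₁ j + z₂ h) ≠ 0 :=
    Finset.prod_ne_zero_iff.mpr fun _ _ => Finset.prod_ne_zero_iff.mpr fun _ _ => hz _ _
  have n3 : ∏ i, ∏ j, zetaPow (1 / (2 * (s : ℝ) ^ 2)) (1 + w i + z₁ j) ≠ 0 :=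
    Finset.prod_ne_zero_iff.mpr fun _ _ => Finset.prod_ne_zero_iff.mpr fun _ _ => hz _ _
  have n4 : ∏ h, zetaPow (1 / (s : ℝ)) (1 + w₀ + z₂ h) ≠ 0 :=
    Finset.prod_ne_zero_iff.mpr fun _ _ => hz _ _
  generalize (∏ i, zetaPow (1 / (2 * (s : ℝ))) (1 + w₀ + w i)) = a1 at *
  generalize (∏ j, ∏ h, zetaPow (1 / (s : ℝ) ^ 2) (1 + z₁ j + z₂ h)) = a2 at *
  generalize (∏ i, ∏ j, zetaPow (1 / (2 * (s : ℝ) ^ 2)) (1 + w i + z₁ j)) = a3 at *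
  generalize (∏ h, zetaPow (1 / (s : ℝ)) (1 + w₀ + z₂ h)) = a4 at *
  field_simp

end

end FracMoment

/-! ### Mellin inversion for the three kernels -/

namespace FracMoment

open Complex MeasureTheory Set Filter Asymptotics Topology

theorem line_ne_zero {c : ℝ} (hc : 0 < c) (t : ℝ) : (c : ℂ) + t * I ≠ 0 := by
  intro h
  have := congrArg Complex.re h
  simp at this
  exact hc.ne' this

theorem norm_line_sq (c t : ℝ) : ‖(c : ℂ) + t * I‖ ^ 2 = c ^ 2 + t ^ 2 := by
  rw [← Complex.normSq_eq_norm_sq]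
  exact Complex.normSq_add_mul_I c t

theorem le_norm_line {c : ℝ} (t : ℝ) : c ≤ ‖(c : ℂ) + t * I‖ := by
  have := Complex.re_le_norm ((c : ℂ) + t * I)
  simpa using this

theorem integrable_norm_line_sq_inv {c : ℝ} (hc : 0 < c) :
    Integrable fun t : ℝ => (‖(c : ℂ) + t * I‖ ^ 2)⁻¹ := by
  -- Comparison by 1 + t² ≤ (1 + c⁻²)(c² + t²).
  refine (integrable_inv_one_add_sq.const_mul (1 + (c ^ 2)⁻¹)).mono'
    (Continuous.aestronglyMeasurable ?_) (Eventually.of_forall fun t => ?_)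
  · refine Continuous.inv₀ (by fun_prop) fun t => pow_ne_zero _ (norm_ne_zero_iff.mpr ?_)
    exact line_ne_zero hc t
  · have hc2 : (c ^ 2)⁻¹ * c ^ 2 = 1 := inv_mul_cancel₀ (by positivity)
    rw [Real.norm_of_nonneg (by positivity), norm_line_sq, inv_eq_one_div, ← div_eq_mul_inv,
      div_le_div_iff₀ (by positivity) (by positivity)]
    have : 0 ≤ (c ^ 2)⁻¹ * t ^ 2 := by positivity
    nlinarith [sq_nonneg c]

theorem integrable_one_div_line_pow {c : ℝ} (hc : 0 < c) (k : ℕ) :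
    Integrable fun t : ℝ => 1 / ((c : ℂ) + t * I) ^ (k + 2) := by
  refine ((integrable_norm_line_sq_inv hc).const_mul (c ^ k)⁻¹).mono'
    (Continuous.aestronglyMeasurable ?_) (Eventually.of_forall fun t => ?_)
  · exact Continuous.div continuous_const (by fun_prop) fun t => pow_ne_zero _ (line_ne_zero hc t)
  · rw [norm_div, norm_one, norm_pow, one_div, pow_add, mul_inv]
    have h0 : 0 < ‖(c : ℂ) + t * I‖ := norm_pos_iff.mpr (line_ne_zero hc t)
    have := le_norm_line (c := c) t
    gcongr

/-- Two applications of the functional equation suffice in place of Stirling: Γ(u) = Γ(u + 2)/(u(u +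
1)), where Γ(u + 2) is bounded on the line by the Euler integral at its real part, and the
denominator supplies the decay |u|⁻². -/
theorem integrable_Gamma_line {c : ℝ} (hc : 0 < c) :
    Integrable fun t : ℝ => Complex.Gamma ((c : ℂ) + t * I) := by
  set B : ℝ := ∫ x in Ioi (0 : ℝ), Real.exp (-x) * x ^ (c + 1) with hB
  have hG : ∀ t : ℝ, ‖Complex.Gamma ((c : ℂ) + t * I + 1 + 1)‖ ≤ B := by
    intro t
    have hre : ((c : ℂ) + t * I + 1 + 1).re = c + 2 := by simp; ring
    rw [Complex.Gamma_eq_integral (by rw [hre]; linarith), Complex.GammaIntegral]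
    refine (norm_integral_le_integral_norm _).trans (le_of_eq ?_)
    refine setIntegral_congr_fun measurableSet_Ioi fun x hx => ?_
    simp only [norm_mul, Complex.norm_real]
    rw [Complex.norm_cpow_eq_rpow_re_of_pos hx, Real.norm_of_nonneg (Real.exp_pos _).le]
    congr 2
    simp
  have hB0 : 0 ≤ B := (norm_nonneg _).trans (hG 0)
  refine ((integrable_norm_line_sq_inv hc).const_mul B).mono'
    (Continuous.aestronglyMeasurable ?_) (Eventually.of_forall fun t => ?_)
  · refine continuous_iff_continuousAt.mpr fun t => ?_
    refine ContinuousAt.comp (f := fun t : ℝ => (c : ℂ) + t * I) ?_ (by fun_prop)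
    refine (Complex.differentiableAt_Gamma _ fun m h => ?_).continuousAt
    have := congrArg Complex.re h
    simp at this
    have hm : (0 : ℝ) ≤ m := by positivity
    linarith
  · have h0 := line_ne_zero hc t
    have h1 : (c : ℂ) + t * I + 1 ≠ 0 := by
      have := line_ne_zero (c := c + 1) (by linarith) t
      convert this using 1
      push_cast; ring
    have hn : ‖(c : ℂ) + t * I‖ ≤ ‖(c : ℂ) + t * I + 1‖ := by
      refine le_of_sq_le_sq ?_ (norm_nonneg _)
      have e : (c : ℂ) + t * I + 1 = ((c + 1 : ℝ) : ℂ) + t * I := by push_cast; ring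
      rw [e, norm_line_sq, norm_line_sq]
      nlinarith
    have e : Complex.Gamma ((c : ℂ) + t * I)
        = Complex.Gamma ((c : ℂ) + t * I + 1 + 1) / (((c : ℂ) + t * I + 1) * ((c : ℂ) + t * I)) := by
      rw [Complex.Gamma_add_one _ h1, Complex.Gamma_add_one _ h0]
      field_simp
    have hp : 0 < ‖(c : ℂ) + t * I‖ := norm_pos_iff.mpr h0
    rw [e, norm_div, norm_mul, div_eq_mul_inv, sq]
    gcongr
    exact hG t

/-- The indicator function of `(0, 1]`. -/
noncomputable def unitInd : ℝ → ℂ := (Ioc (0 : ℝ) 1).indicator fun _ => 1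

/-- Differentiating a Mellin transform inserts log t. The hypotheses on f (vanishing beyond 1,
O(t^(-b)) at 0 for every b > 0) are preserved by that factor, so the step iterates and leads from
1/s to -1/s² and 2/s³. -/
theorem mellin_log_smul {f : ℝ → ℂ} {F F' : ℂ → ℂ} (hfc : LocallyIntegrableOn f (Ioi 0))
    (hf0 : ∀ t, 1 < t → f t = 0)
    (hf : ∀ b : ℝ, 0 < b → f =O[𝓝[>] 0] (· ^ (-b)))
    (hF : ∀ s : ℂ, 0 < s.re → mellin f s = F s) (hF' : ∀ s : ℂ, 0 < s.re → HasDerivAt F (F' s) s)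
    {s : ℂ} (hs : 0 < s.re) :
    HasMellin (fun t => Real.log t • f t) s (F' s) := by
  have htop : f =O[atTop] (· ^ (-(s.re + 1))) := by
    refine (isBigO_zero _ _).congr' ?_ EventuallyEq.rfl
    filter_upwards [eventually_gt_atTop 1] with t ht using (hf0 t ht).symm
  have h := mellin_hasDerivAt_of_isBigO_rpow hfc htop (by linarith) (hf (s.re / 2) (by linarith))
    (by linarith)
  refine ⟨h.1, h.2.unique ((hF' s hs).congr_of_eventuallyEq ?_)⟩
  filter_upwards [(isOpen_lt continuous_const Complex.continuous_re).mem_nhds hs] with z hz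
  exact hF z hz

theorem unitInd_eq_zero {t : ℝ} (ht : 1 < t) : unitInd t = 0 := by
  simp [unitInd, ht]

theorem unitInd_bound (t : ℝ) : ‖unitInd t‖ ≤ 1 := by
  unfold unitInd indicator
  split_ifs <;> simp

theorem locallyIntegrableOn_unitInd : LocallyIntegrableOn unitInd (Ioi 0) := by
  refine LocallyIntegrable.locallyIntegrableOn ?_ _
  refine (locallyIntegrable_const (1 : ℂ)).mono ?_ (Eventually.of_forall fun t => ?_)
  · exact (measurable_const.indicator measurableSet_Ioc).aestronglyMeasurable
  · simpa using unitInd_bound t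

theorem locallyIntegrableOn_log_smul {f : ℝ → ℂ} (hf : LocallyIntegrableOn f (Ioi 0)) :
    LocallyIntegrableOn (fun t => Real.log t • f t) (Ioi 0) := by
  refine hf.continuousOn_smul isOpen_Ioi.isLocallyClosed ?_
  exact Real.continuousOn_log.mono fun t ht => (ne_of_gt ht)

theorem log_smul_isBigO {f : ℝ → ℂ} (hf : ∀ b : ℝ, 0 < b → f =O[𝓝[>] 0] (· ^ (-b)))
    (b : ℝ) (hb : 0 < b) : (fun t => Real.log t • f t) =O[𝓝[>] 0] (· ^ (-b)) := by
  have h1 : Real.log =O[𝓝[>] 0] fun t : ℝ => t ^ (-(b / 2)) :=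
    (isLittleO_log_rpow_nhdsGT_zero (by linarith)).isBigO
  refine (h1.smul (hf (b / 2) (by linarith))).congr' EventuallyEq.rfl ?_
  filter_upwards [self_mem_nhdsWithin] with t ht
  rw [smul_eq_mul, ← Real.rpow_add ht]
  ring_nf

theorem unitInd_isBigO (b : ℝ) (hb : 0 < b) : unitInd =O[𝓝[>] 0] (· ^ (-b)) := by
  refine IsBigO.of_bound 1 ?_
  filter_upwards [Ioo_mem_nhdsGT (zero_lt_one' ℝ)] with t ht
  refine (unitInd_bound t).trans ?_
  rw [one_mul, Real.norm_of_nonneg (Real.rpow_nonneg ht.1.le _)]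
  exact Real.one_le_rpow_of_pos_of_le_one_of_nonpos ht.1 ht.2.le (by linarith)

theorem hasMellin_log_unitInd {s : ℂ} (hs : 0 < s.re) :
    HasMellin (fun t => Real.log t • unitInd t) s (-1 / s ^ 2) :=
  mellin_log_smul (F := fun s => 1 / s) locallyIntegrableOn_unitInd (fun _ => unitInd_eq_zero)
    unitInd_isBigO (fun s hs => (hasMellin_one_Ioc hs).2)
    (F' := fun s => -1 / s ^ 2) (fun s hs => by
      have h0 : s ≠ 0 := by rintro rfl; simp at hs
      have := hasDerivAt_inv h0
      simp only [one_div]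
      rwa [neg_div, one_div]) hs

theorem hasMellin_log_sq_unitInd {s : ℂ} (hs : 0 < s.re) :
    HasMellin (fun t => Real.log t • Real.log t • unitInd t) s (2 / s ^ 3) :=
  mellin_log_smul (F := fun s => -1 / s ^ 2) (locallyIntegrableOn_log_smul locallyIntegrableOn_unitInd)
    (fun t ht => by rw [unitInd_eq_zero ht, smul_zero])
    (log_smul_isBigO unitInd_isBigO) (fun s hs => (hasMellin_log_unitInd hs).2)
    (F' := fun s => 2 / s ^ 3) (fun s hs => by
      have h0 : s ≠ 0 := by rintro rfl; simp at hs
      have := ((hasDerivAt_pow 2 s).inv (pow_ne_zero 2 h0)).const_mul (-1)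
      refine (this.congr_deriv ?_).congr_of_eventuallyEq (Eventually.of_forall fun z => ?_)
      · field_simp
        norm_num [mul_comm]
      · simp [div_eq_mul_inv]) hs

theorem log_smul_unitInd {t : ℝ} (ht : 0 < t) :
    Real.log t • unitInd t = -((max (Real.log t⁻¹) 0 : ℝ) : ℂ) := by
  rw [Real.log_inv]
  rcases le_or_gt t 1 with h | h
  · have : Real.log t ≤ 0 := Real.log_nonpos ht.le h
    rw [max_eq_left (by linarith), unitInd, indicator_of_mem (show t ∈ Ioc (0 : ℝ) 1 from ⟨ht, h⟩)]
    simp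
  · have : 0 < Real.log t := Real.log_pos h
    rw [max_eq_right (by linarith), unitInd_eq_zero h]
    simp

theorem log_smul_log_smul_unitInd {t : ℝ} (ht : 0 < t) :
    Real.log t • Real.log t • unitInd t = (((max (Real.log t⁻¹) 0) ^ 2 : ℝ) : ℂ) := by
  rw [log_smul_unitInd ht, Real.log_inv]
  rcases le_or_gt t 1 with h | h
  · have : Real.log t ≤ 0 := Real.log_nonpos ht.le h
    rw [max_eq_left (by linarith), Complex.real_smul]
    push_cast; ring
  · have : 0 < Real.log t := Real.log_pos h
    rw [max_eq_right (by linarith)]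
    simp

/-- Inverse Mellin transform, for a Mellin transform given on a vertical line. -/
theorem integral_cpow_mul_of_hasMellin {f : ℝ → ℂ} {F : ℂ → ℂ} {c u : ℝ} (hc : 0 < c) (hu : 0 < u)
    (hF : ∀ s : ℂ, 0 < s.re → HasMellin f s (F s))
    (hint : Integrable fun t : ℝ => F ((c : ℂ) + t * I)) (hcont : ContinuousAt f u⁻¹) :
    ∫ t : ℝ, (u : ℂ) ^ ((c : ℂ) + t * I) * F ((c : ℂ) + t * I) = 2 * Real.pi * f u⁻¹ := by
  have hre : ∀ t : ℝ, 0 < ((c : ℂ) + t * I).re := fun t => by simpa using hc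
  have hcv : MellinConvergent f c := (hF c (by simpa using hc)).1
  have hv : Complex.VerticalIntegrable (mellin f) c := by
    refine hint.congr (Eventually.of_forall fun t => ?_)
    exact ((hF _ (hre t)).2).symm
  have h := mellinInv_mellin_eq c f (inv_pos.mpr hu) hcv hv hcont
  rw [← h, mellinInv, Complex.real_smul]
  have e : (2 * (Real.pi : ℂ)) * ((1 / (2 * Real.pi) : ℝ) : ℂ) = 1 := by
    have : (Real.pi : ℂ) ≠ 0 := by exact_mod_cast Real.pi_ne_zero
    push_cast
    field_simp
  rw [← mul_assoc, e, one_mul]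
  refine integral_congr_ae (Eventually.of_forall fun t => ?_)
  simp only [(hF _ (hre t)).2, smul_eq_mul]
  rw [Complex.ofReal_inv, Complex.inv_cpow _ _ (by
    rw [Complex.arg_ofReal_of_nonneg hu.le]; exact Real.pi_pos.ne), Complex.cpow_neg, inv_inv]

/-- The function log⁺ is continuous at u = 1, where the indicator jumps. Pointwise inversion
therefore holds for all u > 0, including the endpoint n = x. -/
theorem integral_cpow_div_sq {c u : ℝ} (hc : 0 < c) (hu : 0 < u) :
    ∫ t : ℝ, (u : ℂ) ^ ((c : ℂ) + t * I) * (1 / ((c : ℂ) + t * I) ^ 2)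
      = 2 * Real.pi * ((max (Real.log u) 0 : ℝ) : ℂ) := by
  have hF : ∀ s : ℂ, 0 < s.re →
      HasMellin (fun t : ℝ => ((max (Real.log t⁻¹) 0 : ℝ) : ℂ)) s (1 / s ^ 2) := by
    intro s hs
    have h := hasMellin_log_unitInd hs
    have hcg : EqOn (fun t : ℝ => (t : ℂ) ^ (s - 1) • -(Real.log t • unitInd t))
        (fun t : ℝ => (t : ℂ) ^ (s - 1) • ((max (Real.log t⁻¹) 0 : ℝ) : ℂ)) (Ioi 0) := by
      intro t ht
      simp only
      rw [log_smul_unitInd ht, neg_neg]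
    refine ⟨IntegrableOn.congr_fun (by simp only [smul_neg]; exact Integrable.neg h.1) hcg
      measurableSet_Ioi, ?_⟩
    · rw [mellin, ← setIntegral_congr_fun measurableSet_Ioi hcg]
      simp only [smul_neg]
      rw [integral_neg]
      have h2 := h.2
      rw [mellin] at h2
      rw [h2]
      ring
  have h := integral_cpow_mul_of_hasMellin hc hu hF (integrable_one_div_line_pow hc 0) (by
    have : u⁻¹ ≠ 0 := inv_ne_zero hu.ne'
    have h1 : ContinuousAt (fun t : ℝ => Real.log t⁻¹) u⁻¹ := by
      simp only [Real.log_inv]; exact (Real.continuousAt_log this).neg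
    exact Complex.continuous_ofReal.continuousAt.comp (h1.max continuousAt_const))
  rw [h, inv_inv]

/-- The transform of log² on (0, 1] is 2/s³, so 1/s³ inverts to half of (log⁺)²; this half is the
factor 1/2 in `mollifier`. -/
theorem integral_cpow_div_cube {c u : ℝ} (hc : 0 < c) (hu : 0 < u) :
    ∫ t : ℝ, (u : ℂ) ^ ((c : ℂ) + t * I) * (1 / ((c : ℂ) + t * I) ^ 3)
      = 2 * Real.pi * (((max (Real.log u) 0) ^ 2 / 2 : ℝ) : ℂ) := by
  have hF : ∀ s : ℂ, 0 < s.re →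
      HasMellin (fun t : ℝ => (((max (Real.log t⁻¹) 0) ^ 2 / 2 : ℝ) : ℂ)) s (1 / s ^ 3) := by
    intro s hs
    have h := hasMellin_log_sq_unitInd hs
    have hcg : EqOn (fun t : ℝ => (1 / 2 : ℂ) *
          ((t : ℂ) ^ (s - 1) • (Real.log t • Real.log t • unitInd t)))
        (fun t : ℝ => (t : ℂ) ^ (s - 1) • (((max (Real.log t⁻¹) 0) ^ 2 / 2 : ℝ) : ℂ)) (Ioi 0) := by
      intro t ht
      simp only [smul_eq_mul]
      rw [log_smul_log_smul_unitInd ht]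
      push_cast; ring
    refine ⟨IntegrableOn.congr_fun (Integrable.const_mul h.1 (1 / 2 : ℂ)) hcg measurableSet_Ioi, ?_⟩
    · rw [mellin, ← setIntegral_congr_fun measurableSet_Ioi hcg, integral_const_mul]
      have h2 := h.2
      rw [mellin] at h2
      rw [h2]
      ring
  have h := integral_cpow_mul_of_hasMellin hc hu hF (integrable_one_div_line_pow hc 1) (by
    have : u⁻¹ ≠ 0 := inv_ne_zero hu.ne'
    have h1 : ContinuousAt (fun t : ℝ => Real.log t⁻¹) u⁻¹ := by
      simp only [Real.log_inv]; exact (Real.continuousAt_log this).neg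
    exact Complex.continuous_ofReal.continuousAt.comp
      (((h1.max continuousAt_const).pow 2).div_const 2))
  rw [h, inv_inv]

theorem integral_cpow_mul_Gamma {c u : ℝ} (hc : 0 < c) (hu : 0 < u) :
    ∫ t : ℝ, (u : ℂ) ^ ((c : ℂ) + t * I) * Complex.Gamma ((c : ℂ) + t * I)
      = 2 * Real.pi * (Real.exp (-u⁻¹) : ℂ) := by
  refine integral_cpow_mul_of_hasMellin (f := fun t : ℝ => (Real.exp (-t) : ℂ)) hc hu
    (fun s hs => ⟨?_, ?_⟩) (integrable_Gamma_line hc) (by fun_prop)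
  · refine IntegrableOn.congr_fun (Complex.GammaIntegral_convergent hs) (fun t _ => ?_)
      measurableSet_Ioi
    rw [smul_eq_mul, mul_comm]
  · rw [← Complex.GammaIntegral_eq_mellin, Complex.Gamma_eq_integral hs]

end FracMoment

/-! ### Integrating kernels of Dirichlet coefficients -/

namespace FracMoment

open Complex MeasureTheory Filter Topology

/-- The sum is measurable as a limit of its partial sums, and its norm is dominated by the sum of
the norms, integrable by Tonelli. This yields integrability of the integrand of I_l without a
separate measurability argument for η_l. -/
theorem integrable_of_hasSum {α : Type*} [MeasurableSpace α] {μ : Measure α} {F : ℕ → α → ℂ}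
    {f : α → ℂ} (hF : ∀ i, Integrable (F i) μ) (hs : Summable fun i => ∫ a, ‖F i a‖ ∂μ)
    (h : ∀ a, HasSum (fun i => F i a) (f a)) : Integrable f μ := by
  refine ⟨aestronglyMeasurable_of_tendsto_ae atTop
    (f := fun n a => ∑ i ∈ Finset.range n, F i a) (fun n => ?_)
    (Eventually.of_forall fun a => (h a).tendsto_sum_nat), ?_⟩
  · exact (integrable_finsetSum _ fun i _ => hF i).1
  · have h1 : ∀ a, ‖f a‖ₑ ≤ ∑' i, ‖F i a‖ₑ := fun a => by
      rw [← (h a).tsum_eq]; exact enorm_tsum_le_tsum_enorm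
    refine (lintegral_mono h1).trans_lt ?_
    rw [lintegral_tsum fun i => (hF i).1.enorm]
    have h2 : ∀ i, ∫⁻ a, ‖F i a‖ₑ ∂μ = ENNReal.ofReal (∫ a, ‖F i a‖ ∂μ) := fun i => by
      rw [ofReal_integral_norm_eq_lintegral_enorm (hF i)]
    simp only [h2]
    exact hs.tsum_ofReal_lt_top

theorem card_finMulAntidiag_le (k : ℕ) {n : ℕ} (hn : n ≠ 0) :
    (Nat.finMulAntidiag k n).card ≤ n.divisors.card ^ k := by
  rw [Nat.finMulAntidiag_eq_piFinset_divisors_filter dvd_rfl hn]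
  refine (Finset.card_filter_le _ _).trans ?_
  simp [Fintype.card_piFinset]

/-- The coefficient `h(n) n^{-u}` times the kernel `x^u / u^{j+2}` at `u = c + it`. -/
noncomputable def lineKernel (c x : ℝ) (j : ℕ) (h : ℕ → ℂ) (n : ℕ) (t : ℝ) : ℂ :=
  twist h ((c : ℂ) + t * I) n * ((x : ℂ) ^ ((c : ℂ) + t * I) * (1 / ((c : ℂ) + t * I) ^ (j + 2)))

/-- The `k`-fold version of `lineKernel`, summed over the factorizations of `n`. -/
noncomputable def lineKernels (k : ℕ) (c x : ℝ) (j : ℕ) (h : ℕ → ℂ) (n : ℕ) (t : Fin k → ℝ) : ℂ :=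
  ∑ f ∈ Nat.finMulAntidiag k n, ∏ i, lineKernel c x j h (f i) (t i)

/-- `∑_{n_1 ⋯ n_k = n} ∏_i h(n_i) W(x / n_i)`. -/
noncomputable def convWeight (k : ℕ) (x : ℝ) (W : ℝ → ℝ) (h : ℕ → ℂ) (n : ℕ) : ℂ :=
  ∑ f ∈ Nat.finMulAntidiag k n, ∏ i, h (f i) * (W (x / f i) : ℂ)

section

variable {c x : ℝ} {j : ℕ} {h : ℕ → ℂ}

theorem cpow_mul_inv_natCast_cpow (hx : 0 < x) (n : ℕ) (u : ℂ) :
    (x : ℂ) ^ u / (n : ℂ) ^ u = ((x / n : ℝ) : ℂ) ^ u := by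
  have h1 : ((n : ℝ) : ℂ) = (n : ℂ) := by simp
  rw [Complex.ofReal_div, ← h1, Complex.div_cpow_ofReal_nonneg hx.le (Nat.cast_nonneg n)]

theorem lineKernel_eq (hx : 0 < x) {n : ℕ} (hn : n ≠ 0) (t : ℝ) :
    lineKernel c x j h n t = h n *
      (((x / n : ℝ) : ℂ) ^ ((c : ℂ) + t * I) * (1 / ((c : ℂ) + t * I) ^ (j + 2))) := by
  rw [lineKernel, twist_apply _ _ hn, ← cpow_mul_inv_natCast_cpow hx]
  ring

theorem norm_cpow_line {u : ℝ} (hu : 0 < u) (t : ℝ) :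
    ‖(u : ℂ) ^ ((c : ℂ) + t * I)‖ = u ^ c := by
  rw [Complex.norm_cpow_eq_rpow_re_of_pos hu]
  simp

theorem continuous_cpow_line {u : ℝ} (hu : 0 < u) :
    Continuous fun t : ℝ => (u : ℂ) ^ ((c : ℂ) + t * I) := by
  refine Continuous.const_cpow (by fun_prop) (Or.inl ?_)
  exact_mod_cast hu.ne'

theorem integrable_cpow_line_mul {u : ℝ} (hu : 0 < u) {F : ℝ → ℂ} (hF : Integrable F) :
    Integrable fun t : ℝ => (u : ℂ) ^ ((c : ℂ) + t * I) * F t :=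
  hF.bdd_mul (continuous_cpow_line hu).aestronglyMeasurable
    (Eventually.of_forall fun t => (norm_cpow_line hu t).le)

theorem integrable_lineKernel (hc : 0 < c) (hx : 0 < x) {n : ℕ} (hn : n ≠ 0) :
    Integrable (lineKernel c x j h n) := by
  have hn' : (0 : ℝ) < n := by exact_mod_cast Nat.pos_of_ne_zero hn
  refine ((integrable_cpow_line_mul (c := c) (div_pos hx hn')
    (integrable_one_div_line_pow hc j)).const_mul (h n)).congr (Eventually.of_forall fun t => ?_)
  exact (lineKernel_eq hx hn t).symm

theorem integral_norm_lineKernel_le (hh : ∀ n, ‖h n‖ ≤ 1) (hx : 0 < x) {n : ℕ} (hn : n ≠ 0) :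
    ∫ t, ‖lineKernel c x j h n t‖
      ≤ (x ^ c * ∫ t : ℝ, ‖1 / ((c : ℂ) + t * I) ^ (j + 2)‖) * (n : ℝ) ^ (-c) := by
  have hn' : (0 : ℝ) < n := by exact_mod_cast Nat.pos_of_ne_zero hn
  have e : ∀ t, ‖lineKernel c x j h n t‖
      = (‖h n‖ * (x ^ c * (n : ℝ) ^ (-c))) * ‖1 / ((c : ℂ) + t * I) ^ (j + 2)‖ := fun t => by
    rw [lineKernel_eq hx hn, norm_mul, norm_mul, norm_cpow_line (div_pos hx hn'),
      Real.div_rpow hx.le hn'.le, Real.rpow_neg hn'.le, div_eq_mul_inv]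
    ring
  simp only [e]
  rw [integral_const_mul]
  have h0 : 0 ≤ ∫ t : ℝ, ‖1 / ((c : ℂ) + t * I) ^ (j + 2)‖ :=
    integral_nonneg fun _ => norm_nonneg _
  calc _ ≤ (1 * (x ^ c * (n : ℝ) ^ (-c))) * ∫ t : ℝ, ‖1 / ((c : ℂ) + t * I) ^ (j + 2)‖ := by
        gcongr
        exact hh n
    _ = _ := by ring

theorem integral_lineKernel {W : ℝ → ℝ} (hW : ∀ u : ℝ, 0 < u →
      ∫ t : ℝ, (u : ℂ) ^ ((c : ℂ) + t * I) * (1 / ((c : ℂ) + t * I) ^ (j + 2))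
        = 2 * Real.pi * (W u : ℂ)) (hx : 0 < x) {n : ℕ} (hn : n ≠ 0) :
    ∫ t, lineKernel c x j h n t = 2 * Real.pi * (h n * (W (x / n) : ℂ)) := by
  have hn' : (0 : ℝ) < n := by exact_mod_cast Nat.pos_of_ne_zero hn
  simp only [lineKernel_eq hx hn]
  rw [integral_const_mul, hW _ (div_pos hx hn')]
  ring

theorem integrable_prod_lineKernel {k : ℕ} (hc : 0 < c) (hx : 0 < x) {f : Fin k → ℕ}
    (hf : ∀ i, f i ≠ 0) : Integrable fun t : Fin k → ℝ => ∏ i, lineKernel c x j h (f i) (t i) :=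
  Integrable.fintype_prod fun i => integrable_lineKernel hc hx (hf i)

theorem integrable_lineKernels {k : ℕ} (hc : 0 < c) (hx : 0 < x) (n : ℕ) :
    Integrable (lineKernels k c x j h n) :=
  integrable_finsetSum _ fun _ hf =>
    integrable_prod_lineKernel hc hx (Nat.ne_zero_of_mem_finMulAntidiag hf)

/-- On the line |u^(c+it)| is constant, so a factor attached to f i has L¹ norm at most B (f
i)^(-c). The product over i is B^k n^(-c), and n has at most d(n)^k factorizations. -/
theorem integral_norm_lineKernels_le {k : ℕ} (hc : 0 < c) (hh : ∀ n, ‖h n‖ ≤ 1) (hx : 0 < x)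
    {n : ℕ} (hn : n ≠ 0) :
    ∫ t, ‖lineKernels k c x j h n t‖
      ≤ (x ^ c * ∫ t : ℝ, ‖1 / ((c : ℂ) + t * I) ^ (j + 2)‖) ^ k
        * ((n.divisors.card : ℝ) ^ k * (n : ℝ) ^ (-c)) := by
  set B := x ^ c * ∫ t : ℝ, ‖1 / ((c : ℂ) + t * I) ^ (j + 2)‖ with hB
  have hB0 : 0 ≤ B := mul_nonneg (by positivity) (integral_nonneg fun _ => norm_nonneg _)
  have hf0 := fun f (hf : f ∈ Nat.finMulAntidiag k n) => Nat.ne_zero_of_mem_finMulAntidiag hf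
  calc ∫ t, ‖lineKernels k c x j h n t‖
      ≤ ∫ t : Fin k → ℝ, ∑ f ∈ Nat.finMulAntidiag k n, ‖∏ i, lineKernel c x j h (f i) (t i)‖ := by
        refine integral_mono (integrable_lineKernels hc hx n).norm
          (integrable_finsetSum _ fun f hf => (integrable_prod_lineKernel hc hx (hf0 f hf)).norm)
          fun t => norm_sum_le _ _
    _ = ∑ f ∈ Nat.finMulAntidiag k n, ∏ i, ∫ t, ‖lineKernel c x j h (f i) t‖ := by
        rw [integral_finsetSum _ fun f hf =>
          (integrable_prod_lineKernel hc hx (hf0 f hf)).norm]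
        refine Finset.sum_congr rfl fun f _ => ?_
        simp only [norm_prod]
        exact integral_fintype_prod_volume_eq_prod fun i t => ‖lineKernel c x j h (f i) t‖
    _ ≤ ∑ f ∈ Nat.finMulAntidiag k n, B ^ k * (n : ℝ) ^ (-c) := by
        refine Finset.sum_le_sum fun f hf => ?_
        refine (Finset.prod_le_prod (fun _ _ => integral_nonneg fun _ => norm_nonneg _) fun i _ =>
          integral_norm_lineKernel_le hh hx (hf0 f hf i)).trans (le_of_eq ?_)
        rw [Finset.prod_mul_distrib, Finset.prod_const, Finset.card_univ, Fintype.card_fin,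
          Real.finsetProd_rpow _ _ fun _ _ => by positivity, ← Nat.cast_prod,
          Nat.prod_eq_of_mem_finMulAntidiag hf]
    _ ≤ _ := by
        rw [Finset.sum_const, nsmul_eq_mul]
        have : ((Nat.finMulAntidiag k n).card : ℝ) ≤ (n.divisors.card : ℝ) ^ k := by
          exact_mod_cast card_finMulAntidiag_le k hn
        calc _ ≤ (n.divisors.card : ℝ) ^ k * (B ^ k * (n : ℝ) ^ (-c)) := by gcongr
          _ = _ := by ring

theorem integral_lineKernels {k : ℕ} {W : ℝ → ℝ} (hc : 0 < c) (hW : ∀ u : ℝ, 0 < u →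
      ∫ t : ℝ, (u : ℂ) ^ ((c : ℂ) + t * I) * (1 / ((c : ℂ) + t * I) ^ (j + 2))
        = 2 * Real.pi * (W u : ℂ)) (hx : 0 < x) (n : ℕ) :
    ∫ t, lineKernels k c x j h n t = (2 * Real.pi) ^ k * convWeight k x W h n := by
  have hf0 := fun f (hf : f ∈ Nat.finMulAntidiag k n) => Nat.ne_zero_of_mem_finMulAntidiag hf
  unfold lineKernels convWeight
  rw [integral_finsetSum _ fun f hf => integrable_prod_lineKernel hc hx (hf0 f hf),
    Finset.mul_sum]
  refine Finset.sum_congr rfl fun f hf => ?_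
  rw [integral_fintype_prod_volume_eq_prod fun i t => lineKernel c x j h (f i) t]
  rw [Finset.prod_congr rfl fun i _ => integral_lineKernel hW hx (hf0 f hf i),
    Finset.prod_mul_distrib, Finset.prod_const, Finset.card_univ, Fintype.card_fin]

/-- Separates the Dirichlet coefficient at n from a weight independent of n. The weight can then be
pulled out of the sum over N. -/
theorem lineKernels_eq {k : ℕ} (n : ℕ) (t : Fin k → ℝ) :
    lineKernels k c x j h n t = (∏ i, twist h ((c : ℂ) + t i * I)) n *
      ∏ i, ((x : ℂ) ^ ((c : ℂ) + t i * I) * (1 / ((c : ℂ) + t i * I) ^ (j + 2))) := by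
  rw [lineKernels, prod_apply_finMulAntidiag, Finset.sum_mul]
  refine Finset.sum_congr rfl fun f _ => ?_
  rw [← Finset.prod_mul_distrib]
  rfl

end

/-- The kernel `m^{-u} X^u Γ(u)` at `u = c + it`. -/
noncomputable def gammaKernel (c X : ℝ) (m : ℕ) (t : ℝ) : ℂ :=
  twist 1 ((c : ℂ) + t * I) m * ((X : ℂ) ^ ((c : ℂ) + t * I) * Complex.Gamma ((c : ℂ) + t * I))

section

variable {c X : ℝ}

theorem gammaKernel_eq (hX : 0 < X) {m : ℕ} (hm : m ≠ 0) (t : ℝ) :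
    gammaKernel c X m t =
      ((X / m : ℝ) : ℂ) ^ ((c : ℂ) + t * I) * Complex.Gamma ((c : ℂ) + t * I) := by
  rw [gammaKernel, twist_apply _ _ hm, ← cpow_mul_inv_natCast_cpow hX, Pi.one_apply]
  ring

theorem integrable_gammaKernel (hc : 0 < c) (hX : 0 < X) {m : ℕ} (hm : m ≠ 0) :
    Integrable (gammaKernel c X m) := by
  have hm' : (0 : ℝ) < m := by exact_mod_cast Nat.pos_of_ne_zero hm
  refine (integrable_cpow_line_mul (c := c) (div_pos hX hm') (integrable_Gamma_line hc)).congr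
    (Eventually.of_forall fun t => ?_)
  exact (gammaKernel_eq hX hm t).symm

theorem integral_norm_gammaKernel (hX : 0 < X) {m : ℕ} (hm : m ≠ 0) :
    ∫ t, ‖gammaKernel c X m t‖
      = (X ^ c * ∫ t : ℝ, ‖Complex.Gamma ((c : ℂ) + t * I)‖) * (m : ℝ) ^ (-c) := by
  have hm' : (0 : ℝ) < m := by exact_mod_cast Nat.pos_of_ne_zero hm
  have e : ∀ t, ‖gammaKernel c X m t‖
      = (X ^ c * (m : ℝ) ^ (-c)) * ‖Complex.Gamma ((c : ℂ) + t * I)‖ := fun t => by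
    rw [gammaKernel_eq hX hm, norm_mul, norm_cpow_line (div_pos hX hm'),
      Real.div_rpow hX.le hm'.le, Real.rpow_neg hm'.le, div_eq_mul_inv]
  simp only [e]
  rw [integral_const_mul]
  ring

theorem integral_gammaKernel (hc : 0 < c) (hX : 0 < X) {m : ℕ} (hm : m ≠ 0) :
    ∫ t, gammaKernel c X m t = 2 * Real.pi * (Real.exp (-(m / X)) : ℂ) := by
  have hm' : (0 : ℝ) < m := by exact_mod_cast Nat.pos_of_ne_zero hm
  simp only [gammaKernel_eq hX hm]
  rw [integral_cpow_mul_Gamma hc (div_pos hX hm'), inv_div]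

end

end FracMoment

/-! ### The integral I_l as a diagonal sum -/

namespace FracMoment

open Complex MeasureTheory Filter Topology

/-- `log⁺ u`. -/
noncomputable def logWeight (u : ℝ) : ℝ := max (Real.log u) 0

/-- `(log⁺ u)² / 2`. -/
noncomputable def logSqWeight (u : ℝ) : ℝ := max (Real.log u) 0 ^ 2 / 2

theorem ofReal_cpow_sum {ι : Type*} (t : Finset ι) {x : ℝ} (hx : 0 < x) (w : ι → ℂ) :
    (x : ℂ) ^ (∑ i ∈ t, w i) = ∏ i ∈ t, (x : ℂ) ^ w i := by
  classical
  have hx0 : (x : ℂ) ≠ 0 := by exact_mod_cast hx.ne'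
  induction t using Finset.induction_on with
  | empty => simp
  | insert a t ha ih => rw [Finset.sum_insert ha, Finset.prod_insert ha, Complex.cpow_add _ _ hx0, ih]

section

variable (k l s : ℕ) (c X x y : ℝ)

/-- The terms with `ma = nb` of the product of the four kernels, as a function of `m, n, a, b`. -/
noncomputable def quadKernel (p q : ℕ × ℕ)
    (t : ℝ × (Fin k → ℝ) × (Fin l → ℝ) × (Fin l → ℝ)) : ℂ :=
  gammaKernel c X p.1 t.1 *
    (lineKernels k c x 0 (divCoeff (1 / (2 * (s : ℝ)))) q.1 t.2.1 *
      (lineKernels l c y 1 (divMuCoeff (1 / (s : ℝ))) p.2 t.2.2.1 *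
        lineKernels l c y 1 (divMuCoeff (1 / (s : ℝ))) q.2 t.2.2.2))

/-- The integral of `quadKernel`, up to powers of `2π`. -/
noncomputable def quadWeight (p q : ℕ × ℕ) : ℂ :=
  (Real.exp (-(p.1 / X)) : ℂ) *
    (convWeight k x logWeight (divCoeff (1 / (2 * (s : ℝ)))) q.1 *
      (convWeight l y logSqWeight (divMuCoeff (1 / (s : ℝ))) p.2 *
        convWeight l y logSqWeight (divMuCoeff (1 / (s : ℝ))) q.2))

/-- The part of the integrand coming from `ma = nb = N`. -/
noncomputable def diagKernel (N : ℕ)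
    (t : ℝ × (Fin k → ℝ) × (Fin l → ℝ) × (Fin l → ℝ)) : ℂ :=
  (∑ p ∈ N.divisorsAntidiagonal, ∑ q ∈ N.divisorsAntidiagonal,
    quadKernel k l s c X x y p q t) * (N : ℂ)⁻¹

/-- The diagonal contribution to the moment, before normalization by logarithms. -/
noncomputable def diagWeight (N : ℕ) : ℂ :=
  (∑ p ∈ N.divisorsAntidiagonal, ∑ q ∈ N.divisorsAntidiagonal,
    quadWeight k l s X x y p q) * (N : ℂ)⁻¹

variable {k l s c X x y}

theorem ne_zero_of_mem_divisorsAntidiagonal {N : ℕ} {p : ℕ × ℕ} (hp : p ∈ N.divisorsAntidiagonal) :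
    p.1 ≠ 0 ∧ p.2 ≠ 0 := by
  obtain ⟨h1, h2⟩ := Nat.mem_divisorsAntidiagonal.mp hp
  rw [← h1] at h2
  exact mul_ne_zero_iff.mp h2

theorem integrable_quadKernel (hc : 0 < c) (hX : 0 < X) (hx : 0 < x) (hy : 0 < y) {p q : ℕ × ℕ}
    (hp : p.1 ≠ 0) : Integrable (quadKernel k l s c X x y p q) :=
  (integrable_gammaKernel hc hX hp).mul_prod ((integrable_lineKernels hc hx q.1).mul_prod
    ((integrable_lineKernels hc hy p.2).mul_prod (integrable_lineKernels hc hy q.2)))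

theorem integral_quadKernel (hc : 0 < c) (hX : 0 < X) (hx : 0 < x) (hy : 0 < y) {p q : ℕ × ℕ}
    (hp : p.1 ≠ 0) :
    ∫ t, quadKernel k l s c X x y p q t
      = (2 * Real.pi) ^ (1 + k + 2 * l) * quadWeight k l s X x y p q := by
  have e : ∫ t, quadKernel k l s c X x y p q t
      = (∫ t, gammaKernel c X p.1 t) *
        ((∫ t, lineKernels k c x 0 (divCoeff (1 / (2 * (s : ℝ)))) q.1 t) *
          ((∫ t, lineKernels l c y 1 (divMuCoeff (1 / (s : ℝ))) p.2 t) *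
            ∫ t, lineKernels l c y 1 (divMuCoeff (1 / (s : ℝ))) q.2 t)) := by
    rw [← integral_prod_mul, ← integral_prod_mul, ← integral_prod_mul]
    rfl
  rw [e, integral_gammaKernel hc hX hp,
    integral_lineKernels (W := logWeight) hc (fun u hu => integral_cpow_div_sq hc hu) hx,
    integral_lineKernels (W := logSqWeight) hc (fun u hu => integral_cpow_div_cube hc hu) hy,
    integral_lineKernels (W := logSqWeight) hc (fun u hu => integral_cpow_div_cube hc hu) hy,
    quadWeight]
  ring

theorem integrable_diagKernel (hc : 0 < c) (hX : 0 < X) (hx : 0 < x) (hy : 0 < y) (N : ℕ) :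
    Integrable (diagKernel k l s c X x y N) :=
  (integrable_finsetSum _ fun _ hp => integrable_finsetSum _ fun _ _ =>
    integrable_quadKernel hc hX hx hy (ne_zero_of_mem_divisorsAntidiagonal hp).1).mul_const _

theorem integral_diagKernel (hc : 0 < c) (hX : 0 < X) (hx : 0 < x) (hy : 0 < y) (N : ℕ) :
    ∫ t, diagKernel k l s c X x y N t
      = (2 * Real.pi) ^ (1 + k + 2 * l) * diagWeight k l s X x y N := by
  have h := fun p (hp : p ∈ N.divisorsAntidiagonal) (q : ℕ × ℕ) => integrable_quadKernel
    (k := k) (l := l) (s := s) (q := q) hc hX hx hy (ne_zero_of_mem_divisorsAntidiagonal hp).1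
  unfold diagKernel diagWeight
  rw [integral_mul_const, ← mul_assoc, Finset.mul_sum,
    integral_finsetSum _ fun p hp => integrable_finsetSum _ fun q _ => h p hp q]
  congr 1
  refine Finset.sum_congr rfl fun p hp => ?_
  rw [Finset.mul_sum, integral_finsetSum _ fun q _ => h p hp q]
  exact Finset.sum_congr rfl fun q _ =>
    integral_quadKernel hc hX hx hy (ne_zero_of_mem_divisorsAntidiagonal hp).1

theorem norm_coeff_le (hs : 0 < s) : (∀ n, ‖divCoeff (1 / (2 * (s : ℝ))) n‖ ≤ 1) ∧
    ∀ n, ‖divMuCoeff (1 / (s : ℝ)) n‖ ≤ 1 := by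
  have h1 : (1 : ℝ) ≤ s := by exact_mod_cast hs
  refine ⟨norm_divCoeff_le (by positivity) ?_, norm_divMuCoeff_le (by positivity) ?_⟩ <;>
  · rw [div_le_one (by positivity)]; linarith

/-- There are d(N)² pairs of factorizations. By Fubini each has L¹ norm at most a constant times
d(N)^(k+2l) N^(-2c), because the two pairs multiply to N, and the outer factor is 1/N. -/
theorem exists_integral_norm_diagKernel_le (hs : 0 < s) (hc : 0 < c) (hX : 0 < X) (hx : 0 < x)
    (hy : 0 < y) : ∃ B : ℝ, ∀ N : ℕ, ∫ t, ‖diagKernel k l s c X x y N t‖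
      ≤ B * ((N.divisors.card : ℝ) ^ (2 + k + 2 * l) * (N : ℝ) ^ (-1 - 2 * c)) := by
  obtain ⟨hh1, hh2⟩ := norm_coeff_le hs
  set A0 := X ^ c * ∫ t : ℝ, ‖Complex.Gamma ((c : ℂ) + t * I)‖ with hA0
  set A1 := (x ^ c * ∫ t : ℝ, ‖1 / ((c : ℂ) + t * I) ^ (0 + 2)‖) ^ k with hA1
  set A2 := (y ^ c * ∫ t : ℝ, ‖1 / ((c : ℂ) + t * I) ^ (1 + 2)‖) ^ l with hA2
  have hint : ∀ F : ℝ → ℂ, 0 ≤ ∫ t : ℝ, ‖F t‖ := fun F => integral_nonneg fun _ => norm_nonneg _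
  have p0 : 0 ≤ A0 := mul_nonneg (by positivity) (hint _)
  have p1 : 0 ≤ A1 := pow_nonneg (mul_nonneg (by positivity) (hint _)) _
  have p2 : 0 ≤ A2 := pow_nonneg (mul_nonneg (by positivity) (hint _)) _
  refine ⟨A0 * (A1 * (A2 * A2)), fun N => ?_⟩
  rcases eq_or_ne N 0 with rfl | hN
  · simp only [diagKernel, Nat.divisorsAntidiagonal_zero, Finset.sum_empty, zero_mul, norm_zero,
      integral_zero]
    positivity
  have hN' : (0 : ℝ) < N := by exact_mod_cast Nat.pos_of_ne_zero hN
  set d : ℝ := (N.divisors.card : ℝ) with hd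
  have hd1 : 1 ≤ d := one_le_card_divisors hN
  have hdiv : ∀ m : ℕ, m ∣ N → (m.divisors.card : ℝ) ≤ d := fun m hm => by
    rw [hd]
    exact_mod_cast Finset.card_le_card (Nat.divisors_subset_of_dvd hN hm)
  have hquad : ∀ p ∈ N.divisorsAntidiagonal, ∀ q ∈ N.divisorsAntidiagonal,
      ∫ t, ‖quadKernel k l s c X x y p q t‖
        ≤ A0 * (A1 * (A2 * A2)) * d ^ (k + 2 * l) * (N : ℝ) ^ (-2 * c) := by
    intro p hp q hq
    obtain ⟨hp1, hp2⟩ := ne_zero_of_mem_divisorsAntidiagonal hp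
    obtain ⟨hq1, hq2⟩ := ne_zero_of_mem_divisorsAntidiagonal hq
    have hpN := (Nat.mem_divisorsAntidiagonal.mp hp).1
    have hqN := (Nat.mem_divisorsAntidiagonal.mp hq).1
    have e : ∫ t, ‖quadKernel k l s c X x y p q t‖
        = (∫ t, ‖gammaKernel c X p.1 t‖) *
          ((∫ t, ‖lineKernels k c x 0 (divCoeff (1 / (2 * (s : ℝ)))) q.1 t‖) *
            ((∫ t, ‖lineKernels l c y 1 (divMuCoeff (1 / (s : ℝ))) p.2 t‖) *
              ∫ t, ‖lineKernels l c y 1 (divMuCoeff (1 / (s : ℝ))) q.2 t‖)) := by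
      rw [← integral_prod_mul, ← integral_prod_mul, ← integral_prod_mul]
      simp only [quadKernel, norm_mul]
      rfl
    have eN : (N : ℝ) ^ (-2 * c)
        = (p.1 : ℝ) ^ (-c) * (p.2 : ℝ) ^ (-c) * ((q.1 : ℝ) ^ (-c) * (q.2 : ℝ) ^ (-c)) := by
      rw [← Real.mul_rpow (by positivity) (by positivity),
        ← Real.mul_rpow (by positivity) (by positivity), ← Nat.cast_mul, ← Nat.cast_mul, hpN, hqN,
        ← Real.rpow_add hN']
      ring_nf
    rw [e, eN, integral_norm_gammaKernel hX hp1]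
    have b1 := integral_norm_lineKernels_le (k := k) (j := 0) hc hh1 hx hq1
    have b2 := integral_norm_lineKernels_le (k := l) (j := 1) hc hh2 hy hp2
    have b3 := integral_norm_lineKernels_le (k := l) (j := 1) hc hh2 hy hq2
    rw [← hA1] at b1
    rw [← hA2] at b2 b3
    have hq1d := hdiv q.1 (hqN ▸ Dvd.intro _ rfl)
    have hp2d := hdiv p.2 (hpN ▸ Dvd.intro_left _ rfl)
    have hq2d := hdiv q.2 (hqN ▸ Dvd.intro_left _ rfl)
    have hn : ∀ (n : ℕ) (F : (Fin n → ℝ) → ℂ), 0 ≤ ∫ t, ‖F t‖ :=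
      fun n F => integral_nonneg fun _ => norm_nonneg _
    calc _ ≤ A0 * (p.1 : ℝ) ^ (-c) * (A1 * (d ^ k * (q.1 : ℝ) ^ (-c)) *
          (A2 * (d ^ l * (p.2 : ℝ) ^ (-c)) * (A2 * (d ^ l * (q.2 : ℝ) ^ (-c))))) := by
          refine mul_le_mul_of_nonneg_left ?_ (by positivity)
          refine mul_le_mul (b1.trans (by gcongr)) ?_ (mul_nonneg (hn _ _) (hn _ _))
            (by positivity)
          exact mul_le_mul (b2.trans (by gcongr)) (b3.trans (by gcongr)) (hn _ _) (by positivity)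
      _ = _ := by ring
  calc ∫ t, ‖diagKernel k l s c X x y N t‖
      ≤ ∫ t, (∑ p ∈ N.divisorsAntidiagonal, ∑ q ∈ N.divisorsAntidiagonal,
          ‖quadKernel k l s c X x y p q t‖) * (N : ℝ)⁻¹ := by
        refine integral_mono (integrable_diagKernel hc hX hx hy N).norm
          ((integrable_finsetSum _ fun p hp => integrable_finsetSum _ fun q _ =>
            (integrable_quadKernel hc hX hx hy
              (ne_zero_of_mem_divisorsAntidiagonal hp).1).norm).mul_const _) fun t => ?_
        simp only [diagKernel]
        rw [norm_mul, norm_inv, Complex.norm_natCast]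
        gcongr
        exact (norm_sum_le _ _).trans (Finset.sum_le_sum fun _ _ => norm_sum_le _ _)
    _ = (∑ p ∈ N.divisorsAntidiagonal, ∑ q ∈ N.divisorsAntidiagonal,
          ∫ t, ‖quadKernel k l s c X x y p q t‖) * (N : ℝ)⁻¹ := by
        have hI := fun p (hp : p ∈ N.divisorsAntidiagonal) (q : ℕ × ℕ) => (integrable_quadKernel
          (k := k) (l := l) (s := s) (q := q) hc hX hx hy
          (ne_zero_of_mem_divisorsAntidiagonal hp).1).norm
        rw [integral_mul_const,
          integral_finsetSum _ fun p hp => integrable_finsetSum _ fun q _ => hI p hp q]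
        congr 1
        exact Finset.sum_congr rfl fun p hp => integral_finsetSum _ fun q _ => hI p hp q
    _ ≤ (∑ p ∈ N.divisorsAntidiagonal, ∑ q ∈ N.divisorsAntidiagonal,
          A0 * (A1 * (A2 * A2)) * d ^ (k + 2 * l) * (N : ℝ) ^ (-2 * c)) * (N : ℝ)⁻¹ := by
        gcongr with p hp q hq
        exact hquad p hp q hq
    _ = _ := by
        rw [Finset.sum_const, Finset.sum_const, ← Nat.map_div_right_divisors, Finset.card_map,
          nsmul_eq_mul, nsmul_eq_mul, ← hd, show -1 - 2 * c = -2 * c - 1 by ring,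
          Real.rpow_sub_one hN'.ne']
        ring

theorem summable_integral_norm_diagKernel (hs : 0 < s) (hc : 0 < c) (hX : 0 < X) (hx : 0 < x)
    (hy : 0 < y) : Summable fun N => ∫ t, ‖diagKernel k l s c X x y N t‖ := by
  obtain ⟨B, hB⟩ := exists_integral_norm_diagKernel_le (k := k) (l := l) hs hc hX hx hy
  exact ((summable_diagCoeff_bound _ hc).mul_left B).of_nonneg_of_le
    (fun N => integral_nonneg fun _ => norm_nonneg _) hB

end

theorem integrandL_eq {r s q : ℕ} {x y : ℝ} (hx : 0 < x) (hy : 0 < y) (w₀ : ℂ)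
    (w : Fin (2 * s) → ℂ) (z₁ z₂ : Fin (s - r) → ℂ) :
    integrandL r s q x y w₀ w z₁ z₂
      = ((∏ i, zetaPow (1 / (2 * (s : ℝ))) (1 + w₀ + w i))
          * ∏ j, ∏ h, zetaPow (1 / (s : ℝ) ^ 2) (1 + z₁ j + z₂ h))
        / ((∏ i, ∏ j, zetaPow (1 / (2 * (s : ℝ) ^ 2)) (1 + w i + z₁ j))
          * ∏ h, zetaPow (1 / (s : ℝ)) (1 + w₀ + z₂ h)) * etaL s w₀ w z₁ z₂ *
        ((((q : ℝ) ^ (5 / 4 : ℝ) : ℝ) : ℂ) ^ w₀ * Complex.Gamma w₀ *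
          ((∏ i, ((x : ℂ) ^ w i * (1 / w i ^ (0 + 2)))) *
            ((∏ i, ((y : ℂ) ^ z₁ i * (1 / z₁ i ^ (1 + 2)))) *
              ∏ i, ((y : ℂ) ^ z₂ i * (1 / z₂ i ^ (1 + 2)))))) := by
  have hy0 : (y : ℂ) ≠ 0 := by exact_mod_cast hy.ne'
  simp only [Finset.prod_mul_distrib, one_div (_ ^ _ : ℂ), Finset.prod_inv_distrib]
  rw [integrandL, Complex.cpow_add _ _ hy0, ofReal_cpow_sum _ hx, ofReal_cpow_sum _ hy,
    ofReal_cpow_sum _ hy, div_eq_mul_inv (_ * _ : ℂ) (_ * _ * _), mul_inv, mul_inv]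
  ring

/-- At a fixed point of the lines every `diagKernel` is `diagCoeff` N times the same factor `R`, so
the claim is `zeta_ratio_mul_etaL` multiplied by `R`. -/
theorem hasSum_diagKernel {r s q : ℕ} (hs : 0 < s) {c x y : ℝ} (hc : 0 < c) (hx : 0 < x)
    (hy : 0 < y) (t : ℝ × (Fin (2 * s) → ℝ) × (Fin (s - r) → ℝ) × (Fin (s - r) → ℝ)) :
    HasSum (fun N => diagKernel (2 * s) (s - r) s c ((q : ℝ) ^ (5 / 4 : ℝ)) x y N t)
      (lineIntegrand r s q x y c t) := by
  set w₀ : ℂ := c + t.1 * I with hw₀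
  set w : Fin (2 * s) → ℂ := fun i => c + t.2.1 i * I with hw
  set z₁ : Fin (s - r) → ℂ := fun i => c + t.2.2.1 i * I with hz₁
  set z₂ : Fin (s - r) → ℂ := fun i => c + t.2.2.2 i * I with hz₂
  set X : ℝ := (q : ℝ) ^ (5 / 4 : ℝ) with hX
  have hre : ∀ u : ℝ, c ≤ ((c : ℂ) + u * I).re := fun u => by simp
  have hsum : Summable fun N => ‖diagCoeff s w₀ w z₁ z₂ N‖ :=
    (summable_diagCoeff_bound _ hc).of_nonneg_of_le (fun _ => norm_nonneg _)
      (norm_diagCoeff_le' hs (hre _) (fun _ => hre _) (fun _ => hre _) fun _ => hre _)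
  set R : ℂ := (X : ℂ) ^ w₀ * Complex.Gamma w₀ *
    ((∏ i, ((x : ℂ) ^ w i * (1 / w i ^ (0 + 2)))) *
      ((∏ i, ((y : ℂ) ^ z₁ i * (1 / z₁ i ^ (1 + 2)))) *
        ∏ i, ((y : ℂ) ^ z₂ i * (1 / z₂ i ^ (1 + 2))))) with hR
  have e1 : lineIntegrand r s q x y c t = (∑' N, diagCoeff s w₀ w z₁ z₂ N) * R := by
    rw [← zeta_ratio_mul_etaL (w := w) hs hc (hre _) (fun _ => hre _) (fun _ => hre _)
      fun _ => hre _]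
    exact integrandL_eq hx hy w₀ w z₁ z₂
  have e2 : ∀ N, diagKernel (2 * s) (s - r) s c X x y N t = diagCoeff s w₀ w z₁ z₂ N * R := by
    intro N
    rw [diagKernel, diagCoeff, leftAF, rightAF, ArithmeticFunction.mul_apply,
      ArithmeticFunction.mul_apply, div_mul_eq_mul_div, div_eq_mul_inv]
    congr 1
    rw [Finset.sum_mul_sum, Finset.sum_mul]
    refine Finset.sum_congr rfl fun p _ => ?_
    rw [Finset.sum_mul]
    refine Finset.sum_congr rfl fun q _ => ?_
    rw [quadKernel, gammaKernel, lineKernels_eq, lineKernels_eq, lineKernels_eq, hR]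
    ring
  rw [e1]
  simp only [e2]
  exact hsum.of_norm.hasSum.mul_right R

theorem integrable_lineIntegrand {r s q : ℕ} (hs : 0 < s) (hq : 0 < q) {c x y : ℝ} (hc : 0 < c)
    (hx : 0 < x) (hy : 0 < y) : Integrable (lineIntegrand r s q x y c) := by
  have hX : 0 < (q : ℝ) ^ (5 / 4 : ℝ) := Real.rpow_pos_of_pos (by exact_mod_cast hq) _
  exact integrable_of_hasSum (integrable_diagKernel hc hX hx hy)
    (summable_integral_norm_diagKernel hs hc hX hx hy) (hasSum_diagKernel hs hc hx hy)

/-- The integral `I_l` is the diagonal sum. -/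
theorem integralL_eq {r s q : ℕ} (hrs : r < s) (hq : 0 < q) {c x y : ℝ} (hc : 0 < c)
    (hx : 0 < x) (hy : 0 < y) :
    integralL r s q x y c = ∑' N, diagWeight (2 * s) (s - r) s ((q : ℝ) ^ (5 / 4 : ℝ)) x y N := by
  have hs : 0 < s := by omega
  have hX : 0 < (q : ℝ) ^ (5 / 4 : ℝ) := Real.rpow_pos_of_pos (by exact_mod_cast hq) _
  have h := hasSum_integral_of_summable_integral_norm
    (integrable_diagKernel (k := 2 * s) (l := s - r) (s := s) hc hX hx hy)
    (summable_integral_norm_diagKernel hs hc hX hx hy)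
  have e : ∀ t, ∑' N, diagKernel (2 * s) (s - r) s c ((q : ℝ) ^ (5 / 4 : ℝ)) x y N t
      = lineIntegrand r s q x y c t := fun t => (hasSum_diagKernel hs hc hx hy t).tsum_eq
  simp only [e, integral_diagKernel hc hX hx hy] at h
  -- The number of variables, where r < s makes the natural subtraction exact. The kernels produce
  -- (2π) to this power and du = i dt produces the same power of i; together they cancel the
  -- prefactor of `integralL`.
  have hn : 4 * s - 2 * r + 1 = 1 + 2 * s + 2 * (s - r) := by omega
  rw [integralL, integral_mul_const, ← h.tsum_eq, tsum_mul_left, hn]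
  have hpi : (Real.pi : ℂ) ≠ 0 := by exact_mod_cast Real.pi_ne_zero
  rw [mul_pow (2 * (Real.pi : ℂ)) I]
  have h1 : (2 * (Real.pi : ℂ)) ^ (1 + 2 * s + 2 * (s - r)) ≠ 0 :=
    pow_ne_zero _ (mul_ne_zero two_ne_zero hpi)
  have h2 : I ^ (1 + 2 * s + 2 * (s - r)) ≠ 0 := pow_ne_zero _ I_ne_zero
  field_simp

end FracMoment

/-! ### The Pólya–Vinogradov inequality for prime moduli -/

namespace FracMoment

open Complex Finset

/-- On (0, 1/2] one has sin πt ≥ 2t, and sin πt is symmetric about 1/2. The symmetric form of the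
bound lets the sum over residues become harmonic. -/
theorem one_div_sin_le {t : ℝ} (h0 : 0 < t) (h1 : t < 1) :
    1 / Real.sin (Real.pi * t) ≤ (1 / t + 1 / (1 - t)) / 2 := by
  have key : ∀ u : ℝ, 0 < u → u ≤ 1 / 2 → 2 * u ≤ Real.sin (Real.pi * u) := by
    intro u hu0 hu1
    have hpi := Real.pi_pos
    have := Real.mul_le_sin (x := Real.pi * u) (by positivity) (by nlinarith)
    calc 2 * u = 2 / Real.pi * (Real.pi * u) := by field_simp
      _ ≤ _ := this
  have h1' : 0 < 1 - t := by linarith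
  rcases le_total t (1 / 2) with h | h
  · have := key t h0 h
    calc 1 / Real.sin (Real.pi * t) ≤ 1 / (2 * t) :=
          one_div_le_one_div_of_le (by positivity) this
      _ = (1 / t) / 2 := by field_simp
      _ ≤ _ := by
          have : 0 < 1 / (1 - t) := by positivity
          linarith
  · have := key (1 - t) h1' (by linarith)
    rw [show Real.pi * (1 - t) = Real.pi - Real.pi * t by ring, Real.sin_pi_sub] at this
    calc 1 / Real.sin (Real.pi * t) ≤ 1 / (2 * (1 - t)) :=
          one_div_le_one_div_of_le (by positivity) this
      _ = (1 / (1 - t)) / 2 := by field_simp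
      _ ≤ _ := by
          have : 0 < 1 / t := by positivity
          linarith

section

variable {q : ℕ} [Fact q.Prime]

/-- The sum is (1 - z^N)/(1 - z), with numerator at most 2 and |1 - z| = 2 sin(πj/q). -/
theorem norm_geom_sum_stdAddChar_le {j : ℕ} (hj : 0 < j) (hjq : j < q) (N : ℕ) :
    ‖∑ m ∈ range N, (ZMod.stdAddChar (j : ZMod q) : ℂ) ^ m‖
      ≤ (q : ℝ) * (1 / j + 1 / ((q : ℝ) - j)) / 2 := by
  have hq0 : (0 : ℝ) < q := by exact_mod_cast (Fact.out : q.Prime).pos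
  have hj0 : (0 : ℝ) < j := by exact_mod_cast hj
  have hjq' : (j : ℝ) < q := by exact_mod_cast hjq
  have hqj : 0 < (q : ℝ) - j := by linarith
  set z : ℂ := ZMod.stdAddChar (j : ZMod q) with hz
  have hze : z = cexp (I * ((2 * (Real.pi * (j / q)) : ℝ) : ℂ)) := by
    have := ZMod.stdAddChar_coe (N := q) (j : ℤ)
    rw [Int.cast_natCast] at this
    rw [hz, this]
    congr 1
    push_cast
    ring
  have ht0 : 0 < (j : ℝ) / q := by positivity
  have ht1 : (j : ℝ) / q < 1 := by rwa [div_lt_one hq0]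
  have hsin : 0 < Real.sin (Real.pi * (j / q)) :=
    Real.sin_pos_of_pos_of_lt_pi (by positivity) (by nlinarith [Real.pi_pos])
  have hn : ‖1 - z‖ = 2 * Real.sin (Real.pi * (j / q)) := by
    rw [norm_sub_rev, hze, norm_exp_I_mul_ofReal_sub_one,
      show 2 * (Real.pi * ((j : ℝ) / q)) / 2 = Real.pi * (j / q) by ring,
      Real.norm_of_nonneg (by positivity)]
  have hz1 : ‖z‖ = 1 := by rw [hze, mul_comm]; exact norm_exp_ofReal_mul_I _
  have h2 : ‖1 - z ^ N‖ ≤ 2 := by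
    refine (norm_sub_le _ _).trans ?_
    rw [norm_pow, hz1]; norm_num
  have h3 := congrArg norm (mul_neg_geom_sum z N)
  rw [norm_mul, hn] at h3
  have h4 : ‖∑ m ∈ range N, z ^ m‖ ≤ 1 / Real.sin (Real.pi * (j / q)) := by
    rw [le_div_iff₀ hsin]
    nlinarith
  refine h4.trans ((one_div_sin_le ht0 ht1).trans (le_of_eq ?_))
  field_simp

theorem sum_ne_zero_eq_sum_range {M : Type*} [AddCommMonoid M] (F : ZMod q → M) :
    ∑ a with a ≠ 0, F a = ∑ i ∈ range (q - 1), F ((i + 1 : ℕ) : ZMod q) := by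
  have hq : 1 < q := (Fact.out : q.Prime).one_lt
  symm
  refine Finset.sum_nbij' (fun i => ((i + 1 : ℕ) : ZMod q)) (fun a => a.val - 1) ?_ ?_ ?_ ?_ ?_
  · intro i hi
    have hi' : i + 1 < q := by have := mem_range.mp hi; omega
    simp only [mem_filter, mem_univ, true_and]
    rw [Ne, ZMod.natCast_eq_zero_iff]
    exact fun h => absurd (Nat.le_of_dvd (by omega) h) (by omega)
  · intro a ha
    have h1 := ZMod.val_lt a
    have h2 : a.val ≠ 0 := by simpa using ha
    rw [mem_range]; omega
  · intro i hi
    have hi' : i + 1 < q := by have := mem_range.mp hi; omega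
    rw [ZMod.val_cast_of_lt hi']; omega
  · intro a ha
    have h2 : a.val ≠ 0 := by simpa using ha
    rw [Nat.sub_add_cancel (by omega), ZMod.natCast_zmod_val]
  · intros; rfl

/-- The reflection j ↦ q - j identifies the two sums of reciprocals, and a harmonic sum is at most 1
+ log q. -/
theorem sum_geom_sum_le (N : ℕ) :
    ∑ a : ZMod q with a ≠ 0, ‖∑ m ∈ range N, (ZMod.stdAddChar a : ℂ) ^ m‖
      ≤ q * (1 + Real.log q) := by
  have hq : 1 < q := (Fact.out : q.Prime).one_lt
  rw [sum_ne_zero_eq_sum_range]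
  have hH : ∑ i ∈ range (q - 1), (1 / ((i : ℝ) + 1)) ≤ 1 + Real.log q := by
    have h := harmonic_le_one_add_log (q - 1)
    rw [harmonic] at h
    push_cast at h
    simp only [one_div]
    refine h.trans ?_
    gcongr
    · have : 0 < q - 1 := by omega
      exact_mod_cast this
    · omega
  have hR : ∑ i ∈ range (q - 1), (1 / ((q : ℝ) - ((i : ℝ) + 1)))
      = ∑ i ∈ range (q - 1), (1 / ((i : ℝ) + 1)) := by
    rw [← Finset.sum_range_reflect]
    refine Finset.sum_congr rfl fun i hi => ?_
    have hi' := mem_range.mp hi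
    congr 1
    rw [Nat.sub_sub, Nat.cast_sub (by omega), Nat.cast_sub (by omega)]
    push_cast; ring
  calc _ ≤ ∑ i ∈ range (q - 1),
        (q : ℝ) * (1 / ((i : ℝ) + 1) + 1 / ((q : ℝ) - ((i : ℝ) + 1))) / 2 := by
        refine Finset.sum_le_sum fun i hi => ?_
        have hi' := mem_range.mp hi
        have := norm_geom_sum_stdAddChar_le (q := q) (j := i + 1) (by omega) (by omega) N
        push_cast at this ⊢
        exact this
    _ = q * ∑ i ∈ range (q - 1), (1 / ((i : ℝ) + 1)) := by
        rw [← Finset.sum_div, ← Finset.mul_sum, Finset.sum_add_distrib, hR]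
        ring
    _ ≤ _ := by gcongr

theorem isPrimitive_of_ne_one {χ : DirichletCharacter ℂ q} (hχ : χ ≠ 1) : χ.IsPrimitive := by
  rw [DirichletCharacter.isPrimitive_def]
  rcases (Nat.dvd_prime Fact.out).mp χ.conductor_dvd_level with h | h
  · exact absurd ((DirichletCharacter.eq_one_iff_conductor_eq_one).mpr h) hχ
  · exact h

theorem norm_gaussSum_sq {χ : DirichletCharacter ℂ q} (hχ : χ ≠ 1) :
    ‖gaussSum χ ZMod.stdAddChar‖ ^ 2 = q := by
  have h := gaussSum_mul_gaussSum_eq_card hχ (ZMod.isPrimitive_stdAddChar q)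
  have hc : gaussSum χ⁻¹ ZMod.stdAddChar⁻¹
      = (starRingEnd ℂ) (gaussSum χ (ZMod.stdAddChar (N := q))) := by
    rw [gaussSum, gaussSum, map_sum]
    refine Finset.sum_congr rfl fun a _ => ?_
    rw [map_mul, ← MulChar.star_apply', AddChar.inv_apply, AddChar.map_neg_eq_conj]
    rfl
  rw [hc, Complex.mul_conj, ZMod.card, Complex.normSq_eq_norm_sq] at h
  exact_mod_cast h

/-- The Pólya–Vinogradov inequality for a prime modulus. -/
theorem norm_sum_range_char_le {χ : DirichletCharacter ℂ q} (hχ : χ ≠ 1) (N : ℕ) :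
    ‖∑ m ∈ range N, χ (m : ZMod q)‖ ≤ Real.sqrt q * (1 + Real.log q) := by
  have hq0 : (0 : ℝ) < q := by exact_mod_cast (Fact.out : q.Prime).pos
  have hχ' : χ⁻¹ ≠ 1 := inv_ne_one.mpr hχ
  set τ := gaussSum χ⁻¹ (ZMod.stdAddChar (N := q)) with hτ
  have hτn : ‖τ‖ = Real.sqrt q := by
    rw [← norm_gaussSum_sq hχ', Real.sqrt_sq (norm_nonneg _)]
  -- The expansion χ(m) τ(χ⁻¹) = ∑ χ⁻¹(a) e(am/q) turns the character sum into geometric sums. The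
  -- term a = 0, which would be of size N, drops out since χ⁻¹(0) = 0.
  have e : (∑ m ∈ range N, χ (m : ZMod q)) * τ
      = ∑ a : ZMod q, χ⁻¹ a * ∑ m ∈ range N, (ZMod.stdAddChar a : ℂ) ^ m := by
    rw [Finset.sum_mul]
    have : ∀ m ∈ range N, χ (m : ZMod q) * τ
        = ∑ a : ZMod q, χ⁻¹ a * (ZMod.stdAddChar a : ℂ) ^ m := by
      intro m _
      have h := gaussSum_mulShift_of_isPrimitive (ZMod.stdAddChar (N := q))
        (isPrimitive_of_ne_one hχ') (m : ZMod q)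
      rw [inv_inv] at h
      rw [← h, gaussSum]
      refine Finset.sum_congr rfl fun a _ => ?_
      rw [AddChar.mulShift_apply, ← nsmul_eq_mul, AddChar.map_nsmul_eq_pow]
    rw [Finset.sum_congr rfl this, Finset.sum_comm]
    exact Finset.sum_congr rfl fun a _ => (Finset.mul_sum _ _ _).symm
  have hb : ‖(∑ m ∈ range N, χ (m : ZMod q)) * τ‖ ≤ q * (1 + Real.log q) := by
    rw [e]
    refine (norm_sum_le _ _).trans (le_trans ?_ (sum_geom_sum_le N))
    rw [← Finset.sum_filter_add_sum_filter_not univ (fun a : ZMod q => a ≠ 0)]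
    have h0 : ∑ a : ZMod q with ¬ a ≠ 0,
        ‖χ⁻¹ a * ∑ m ∈ range N, (ZMod.stdAddChar a : ℂ) ^ m‖ = 0 := by
      refine Finset.sum_eq_zero fun a ha => ?_
      have : a = 0 := by simpa using ha
      rw [this, MulChar.map_zero, zero_mul, norm_zero]
    rw [h0, add_zero]
    refine Finset.sum_le_sum fun a _ => ?_
    rw [norm_mul]
    exact mul_le_of_le_one_left (norm_nonneg _) (DirichletCharacter.norm_le_one _ _)
  rw [norm_mul, hτn] at hb
  have hs : 0 < Real.sqrt q := Real.sqrt_pos.mpr hq0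
  refine le_of_mul_le_mul_right (hb.trans (le_of_eq ?_)) hs
  nth_rewrite 1 [← Real.mul_self_sqrt hq0.le]
  ring

end

end FracMoment

/-! ### Approximating L(1/2, χ) by a smoothed series -/

namespace FracMoment

open Complex Finset Filter Topology

theorem sum_range_succ_mul_eq (a g : ℕ → ℂ) (N : ℕ) :
    ∑ m ∈ range (N + 1), a m * g m = (∑ m ∈ range (N + 1), a m) * g N
      + ∑ n ∈ range N, (∑ m ∈ range (n + 1), a m) * (g n - g (n + 1)) := by
  induction N with
  | zero => simp
  | succ N ih =>
    rw [Finset.sum_range_succ (fun m => a m * g m) (N + 1), ih,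
      Finset.sum_range_succ (fun n => (∑ m ∈ range (n + 1), a m) * (g n - g (n + 1))) N,
      Finset.sum_range_succ a (N + 1)]
    ring

/-- Summation by parts for a series with bounded partial sums. -/
theorem tsum_mul_eq_tsum_partial_sums {a g : ℕ → ℂ} {B : ℝ}
    (hB : ∀ n, ‖∑ m ∈ range (n + 1), a m‖ ≤ B) (hg : Tendsto g atTop (𝓝 0))
    (hd : Summable fun n => ‖g n - g (n + 1)‖) (hs : Summable fun n => a n * g n) :
    ∑' n, a n * g n = ∑' n, (∑ m ∈ range (n + 1), a m) * (g n - g (n + 1)) := by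
  have hS : Summable fun n => (∑ m ∈ range (n + 1), a m) * (g n - g (n + 1)) := by
    refine Summable.of_norm_bounded (hd.mul_left B) fun n => ?_
    rw [norm_mul]
    exact mul_le_mul_of_nonneg_right (hB n) (norm_nonneg _)
  have h1 : Tendsto (fun N => ∑ m ∈ range (N + 1), a m * g m) atTop (𝓝 (∑' n, a n * g n)) :=
    hs.hasSum.tendsto_sum_nat.comp (tendsto_add_atTop_nat 1)
  have h2 : Tendsto (fun N => (∑ m ∈ range (N + 1), a m) * g N) atTop (𝓝 0) := by
    refine squeeze_zero_norm (fun N => ?_) (by simpa using (hg.norm).const_mul B)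
    rw [norm_mul]
    exact mul_le_mul_of_nonneg_right (hB N) (norm_nonneg _)
  have h3 := h2.add hS.hasSum.tendsto_sum_nat
  rw [zero_add] at h3
  refine tendsto_nhds_unique h1 (h3.congr fun N => ?_)
  exact (sum_range_succ_mul_eq a g N).symm

theorem norm_cpow_sub_cpow_le {s : ℂ} (hs : 0 < s.re) {m : ℝ} (hm : 0 < m) :
    ‖(m : ℂ) ^ (-s) - ((m + 1 : ℝ) : ℂ) ^ (-s)‖ ≤ ‖s‖ * m ^ (-s.re - 1) := by
  have hs0 : -s ≠ 0 := by
    intro h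
    rw [neg_eq_zero.mp h] at hs
    simp at hs
  have hd : ∀ t ∈ Set.Icc m (m + 1), HasDerivWithinAt (fun t : ℝ => (t : ℂ) ^ (-s))
      (-s * (t : ℂ) ^ (-s - 1)) (Set.Icc m (m + 1)) t := fun t ht =>
    (hasDerivAt_ofReal_cpow_const (hm.trans_le ht.1).ne' hs0).hasDerivWithinAt
  have h := Convex.norm_image_sub_le_of_norm_hasDerivWithin_le (C := ‖s‖ * m ^ (-s.re - 1)) hd
    (fun t ht => ?_) (convex_Icc m (m + 1)) (Set.right_mem_Icc.mpr (by linarith))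
    (Set.left_mem_Icc.mpr (by linarith))
  · refine h.trans (le_of_eq ?_)
    rw [show m - (m + 1) = -1 by ring, norm_neg, norm_one, mul_one]
  · have ht0 : 0 < t := hm.trans_le ht.1
    rw [norm_mul, norm_neg, Complex.norm_cpow_eq_rpow_re_of_pos ht0]
    gcongr
    simp only [Complex.sub_re, Complex.neg_re, Complex.one_re]
    exact Real.rpow_le_rpow_of_nonpos hm ht.1 (by linarith)

section

variable {q : ℕ} [Fact q.Prime]

theorem char_zero (χ : DirichletCharacter ℂ q) : χ 0 = 0 :=
  MulChar.map_zero χ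

theorem sum_range_char_succ (χ : DirichletCharacter ℂ q) (n : ℕ) :
    ∑ m ∈ range n, χ ((m + 1 : ℕ) : ZMod q) = ∑ m ∈ range (n + 1), χ (m : ZMod q) := by
  rw [Finset.sum_range_succ']
  simp [char_zero]

theorem norm_sum_range_char_succ_le {χ : DirichletCharacter ℂ q} (hχ : χ ≠ 1) (n : ℕ) :
    ‖∑ m ∈ range n, χ ((m + 1 : ℕ) : ZMod q)‖ ≤ Real.sqrt q * (1 + Real.log q) := by
  rw [sum_range_char_succ]
  exact norm_sum_range_char_le hχ _

theorem tendsto_natCast_succ_cpow {s : ℂ} (hs : 0 < s.re) :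
    Tendsto (fun n : ℕ => ((n + 1 : ℝ) : ℂ) ^ (-s)) atTop (𝓝 0) := by
  rw [tendsto_zero_iff_norm_tendsto_zero]
  have h1 : Tendsto (fun n : ℕ => ((n : ℝ) + 1) ^ (-s.re)) atTop (𝓝 0) :=
    (tendsto_rpow_neg_atTop hs).comp
      (tendsto_atTop_add_const_right _ _ tendsto_natCast_atTop_atTop)
  refine h1.congr fun n => ?_
  rw [Complex.norm_cpow_eq_rpow_re_of_pos (by positivity), Complex.neg_re]

theorem summable_succ_rpow {b : ℝ} (hb : b < -1) : Summable fun n : ℕ => ((n : ℝ) + 1) ^ b := by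
  have := (summable_nat_add_iff 1).mpr (Real.summable_nat_rpow.mpr hb)
  simpa using this

theorem summable_norm_cpow_sub {s : ℂ} (hs : 0 < s.re) :
    Summable fun n : ℕ => ‖((n + 1 : ℝ) : ℂ) ^ (-s) - (((n + 1 : ℕ) + 1 : ℝ) : ℂ) ^ (-s)‖ := by
  refine ((summable_succ_rpow (b := -s.re - 1) (by linarith)).mul_left ‖s‖).of_nonneg_of_le
    (fun _ => norm_nonneg _) fun n => ?_
  rw [Nat.cast_add, Nat.cast_one]
  exact norm_cpow_sub_cpow_le hs (by positivity)

theorem LFunction_eq_tsum_partial_sums_of_one_lt {χ : DirichletCharacter ℂ q} (hχ : χ ≠ 1) {s : ℂ}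
    (hs : 1 < s.re) :
    DirichletCharacter.LFunction χ s = ∑' n : ℕ, (∑ m ∈ range (n + 1), χ ((m + 1 : ℕ) : ZMod q)) *
      (((n + 1 : ℝ) : ℂ) ^ (-s) - (((n + 1 : ℕ) + 1 : ℝ) : ℂ) ^ (-s)) := by
  have hterm : ∀ n : ℕ, LSeries.term (fun n => χ (n : ZMod q)) s (n + 1)
      = χ ((n + 1 : ℕ) : ZMod q) * ((n + 1 : ℝ) : ℂ) ^ (-s) := fun n => by
    rw [LSeries.term_of_ne_zero (by omega), Complex.cpow_neg, div_eq_mul_inv]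
    push_cast
    rfl
  have hsum : LSeriesSummable (fun n => χ (n : ZMod q)) s :=
    DirichletCharacter.LSeriesSummable_of_one_lt_re χ hs
  have hsum1 := (summable_nat_add_iff 1).mpr hsum
  simp only [hterm] at hsum1
  rw [DirichletCharacter.LFunction_eq_LSeries χ hs, LSeries, Summable.tsum_eq_zero_add hsum,
    LSeries.term_zero, zero_add]
  simp only [hterm]
  exact tsum_mul_eq_tsum_partial_sums (fun n => norm_sum_range_char_succ_le hχ _)
    (tendsto_natCast_succ_cpow (by linarith)) (summable_norm_cpow_sub (by linarith)) hsum1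

/-- Analytic continuation. With bounded partial character sums the series is dominated by ∑ |s|
n^(-Re s - 1), hence holomorphic for Re s > 1/4 in a ball, where |s| stays bounded. It equals L near
s = 2, and the region is convex and contains 1/2. -/
theorem LFunction_half_eq_tsum_partial_sums {χ : DirichletCharacter ℂ q} (hχ : χ ≠ 1) :
    DirichletCharacter.LFunction χ (1 / 2) =
      ∑' n : ℕ, (∑ m ∈ range (n + 1), χ ((m + 1 : ℕ) : ZMod q)) *
        (((n + 1 : ℝ) : ℂ) ^ (-(1 / 2) : ℂ) - (((n + 1 : ℕ) + 1 : ℝ) : ℂ) ^ (-(1 / 2) : ℂ)) := by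
  set U : Set ℂ := {s | 1 / 4 < s.re} ∩ Metric.ball 0 3 with hU
  have hUo : IsOpen U := (isOpen_lt continuous_const Complex.continuous_re).inter Metric.isOpen_ball
  have hUc : IsPreconnected U :=
    ((convex_halfSpace_re_gt _).inter (convex_ball _ _)).isPreconnected
  set B : ℝ := Real.sqrt q * (1 + Real.log q) with hB
  have hB0 : 0 ≤ B := (norm_nonneg _).trans (norm_sum_range_char_succ_le hχ 0)
  set G : ℂ → ℂ := fun s => ∑' n : ℕ, (∑ m ∈ range (n + 1), χ ((m + 1 : ℕ) : ZMod q)) *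
      (((n + 1 : ℝ) : ℂ) ^ (-s) - (((n + 1 : ℕ) + 1 : ℝ) : ℂ) ^ (-s)) with hG
  have hdiff : DifferentiableOn ℂ G U := by
    refine differentiableOn_tsum_of_summable_norm
      (u := fun n : ℕ => B * (3 * ((n : ℝ) + 1) ^ (-(5 / 4) : ℝ)))
      (((summable_succ_rpow (by norm_num)).mul_left 3).mul_left B) (fun n => ?_) hUo ?_
    · have hc : ∀ t : ℝ, 0 < t → Differentiable ℂ fun s : ℂ => (t : ℂ) ^ (-s) := fun t ht =>
        differentiable_neg.const_cpow (Or.inl (by exact_mod_cast ht.ne'))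
      exact (((hc _ (by positivity)).sub (hc _ (by positivity))).const_mul _).differentiableOn
    · intro n s hs
      have h1 : 1 / 4 < s.re := hs.1
      have h2 : ‖s‖ ≤ 3 := by simpa using (Metric.mem_ball.mp hs.2).le
      rw [norm_mul]
      refine mul_le_mul (norm_sum_range_char_succ_le hχ _) ?_ (norm_nonneg _) hB0
      rw [Nat.cast_add, Nat.cast_one]
      refine (norm_cpow_sub_cpow_le (by linarith) (by positivity)).trans ?_
      have : (1 : ℝ) ≤ (n : ℝ) + 1 := by
        have : (0 : ℝ) ≤ n := by positivity
        linarith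
      gcongr
      linarith
  have hL : DifferentiableOn ℂ (DirichletCharacter.LFunction χ) U :=
    (DirichletCharacter.differentiable_LFunction hχ).differentiableOn
  have h2U : (2 : ℂ) ∈ U := by
    refine ⟨?_, ?_⟩
    · simp only [Set.mem_ofPred_eq]; norm_num
    · simp; norm_num
  have hev : DirichletCharacter.LFunction χ =ᶠ[𝓝 2] G := by
    have : {s : ℂ | 1 < s.re} ∈ 𝓝 (2 : ℂ) :=
      (isOpen_lt continuous_const Complex.continuous_re).mem_nhds (by simp)
    filter_upwards [this] with s hs
    exact LFunction_eq_tsum_partial_sums_of_one_lt hχ hs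
  refine (hL.analyticOnNhd hUo).eqOn_of_preconnected_of_eventuallyEq (hdiff.analyticOnNhd hUo) hUc
    h2U hev ⟨?_, ?_⟩
  · simp only [Set.mem_ofPred_eq]; norm_num
  · simp; norm_num

end

/-- The left side is at most min(u, 1), which u^θ dominates. The free exponent allows powers of m to
be traded for powers of X. -/
theorem one_sub_exp_neg_le_rpow {u θ : ℝ} (hu : 0 ≤ u) (h0 : 0 ≤ θ) (h1 : θ ≤ 1) :
    1 - Real.exp (-u) ≤ u ^ θ := by
  rcases le_or_gt u 1 with h | h
  · have h2 : 1 - Real.exp (-u) ≤ u := by linarith [Real.add_one_le_exp (-u)]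
    refine h2.trans ?_
    rcases eq_or_lt_of_le hu with rfl | hu'
    · positivity
    · calc u = u ^ (1 : ℝ) := (Real.rpow_one u).symm
        _ ≤ u ^ θ := Real.rpow_le_rpow_of_exponent_ge hu' h h1
  · have := Real.exp_pos (-u)
    have h3 : 1 ≤ u ^ θ := Real.one_le_rpow h.le h0
    linarith

theorem exp_neg_le_rpow {u κ : ℝ} (hu : 0 < u) (h0 : 0 ≤ κ) (h1 : κ ≤ 1) :
    Real.exp (-u) ≤ u ^ (-κ) := by
  rw [Real.exp_neg, Real.rpow_neg hu.le]
  gcongr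
  have h2 : u ^ κ ≤ 1 + u := by
    rcases le_or_gt u 1 with h | h
    · have := Real.rpow_le_one hu.le h h0
      linarith
    · have := Real.rpow_le_rpow_of_exponent_le h.le h1
      rw [Real.rpow_one] at this
      linarith
  linarith [Real.add_one_le_exp u]

/-- The weight `m^{-1/2} e^{-m/X}`. -/
noncomputable def smoothWeight (X m : ℝ) : ℝ := m ^ (-(1 / 2) : ℝ) * Real.exp (-(m / X))

theorem smoothWeight_le {X m κ : ℝ} (hX : 0 < X) (hm : 0 < m) (h0 : 0 ≤ κ) (h1 : κ ≤ 1) :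
    smoothWeight X m ≤ X ^ κ * m ^ (-(1 / 2) - κ) := by
  rw [smoothWeight]
  calc m ^ (-(1 / 2) : ℝ) * Real.exp (-(m / X)) ≤ m ^ (-(1 / 2) : ℝ) * (m / X) ^ (-κ) := by
        gcongr
        exact exp_neg_le_rpow (by positivity) h0 h1
    _ = _ := by
        rw [Real.div_rpow hm.le hX.le, Real.rpow_neg hX.le, Real.rpow_sub hm, Real.rpow_neg hm.le κ]
        field_simp

theorem smoothWeight_nonneg {X m : ℝ} (hm : 0 ≤ m) : 0 ≤ smoothWeight X m :=
  mul_nonneg (Real.rpow_nonneg hm _) (Real.exp_pos _).le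

/-- A discrete product rule splits the difference into a change of m^(-1/2) against 1 - e^(-m/X) ≤
(m/X)^(12/25), and a change of e^(-m/X), at most e^(-m/X)/X with e^(-m/X) ≤ (m/X)^(-13/25). The
exponents are chosen so that both pieces are X^(-12/25) m^(-51/50), barely summable in m. -/
theorem abs_sharp_sub_smooth_le {X m : ℝ} (hX : 0 < X) (hm : 0 < m) :
    |(m ^ (-(1 / 2) : ℝ) - smoothWeight X m)
        - ((m + 1) ^ (-(1 / 2) : ℝ) - smoothWeight X (m + 1))|
      ≤ 2 * X ^ (-(12 / 25) : ℝ) * m ^ (-(51 / 50) : ℝ) := by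
  have hm1 : 0 < m + 1 := by linarith
  have hdiff : |m ^ (-(1 / 2) : ℝ) - (m + 1) ^ (-(1 / 2) : ℝ)| ≤ m ^ (-(3 / 2) : ℝ) := by
    have h := norm_cpow_sub_cpow_le (s := 1 / 2) (by norm_num) hm
    have e1 : ∀ t : ℝ, 0 < t → (t : ℂ) ^ (-(1 / 2) : ℂ) = ((t ^ (-(1 / 2) : ℝ) : ℝ) : ℂ) := by
      intro t ht
      rw [Complex.ofReal_cpow ht.le]
      norm_num
    rw [e1 m hm, e1 _ hm1, ← Complex.ofReal_sub, Complex.norm_real, Real.norm_eq_abs] at h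
    refine h.trans ?_
    have e2 : (-(1 / 2 : ℂ).re - 1) = (-(3 / 2) : ℝ) := by norm_num
    have e3 : ‖(1 / 2 : ℂ)‖ = 1 / 2 := by norm_num
    rw [e2, e3]
    have : 0 ≤ m ^ (-(3 / 2) : ℝ) := by positivity
    linarith
  have h1 : 0 ≤ 1 - Real.exp (-(m / X)) := by
    have : Real.exp (-(m / X)) ≤ 1 := Real.exp_le_one_iff.mpr (by
      have : 0 ≤ m / X := by positivity
      linarith)
    linarith
  have h2 : 1 - Real.exp (-(m / X)) ≤ (m / X) ^ (12 / 25 : ℝ) :=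
    one_sub_exp_neg_le_rpow (by positivity) (by norm_num) (by norm_num)
  have h3 : Real.exp (-(m / X)) ≤ (m / X) ^ (-(13 / 25) : ℝ) :=
    exp_neg_le_rpow (by positivity) (by norm_num) (by norm_num)
  have h4 : 0 ≤ Real.exp (-(m / X)) - Real.exp (-((m + 1) / X)) := by
    rw [sub_nonneg]
    gcongr
    linarith
  have h5 : Real.exp (-(m / X)) - Real.exp (-((m + 1) / X)) ≤ Real.exp (-(m / X)) * X⁻¹ := by
    have e : Real.exp (-((m + 1) / X)) = Real.exp (-(m / X)) * Real.exp (-X⁻¹) := by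
      rw [← Real.exp_add]; congr 1; field_simp; ring
    rw [e]
    nlinarith [Real.add_one_le_exp (-X⁻¹), Real.exp_pos (-(m / X))]
  have h6 : (m + 1) ^ (-(1 / 2) : ℝ) ≤ m ^ (-(1 / 2) : ℝ) :=
    Real.rpow_le_rpow_of_nonpos hm (by linarith) (by norm_num)
  have e : (m ^ (-(1 / 2) : ℝ) - smoothWeight X m)
        - ((m + 1) ^ (-(1 / 2) : ℝ) - smoothWeight X (m + 1))
      = (m ^ (-(1 / 2) : ℝ) - (m + 1) ^ (-(1 / 2) : ℝ)) * (1 - Real.exp (-(m / X)))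
        - (m + 1) ^ (-(1 / 2) : ℝ) * (Real.exp (-(m / X)) - Real.exp (-((m + 1) / X))) := by
    simp only [smoothWeight]
    ring
  rw [e]
  refine (abs_sub _ _).trans ?_
  rw [abs_mul, abs_mul, abs_of_nonneg h1, abs_of_nonneg h4,
    abs_of_nonneg (show 0 ≤ (m + 1) ^ (-(1 / 2) : ℝ) by positivity)]
  have a1 : |m ^ (-(1 / 2) : ℝ) - (m + 1) ^ (-(1 / 2) : ℝ)| * (1 - Real.exp (-(m / X)))
      ≤ X ^ (-(12 / 25) : ℝ) * m ^ (-(51 / 50) : ℝ) := by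
    calc _ ≤ m ^ (-(3 / 2) : ℝ) * (m / X) ^ (12 / 25 : ℝ) := by gcongr
      _ = _ := by
        rw [Real.div_rpow hm.le hX.le, Real.rpow_neg hX.le,
          show (-(51 / 50) : ℝ) = -(3 / 2) + 12 / 25 by norm_num, Real.rpow_add hm]
        field_simp
  have a2 : (m + 1) ^ (-(1 / 2) : ℝ) * (Real.exp (-(m / X)) - Real.exp (-((m + 1) / X)))
      ≤ X ^ (-(12 / 25) : ℝ) * m ^ (-(51 / 50) : ℝ) := by
    calc _ ≤ m ^ (-(1 / 2) : ℝ) * ((m / X) ^ (-(13 / 25) : ℝ) * X⁻¹) := by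
          gcongr
          exact h5.trans (by gcongr)
      _ = _ := by
        rw [Real.div_rpow hm.le hX.le, show (-(12 / 25) : ℝ) = -(-(13 / 25)) + -1 by norm_num,
          show (-(51 / 50) : ℝ) = -(1 / 2) + -(13 / 25) by norm_num, Real.rpow_add hm,
          Real.rpow_add hX, Real.rpow_neg_one, Real.rpow_neg hX.le (-(13 / 25))]
        field_simp
  linarith

section

variable {q : ℕ} [Fact q.Prime]

theorem summable_smoothWeight {X : ℝ} (hX : 0 < X) :
    Summable fun n : ℕ => smoothWeight X ((n : ℝ) + 1) := by
  refine ((summable_succ_rpow (b := -(1 / 2) - 3 / 5) (by norm_num)).mul_left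
    (X ^ (3 / 5 : ℝ))).of_nonneg_of_le (fun n => smoothWeight_nonneg (by positivity)) fun n => ?_
  exact smoothWeight_le hX (by positivity) (by norm_num) (by norm_num)

theorem summable_char_mul_smoothWeight (χ : DirichletCharacter ℂ q) {X : ℝ} (hX : 0 < X) :
    Summable fun n : ℕ => χ ((n + 1 : ℕ) : ZMod q) * (smoothWeight X ((n : ℝ) + 1) : ℂ) := by
  refine Summable.of_norm_bounded (summable_smoothWeight hX) fun n => ?_
  rw [norm_mul, Complex.norm_real, Real.norm_of_nonneg (smoothWeight_nonneg (by positivity))]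
  exact mul_le_of_le_one_left (smoothWeight_nonneg (by positivity))
    (DirichletCharacter.norm_le_one _ _)

/-- `L(1/2, χ)` is approximated by a smoothed Dirichlet polynomial. -/
theorem exists_norm_LFunction_half_sub_le : ∃ C : ℝ, ∀ (q : ℕ) [Fact q.Prime]
    (χ : DirichletCharacter ℂ q) (_ : χ ≠ 1) (X : ℝ) (_ : 0 < X),
    ‖DirichletCharacter.LFunction χ (1 / 2)
        - ∑' n : ℕ, χ ((n + 1 : ℕ) : ZMod q) * (smoothWeight X ((n : ℝ) + 1) : ℂ)‖
      ≤ C * (Real.sqrt q * (1 + Real.log q)) * X ^ (-(12 / 25) : ℝ) := by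
  refine ⟨2 * ∑' n : ℕ, ((n : ℝ) + 1) ^ (-(51 / 50) : ℝ), fun q _ χ hχ X hX => ?_⟩
  set S : ℕ → ℂ := fun n => ∑ m ∈ range (n + 1), χ ((m + 1 : ℕ) : ZMod q) with hS
  set B : ℝ := Real.sqrt q * (1 + Real.log q) with hB
  have hSB : ∀ n, ‖S n‖ ≤ B := fun n => norm_sum_range_char_succ_le hχ _
  have hB0 : 0 ≤ B := (norm_nonneg _).trans (hSB 0)
  set g : ℕ → ℂ := fun n => ((n + 1 : ℝ) : ℂ) ^ (-(1 / 2) : ℂ) with hg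
  set v : ℕ → ℂ := fun n => (smoothWeight X ((n : ℝ) + 1) : ℂ) with hv
  have hgr : ∀ n : ℕ, g n = ((((n : ℝ) + 1) ^ (-(1 / 2) : ℝ) : ℝ) : ℂ) := fun n => by
    rw [Complex.ofReal_cpow (by positivity)]
    norm_num [hg]
  have hrs : Summable fun n : ℕ => ((n : ℝ) + 1) ^ (-(51 / 50) : ℝ) :=
    summable_succ_rpow (by norm_num)
  have hbd : ∀ n, ‖(g n - g (n + 1)) - (v n - v (n + 1))‖
      ≤ 2 * X ^ (-(12 / 25) : ℝ) * ((n : ℝ) + 1) ^ (-(51 / 50) : ℝ) := by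
    intro n
    have h := abs_sharp_sub_smooth_le hX (m := (n : ℝ) + 1) (by positivity)
    rw [hgr, hgr, ← Real.norm_eq_abs, ← Complex.norm_real] at *
    refine le_trans (le_of_eq ?_) h
    simp only [hv]
    push_cast
    congr 1
    ring
  have hgd : Summable fun n => ‖g n - g (n + 1)‖ := summable_norm_cpow_sub (by norm_num)
  have hdd : Summable fun n => ‖(g n - g (n + 1)) - (v n - v (n + 1))‖ :=
    (hrs.mul_left _).of_nonneg_of_le (fun _ => norm_nonneg _) hbd
  have hvd : Summable fun n => ‖v n - v (n + 1)‖ := by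
    refine (hgd.add hdd).of_nonneg_of_le (fun _ => norm_nonneg _) fun n => ?_
    have := norm_sub_le (g n - g (n + 1)) ((g n - g (n + 1)) - (v n - v (n + 1)))
    rwa [sub_sub_cancel] at this
  have hv0 : Tendsto v atTop (𝓝 0) := by
    have := (Complex.continuous_ofReal.tendsto 0).comp (summable_smoothWeight hX).tendsto_atTop_zero
    simpa [Function.comp_def] using this
  have hV := tsum_mul_eq_tsum_partial_sums (a := fun m => χ ((m + 1 : ℕ) : ZMod q)) hSB hv0 hvd
    (summable_char_mul_smoothWeight χ hX)
  have hsumS : ∀ {u : ℕ → ℂ}, (Summable fun n => ‖u n‖) → Summable fun n => S n * u n :=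
    fun {u} hu => Summable.of_norm_bounded (hu.mul_left B) fun n => by
      rw [norm_mul]
      exact mul_le_mul_of_nonneg_right (hSB n) (norm_nonneg _)
  -- Both series are now written with the same partial sums `S`, so only the consecutive differences
  -- of the two weights are compared.
  rw [hV, LFunction_half_eq_tsum_partial_sums hχ]
  rw [← Summable.tsum_sub (hsumS hgd) (hsumS hvd)]
  have hn : Summable fun n => ‖S n * (g n - g (n + 1)) - S n * (v n - v (n + 1))‖ := by
    refine (hdd.mul_left B).of_nonneg_of_le (fun _ => norm_nonneg _) fun n => ?_
    rw [← mul_sub, norm_mul]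
    exact mul_le_mul_of_nonneg_right (hSB n) (norm_nonneg _)
  refine (norm_tsum_le_tsum_norm hn).trans ?_
  calc _ ≤ ∑' n : ℕ, B * (2 * X ^ (-(12 / 25) : ℝ) * ((n : ℝ) + 1) ^ (-(51 / 50) : ℝ)) := by
        refine hn.tsum_le_tsum (fun n => ?_) ((hrs.mul_left _).mul_left _)
        rw [← mul_sub, norm_mul]
        exact mul_le_mul (hSB n) (hbd n) (norm_nonneg _) hB0
    _ = _ := by
        rw [tsum_mul_left, tsum_mul_left]
        ring

end

end FracMoment

/-! ### The twisted first moment of L(1/2, χ) -/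

namespace FracMoment

open Complex Finset Filter Topology

section

variable {q : ℕ} [Fact q.Prime]

theorem natCast_lt_of_le_rpow {a : ℕ} (h : (a : ℝ) ≤ (q : ℝ) ^ (1 / 20 : ℝ)) : a < q := by
  have hq : (1 : ℝ) < q := by exact_mod_cast (Fact.out : q.Prime).one_lt
  have : (q : ℝ) ^ (1 / 20 : ℝ) < q := by
    conv_rhs => rw [← Real.rpow_one (q : ℝ)]
    exact Real.rpow_lt_rpow_of_exponent_lt hq (by norm_num)
  exact_mod_cast h.trans_lt this

theorem isUnit_natCast {a : ℕ} (h0 : 0 < a) (h : a < q) : IsUnit (a : ZMod q) := by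
  rw [ZMod.isUnit_iff_coprime]
  exact ((Nat.Prime.coprime_iff_not_dvd Fact.out).mpr (Nat.not_dvd_of_pos_of_lt h0 h)).symm

open Classical in
/-- Orthogonality applied to the smoothed series. -/
theorem sum_char_tsum_mul {X : ℝ} (hX : 0 < X) {a B : ℕ} (hB : IsUnit (B : ZMod q)) :
    ∑ χ : DirichletCharacter ℂ q,
      (∑' n : ℕ, χ ((n + 1 : ℕ) : ZMod q) * (smoothWeight X ((n : ℝ) + 1) : ℂ))
        * (χ (a : ZMod q) * starRingEnd ℂ (χ (B : ZMod q)))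
      = (Nat.totient q : ℂ) * ((∑' n : ℕ, if ((B : ℕ) : ZMod q) = (((n + 1) * a : ℕ) : ZMod q) then
          smoothWeight X ((n : ℝ) + 1) else 0 : ℝ) : ℂ) := by
  simp_rw [← tsum_mul_right]
  rw [← Summable.tsum_finsetSum fun χ _ => (summable_char_mul_smoothWeight χ hX).mul_right _,
    Complex.ofReal_tsum, ← tsum_mul_left]
  congr 1
  funext n
  have h := DirichletCharacter.sum_char_inv_mul_char_eq ℂ hB (((n + 1) * a : ℕ) : ZMod q)
  have e : ∀ χ : DirichletCharacter ℂ q, starRingEnd ℂ (χ (B : ZMod q)) = χ ((B : ZMod q)⁻¹) := by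
    intro χ
    rw [← MulChar.inv_apply', ← MulChar.star_eq_inv]
    rfl
  calc _ = (∑ χ : DirichletCharacter ℂ q, χ ((B : ZMod q)⁻¹) * χ (((n + 1) * a : ℕ) : ZMod q))
        * (smoothWeight X ((n : ℝ) + 1) : ℂ) := by
        rw [Finset.sum_mul]
        refine Finset.sum_congr rfl fun χ _ => ?_
        rw [e, Nat.cast_mul, map_mul]
        ring
    _ = _ := by
        rw [h]
        split_ifs <;> simp

end

/-- If ma ≡ B but ma ≠ B, then ma ≥ q because B < q; hence m ≥ q^(19/20). As a is a unit, these m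
lie in one class mod q, so j = ⌊m/q⌋ determines m. With weight at most X^(3/5) m^(-11/10) and m ≥
q^(19/20)(j + 1)/2, the sum over j converges and the power of q is 3/4 - 209/200 = -59/200. -/
theorem exists_offDiagonal_le : ∃ C : ℝ, 0 ≤ C ∧ ∀ (q : ℕ) [Fact q.Prime] (a B : ℕ),
    0 < a → 0 < B → (a : ℝ) ≤ (q : ℝ) ^ (1 / 20 : ℝ) → (B : ℝ) ≤ (q : ℝ) ^ (1 / 20 : ℝ) →
    |(∑' n : ℕ, if ((B : ℕ) : ZMod q) = (((n + 1) * a : ℕ) : ZMod q) then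
          smoothWeight ((q : ℝ) ^ (5 / 4 : ℝ)) ((n : ℝ) + 1) else 0)
        - (if a ∣ B then smoothWeight ((q : ℝ) ^ (5 / 4 : ℝ)) ((B / a : ℕ) : ℝ) else 0)|
      ≤ C * (q : ℝ) ^ (-(59 / 200) : ℝ) := by
  set Z : ℝ := ∑' j : ℕ, ((j : ℝ) + 1) ^ (-(11 / 10) : ℝ) with hZ
  have hZs : Summable fun j : ℕ => ((j : ℝ) + 1) ^ (-(11 / 10) : ℝ) :=
    summable_succ_rpow (by norm_num)
  have hZ0 : 0 ≤ Z := tsum_nonneg fun j => by positivity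
  refine ⟨2 ^ (11 / 10 : ℝ) * Z, by positivity, fun q _ a B ha hB haq hBq => ?_⟩
  have hq : q.Prime := Fact.out
  have hq0 : (0 : ℝ) < q := by exact_mod_cast hq.pos
  have hBlt := natCast_lt_of_le_rpow hBq
  set X : ℝ := (q : ℝ) ^ (5 / 4 : ℝ) with hXdef
  have hX : 0 < X := by positivity
  set v : ℕ → ℝ := fun n => smoothWeight X ((n : ℝ) + 1) with hv
  have hv0 : ∀ n, 0 ≤ v n := fun n => smoothWeight_nonneg (by positivity)
  have hvs : Summable v := summable_smoothWeight hX
  set D : Set ℕ := {n | (n + 1) * a = B} with hD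
  set E : Set ℕ := {n | ((B : ℕ) : ZMod q) = (((n + 1) * a : ℕ) : ZMod q) ∧ (n + 1) * a ≠ B} with hE
  have hsplit : ∀ n, (if ((B : ℕ) : ZMod q) = (((n + 1) * a : ℕ) : ZMod q) then v n else 0)
      = D.indicator v n + E.indicator v n := by
    intro n
    by_cases h1 : (n + 1) * a = B
    · have hnE : n ∉ E := fun h => h.2 h1
      rw [Set.indicator_of_mem (show n ∈ D from h1), Set.indicator_of_notMem hnE, if_pos (by rw [h1]),
        add_zero]
    · have hnD : n ∉ D := h1
      rw [Set.indicator_of_notMem hnD, zero_add]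
      by_cases h2 : ((B : ℕ) : ZMod q) = (((n + 1) * a : ℕ) : ZMod q)
      · rw [if_pos h2, Set.indicator_of_mem (show n ∈ E from ⟨h2, h1⟩)]
      · rw [if_neg h2, Set.indicator_of_notMem fun h => h2 h.1]
  have hDsum : ∑' n, D.indicator v n
      = if a ∣ B then smoothWeight X ((B / a : ℕ) : ℝ) else 0 := by
    split_ifs with h
    · obtain ⟨k, rfl⟩ := h
      have hk : 0 < k := Nat.pos_of_mul_pos_left hB
      rw [Nat.mul_div_cancel_left k ha, tsum_eq_single (k - 1)]
      · rw [Set.indicator_of_mem]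
        · simp only [hv]
          rw [← Nat.cast_add_one, Nat.sub_add_cancel hk]
        · change (k - 1 + 1) * a = a * k
          rw [Nat.sub_add_cancel hk, mul_comm]
      · intro n hn
        refine Set.indicator_of_notMem (fun h => hn ?_) _
        have h' : (n + 1) * a = a * k := h
        rw [mul_comm] at h'
        have := Nat.eq_of_mul_eq_mul_left ha h'
        omega
    · rw [tsum_congr (fun n => Set.indicator_of_notMem (fun hn : n ∈ D => h ?_) v), tsum_zero]
      exact ⟨n + 1, by rw [mul_comm]; exact (show (n + 1) * a = B from hn).symm⟩
  have hEs : Summable (E.indicator v) := hvs.indicator E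
  have hEsum : ∑' n, E.indicator v n ≤ 2 ^ (11 / 10 : ℝ) * Z * (q : ℝ) ^ (-(59 / 200) : ℝ) := by
    set K : ℝ := 2 ^ (11 / 10 : ℝ) * (q : ℝ) ^ (-(59 / 200) : ℝ) with hK
    have hinj : Function.Injective fun n : E => (n.1 + 1) / q := by
      rintro ⟨n, hn⟩ ⟨n', hn'⟩ h
      have hau := isUnit_natCast (q := q) ha (natCast_lt_of_le_rpow haq)
      have h1 : ((n + 1 : ℕ) : ZMod q) = ((n' + 1 : ℕ) : ZMod q) := by
        have h2 := hn.1.symm.trans hn'.1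
        rw [Nat.cast_mul, Nat.cast_mul] at h2
        exact hau.mul_right_cancel h2
      rw [ZMod.natCast_eq_natCast_iff'] at h1
      have e1 := Nat.div_add_mod (n + 1) q
      have e2 := Nat.div_add_mod (n' + 1) q
      have h' : (n + 1) / q = (n' + 1) / q := h
      rw [h', h1, e2] at e1
      exact Subtype.ext (by simpa using e1.symm)
    have hle : ∀ n : E, v n ≤ K * ((((n.1 + 1) / q : ℕ) : ℝ) + 1) ^ (-(11 / 10) : ℝ) := by
      rintro ⟨n, hn⟩
      have hnq : q ≤ (n + 1) * a := by
        by_contra! h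
        refine hn.2 ?_
        have := hn.1
        rw [ZMod.natCast_eq_natCast_iff', Nat.mod_eq_of_lt hBlt, Nat.mod_eq_of_lt h] at this
        exact this.symm
      set m : ℝ := (n : ℝ) + 1 with hm
      have hm0 : 0 < m := by positivity
      set j : ℕ := (n + 1) / q with hj
      have h1 : (q : ℝ) ^ (19 / 20 : ℝ) ≤ m := by
        have e : (q : ℝ) ^ (19 / 20 : ℝ) * (q : ℝ) ^ (1 / 20 : ℝ) = q := by
          rw [← Real.rpow_add hq0]; norm_num
        have h2 : (q : ℝ) ≤ m * (q : ℝ) ^ (1 / 20 : ℝ) := by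
          calc (q : ℝ) ≤ m * a := by rw [hm]; exact_mod_cast hnq
            _ ≤ _ := by gcongr
        have h3 : 0 < (q : ℝ) ^ (1 / 20 : ℝ) := by positivity
        exact le_of_mul_le_mul_right (e.trans_le h2) h3
      have h2 : (q : ℝ) ^ (19 / 20 : ℝ) * j ≤ m := by
        have h3 : (q : ℝ) ^ (19 / 20 : ℝ) ≤ q := by
          conv_rhs => rw [← Real.rpow_one (q : ℝ)]
          exact Real.rpow_le_rpow_of_exponent_le (by exact_mod_cast hq.one_lt.le) (by norm_num)
        calc (q : ℝ) ^ (19 / 20 : ℝ) * j ≤ q * j := by gcongr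
          _ ≤ m := by rw [hm]; exact_mod_cast Nat.mul_div_le (n + 1) q
      -- The average of `h1` and `h2`; one bound covering j = 0 as well as large j.
      have h3 : (q : ℝ) ^ (19 / 20 : ℝ) * ((j : ℝ) + 1) / 2 ≤ m := by linarith
      have h4 : v n ≤ X ^ (3 / 5 : ℝ) * m ^ (-(11 / 10) : ℝ) := by
        have := smoothWeight_le (κ := 3 / 5) hX hm0 (by norm_num) (by norm_num)
        norm_num at this ⊢
        exact this
      refine h4.trans ?_
      calc X ^ (3 / 5 : ℝ) * m ^ (-(11 / 10) : ℝ)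
          ≤ X ^ (3 / 5 : ℝ) * ((q : ℝ) ^ (19 / 20 : ℝ) * ((j : ℝ) + 1) / 2) ^ (-(11 / 10) : ℝ) := by
            refine mul_le_mul_of_nonneg_left ?_ (by positivity)
            exact Real.rpow_le_rpow_of_nonpos (by positivity) h3 (by norm_num)
        _ = _ := by
            rw [hXdef, ← Real.rpow_mul hq0.le, Real.div_rpow (by positivity) (by norm_num),
              Real.mul_rpow (by positivity) (by positivity), ← Real.rpow_mul hq0.le,
              Real.rpow_neg (by norm_num : (0 : ℝ) ≤ 2), div_inv_eq_mul, hK,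
              show (-(59 / 200) : ℝ) = 5 / 4 * (3 / 5) + 19 / 20 * (-(11 / 10)) by norm_num,
              Real.rpow_add hq0]
            ring
    have hg : Summable fun j : ℕ => K * ((j : ℝ) + 1) ^ (-(11 / 10) : ℝ) := hZs.mul_left K
    have h := Summable.tsum_le_tsum_of_inj (fun n : E => (n.1 + 1) / q) hinj
      (fun j _ => by positivity) hle (hvs.subtype E) hg
    rw [tsum_mul_left] at h
    rw [← tsum_subtype E v]
    refine h.trans (le_of_eq ?_)
    rw [hK]; ring
  simp_rw [show ∀ n : ℕ, smoothWeight X ((n : ℝ) + 1) = v n from fun _ => rfl, hsplit]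
  rw [(hvs.indicator D).tsum_add hEs, hDsum, add_sub_cancel_left,
    abs_of_nonneg (tsum_nonneg fun n => Set.indicator_nonneg (fun n _ => hv0 n) n)]
  exact hEsum

theorem one_add_log_le {q δ : ℝ} (hq : 1 ≤ q) (hδ : 0 < δ) :
    1 + Real.log q ≤ (1 + 1 / δ) * q ^ δ := by
  have h1 : Real.log q ≤ q ^ δ / δ := Real.log_le_rpow_div (by linarith) hδ
  have h2 : 1 ≤ q ^ δ := Real.one_le_rpow hq hδ.le
  rw [add_mul, one_mul, one_div_mul_eq_div]
  linarith

open Classical in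
/-- The twisted first moment of `L(1/2, χ)`. -/
theorem exists_twistedMoment_le : ∃ C : ℝ, 0 ≤ C ∧ ∀ (q : ℕ) [Fact q.Prime] (a B : ℕ),
    0 < a → 0 < B → (a : ℝ) ≤ (q : ℝ) ^ (1 / 20 : ℝ) → (B : ℝ) ≤ (q : ℝ) ^ (1 / 20 : ℝ) →
    ‖(∑ χ : DirichletCharacter ℂ q with χ ≠ 1, DirichletCharacter.LFunction χ (1 / 2)
          * (χ (a : ZMod q) * starRingEnd ℂ (χ (B : ZMod q))))
        - (Nat.totient q : ℂ) * ((if a ∣ B then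
            smoothWeight ((q : ℝ) ^ (5 / 4 : ℝ)) ((B / a : ℕ) : ℝ) else 0 : ℝ) : ℂ)‖
      ≤ C * (q : ℝ) ^ (93 / 100 : ℝ) := by
  obtain ⟨C₁, hC₁⟩ := exists_norm_LFunction_half_sub_le
  obtain ⟨C₂, hC₂0, hC₂⟩ := exists_offDiagonal_le
  set Z : ℝ := ∑' j : ℕ, ((j : ℝ) + 1) ^ (-(11 / 10) : ℝ) with hZ
  have hZs : Summable fun j : ℕ => ((j : ℝ) + 1) ^ (-(11 / 10) : ℝ) :=
    summable_succ_rpow (by norm_num)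
  have hZ0 : 0 ≤ Z := tsum_nonneg fun j => by positivity
  -- One summand per error. Approximating L costs q · q^(1/2) · X^(-12/25) = q^(9/10), with log q
  -- absorbed in q^(3/100); the principal character costs X^(3/5) = q^(3/4); the off-diagonal terms
  -- cost q^(1 - 59/200) = q^(141/200).
  refine ⟨|C₁| * (1 + 1 / (3 / 100)) + Z + C₂, by positivity, fun q _ a B ha hB haq hBq => ?_⟩
  have hq : q.Prime := Fact.out
  have hq0 : (0 : ℝ) < q := by exact_mod_cast hq.pos
  have hq1 : (1 : ℝ) ≤ q := by exact_mod_cast hq.one_lt.le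
  have hφ : (Nat.totient q : ℝ) ≤ q := by exact_mod_cast Nat.totient_le q
  set X : ℝ := (q : ℝ) ^ (5 / 4 : ℝ) with hXdef
  have hX : 0 < X := by positivity
  have hBu := isUnit_natCast (q := q) hB (natCast_lt_of_le_rpow hBq)
  set V : DirichletCharacter ℂ q → ℂ := fun χ =>
    ∑' n : ℕ, χ ((n + 1 : ℕ) : ZMod q) * (smoothWeight X ((n : ℝ) + 1) : ℂ) with hV
  set t : DirichletCharacter ℂ q → ℂ := fun χ => χ (a : ZMod q) * starRingEnd ℂ (χ (B : ZMod q))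
    with ht
  have ht1 : ∀ χ, ‖t χ‖ ≤ 1 := fun χ => by
    rw [ht]
    simp only [norm_mul, RCLike.norm_conj]
    exact mul_le_one₀ (DirichletCharacter.norm_le_one _ _) (norm_nonneg _)
      (DirichletCharacter.norm_le_one _ _)
  have horth := sum_char_tsum_mul (a := a) hX hBu
  -- Orthogonality requires all characters, so the smoothed series of the principal one is added
  -- here and estimated trivially in `e2`.
  have hsplit : ∑ χ, V χ * t χ
      = (∑ χ : DirichletCharacter ℂ q with χ ≠ 1, V χ * t χ) + V 1 * t 1 := by
    rw [← Finset.sum_filter_add_sum_filter_not univ (fun χ : DirichletCharacter ℂ q => χ ≠ 1)]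
    congr 1
    simp only [not_not]
    rw [Finset.sum_filter, Finset.sum_ite_eq' univ (1 : DirichletCharacter ℂ q)]
    simp
  set W : ℝ := ∑' n : ℕ, if ((B : ℕ) : ZMod q) = (((n + 1) * a : ℕ) : ZMod q) then
          smoothWeight X ((n : ℝ) + 1) else 0 with hW
  set W₀ : ℝ := if a ∣ B then smoothWeight X ((B / a : ℕ) : ℝ) else 0 with hW₀
  have hcard : ((univ.filter fun χ : DirichletCharacter ℂ q => χ ≠ 1).card : ℝ) ≤ q := by
    refine le_trans ?_ hφ
    rw [← DirichletCharacter.card_eq_totient_of_hasEnoughRootsOfUnity ℂ q, Nat.card_eq_fintype_card]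
    exact_mod_cast Finset.card_le_univ _
  have e1 : ‖∑ χ : DirichletCharacter ℂ q with χ ≠ 1,
      (DirichletCharacter.LFunction χ (1 / 2) - V χ) * t χ‖
      ≤ |C₁| * (1 + 1 / (3 / 100)) * (q : ℝ) ^ (93 / 100 : ℝ) := by
    have hterm : ∀ χ ∈ univ.filter (fun χ : DirichletCharacter ℂ q => χ ≠ 1),
        ‖(DirichletCharacter.LFunction χ (1 / 2) - V χ) * t χ‖
          ≤ |C₁| * (Real.sqrt q * (1 + Real.log q)) * X ^ (-(12 / 25) : ℝ) := by
      intro χ hχ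
      rw [norm_mul]
      refine (mul_le_of_le_one_right (norm_nonneg _) (ht1 χ)).trans ?_
      refine (hC₁ q χ (Finset.mem_filter.mp hχ).2 X hX).trans ?_
      have : 0 ≤ Real.log q := Real.log_nonneg hq1
      gcongr
      exact le_abs_self _
    have hlog : 0 ≤ Real.log q := Real.log_nonneg hq1
    refine (norm_sum_le_of_le _ hterm).trans ?_
    rw [Finset.sum_const, nsmul_eq_mul]
    calc _ ≤ (q : ℝ) * (|C₁| * (Real.sqrt q * ((1 + 1 / (3 / 100)) * (q : ℝ) ^ (3 / 100 : ℝ)))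
          * X ^ (-(12 / 25) : ℝ)) := by
          gcongr
          exact one_add_log_le hq1 (by norm_num)
      _ = |C₁| * (1 + 1 / (3 / 100)) * ((q : ℝ) ^ (1 : ℝ) * (q : ℝ) ^ (1 / 2 : ℝ)
            * (q : ℝ) ^ (3 / 100 : ℝ) * (q : ℝ) ^ (-(3 / 5) : ℝ)) := by
          rw [Real.rpow_one, Real.sqrt_eq_rpow, hXdef, ← Real.rpow_mul hq0.le]
          norm_num
          ring
      _ = _ := by
          rw [← Real.rpow_add hq0, ← Real.rpow_add hq0, ← Real.rpow_add hq0]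
          norm_num
  have e2 : ‖V 1 * t 1‖ ≤ Z * (q : ℝ) ^ (93 / 100 : ℝ) := by
    rw [norm_mul]
    refine (mul_le_of_le_one_right (norm_nonneg _) (ht1 1)).trans ?_
    have hb : ∀ n : ℕ, ‖(1 : DirichletCharacter ℂ q) ((n + 1 : ℕ) : ZMod q)
        * (smoothWeight X ((n : ℝ) + 1) : ℂ)‖
        ≤ X ^ (3 / 5 : ℝ) * ((n : ℝ) + 1) ^ (-(11 / 10) : ℝ) := fun n => by
      rw [norm_mul, Complex.norm_real, Real.norm_of_nonneg (smoothWeight_nonneg (by positivity))]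
      refine (mul_le_of_le_one_left (smoothWeight_nonneg (by positivity))
        (DirichletCharacter.norm_le_one _ _)).trans ?_
      have := smoothWeight_le (m := (n : ℝ) + 1) (κ := 3 / 5) hX (by positivity) (by norm_num)
        (by norm_num)
      norm_num at this ⊢
      exact this
    refine (tsum_of_norm_bounded (hZs.mul_left _).hasSum hb).trans ?_
    rw [tsum_mul_left, mul_comm]
    refine mul_le_mul_of_nonneg_left ?_ hZ0
    rw [hXdef, ← Real.rpow_mul hq0.le]
    exact Real.rpow_le_rpow_of_exponent_le hq1 (by norm_num)
  have e3 : ‖(Nat.totient q : ℂ) * ((W - W₀ : ℝ) : ℂ)‖ ≤ C₂ * (q : ℝ) ^ (93 / 100 : ℝ) := by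
    rw [norm_mul, Complex.norm_natCast, Complex.norm_real, Real.norm_eq_abs]
    calc (Nat.totient q : ℝ) * |W - W₀| ≤ q * (C₂ * (q : ℝ) ^ (-(59 / 200) : ℝ)) := by
          gcongr
          exact hC₂ q a B ha hB haq hBq
      _ = C₂ * (q : ℝ) ^ (141 / 200 : ℝ) := by
          rw [show (141 / 200 : ℝ) = 1 + -(59 / 200) by norm_num, Real.rpow_add hq0, Real.rpow_one]
          ring
      _ ≤ _ := by
          refine mul_le_mul_of_nonneg_left ?_ hC₂0
          exact Real.rpow_le_rpow_of_exponent_le hq1 (by norm_num)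
  have key : (∑ χ : DirichletCharacter ℂ q with χ ≠ 1,
        DirichletCharacter.LFunction χ (1 / 2) * t χ) - (Nat.totient q : ℂ) * (W₀ : ℂ)
      = (∑ χ : DirichletCharacter ℂ q with χ ≠ 1,
          (DirichletCharacter.LFunction χ (1 / 2) - V χ) * t χ) - V 1 * t 1
        + (Nat.totient q : ℂ) * ((W - W₀ : ℝ) : ℂ) := by
    have h1 : ∑ χ, V χ * t χ = (Nat.totient q : ℂ) * (W : ℂ) := horth
    simp_rw [sub_mul]
    rw [Finset.sum_sub_distrib, Complex.ofReal_sub]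
    rw [hsplit] at h1
    linear_combination h1
  rw [key]
  refine (norm_add_le _ _).trans ((add_le_add ((norm_sub_le _ _).trans (add_le_add e1 e2)) e3).trans
    (le_of_eq ?_))
  ring

end FracMoment

/-! ### Powers of P and M as Dirichlet polynomials -/

namespace FracMoment

open Complex Finset Filter Topology

theorem prod_pos_of_mem_piFinset {k M : ℕ} {f : Fin k → ℕ}
    (hf : f ∈ Fintype.piFinset fun _ : Fin k => Icc 1 M) : ∏ i, f i ∈ Icc 1 (M ^ k) := by
  rw [Fintype.mem_piFinset] at hf
  rw [Finset.mem_Icc]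
  refine ⟨Nat.one_le_iff_ne_zero.mpr (Finset.prod_ne_zero_iff.mpr fun i _ =>
    Nat.one_le_iff_ne_zero.mp (Finset.mem_Icc.mp (hf i)).1), ?_⟩
  calc ∏ i, f i ≤ ∏ _i : Fin k, M := Finset.prod_le_prod' fun i _ => (Finset.mem_Icc.mp (hf i)).2
    _ = M ^ k := by simp

/-- The power of a finite sum, grouped by the product of the indices. -/
theorem sum_finMulAntidiag_eq_pow {R : Type*} [CommSemiring R] (k M : ℕ) {F : ℕ → R}
    (hF : ∀ n, M < n → F n = 0) :
    ∑ N ∈ Icc 1 (M ^ k), ∑ f ∈ Nat.finMulAntidiag k N, ∏ i, F (f i) = (∑ n ∈ Icc 1 M, F n) ^ k := by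
  classical
  have h : (∑ n ∈ Icc 1 M, F n) ^ k
      = ∑ f ∈ Fintype.piFinset fun _ : Fin k => Icc 1 M, ∏ i, F (f i) := by
    rw [← Finset.prod_univ_sum]
    simp
  rw [h, ← Finset.sum_fiberwise_of_maps_to (t := Icc 1 (M ^ k))
    (g := fun f : Fin k → ℕ => ∏ i, f i) fun f hf => prod_pos_of_mem_piFinset hf]
  refine Finset.sum_congr rfl fun N hN => (Finset.sum_subset ?_ ?_).symm
  · intro f hf
    rw [Finset.mem_filter] at hf
    rw [Nat.mem_finMulAntidiag]
    have := (Finset.mem_Icc.mp hN).1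
    exact ⟨hf.2, by omega⟩
  · intro f hf hf'
    rw [Nat.mem_finMulAntidiag] at hf
    rw [Finset.mem_filter, Fintype.mem_piFinset, not_and'] at hf'
    have h1 := hf' hf.1
    push Not at h1
    obtain ⟨i, hi⟩ := h1
    have hi0 : f i ≠ 0 := fun h0 => hf.2 (by rw [← hf.1]; exact Finset.prod_eq_zero (mem_univ i) h0)
    refine Finset.prod_eq_zero (mem_univ i) (hF _ ?_)
    by_contra! hle
    exact hi (Finset.mem_Icc.mpr ⟨Nat.one_le_iff_ne_zero.mpr hi0, hle⟩)

theorem logWeight_div_eq_zero {x : ℝ} {n : ℕ} (hx : 0 < x) (h : ⌊x⌋₊ < n) :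
    max (Real.log (x / n)) 0 = 0 := by
  have hn : x < n := (Nat.floor_lt hx.le).mp h
  have hn0 : (0 : ℝ) < n := hx.trans hn
  exact max_eq_right (Real.log_nonpos (by positivity) ((div_le_one hn0).mpr hn.le))

theorem max_log_div_eq {x : ℝ} {n : ℕ} (hx : 0 < x) (h : n ∈ Icc 1 ⌊x⌋₊) :
    max (Real.log (x / n)) 0 = Real.log (x / n) := by
  rw [Finset.mem_Icc] at h
  have hn0 : (0 : ℝ) < n := by exact_mod_cast h.1
  exact max_eq_left (Real.log_nonneg ((one_le_div hn0).mpr ((Nat.le_floor_iff hx.le).mp h.2)))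

theorem max_log_div_le {x : ℝ} {n : ℕ} (hx : 1 < x) (h : n ∈ Icc 1 ⌊x⌋₊) :
    max (Real.log (x / n)) 0 ≤ Real.log x := by
  have hx0 : 0 < x := by linarith
  have hn : (1 : ℝ) ≤ n := by exact_mod_cast (Finset.mem_Icc.mp h).1
  refine max_le (Real.log_le_log (by positivity) (div_le_self hx0.le hn)) (Real.log_nonneg hx.le)

section

variable {k : ℕ} {x : ℝ} {W : ℝ → ℝ} {h : ℕ → ℂ}

theorem convWeight_eq_zero (hW : ∀ n : ℕ, ⌊x⌋₊ < n → W (x / n) = 0) {N : ℕ}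
    (hN : N ∉ Icc 1 (⌊x⌋₊ ^ k)) : convWeight k x W h N = 0 := by
  refine Finset.sum_eq_zero fun f hf => ?_
  rw [Nat.mem_finMulAntidiag] at hf
  by_contra hne
  have hne' := Finset.prod_ne_zero_iff.mp hne
  refine hN (hf.1 ▸ prod_pos_of_mem_piFinset (Fintype.mem_piFinset.mpr fun i => ?_))
  rw [Finset.mem_Icc]
  refine ⟨Nat.one_le_iff_ne_zero.mpr fun h0 => hf.2 ?_, ?_⟩
  · rw [← hf.1]; exact Finset.prod_eq_zero (mem_univ i) h0
  · by_contra! hlt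
    exact hne' i (mem_univ i) (by rw [hW _ hlt]; simp)

/-- As φ is completely multiplicative, the product of the φ(f i) depends only on N and leaves the
sum over factorizations. -/
theorem sum_convWeight_mul (hW : ∀ n : ℕ, ⌊x⌋₊ < n → W (x / n) = 0) (φ : ℕ →* ℂ) :
    (∑ n ∈ Icc 1 ⌊x⌋₊, h n * (W (x / n) : ℂ) * φ n) ^ k
      = ∑ N ∈ Icc 1 (⌊x⌋₊ ^ k), convWeight k x W h N * φ N := by
  rw [← sum_finMulAntidiag_eq_pow k ⌊x⌋₊ (F := fun n => h n * (W (x / n) : ℂ) * φ n)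
    fun n hn => by rw [hW n hn]; simp]
  refine Finset.sum_congr rfl fun N _ => ?_
  rw [convWeight, Finset.sum_mul]
  refine Finset.sum_congr rfl fun f hf => ?_
  rw [Finset.prod_mul_distrib, ← map_prod, (Nat.mem_finMulAntidiag.mp hf).1]

/-- With |h| ≤ 1 the sum is majorized by the k-th power of ∑ W(x/n), to which the same regrouping
applies. Keeping the factor T, a power of the logarithm, matters: it cancels the normalization
later, even for x near 1. -/
theorem sum_norm_convWeight_le (hW : ∀ n : ℕ, ⌊x⌋₊ < n → W (x / n) = 0) (hW0 : ∀ u, 0 ≤ W u)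
    (hh : ∀ n, ‖h n‖ ≤ 1) (hx : 0 ≤ x) {T : ℝ} (hT : ∀ n ∈ Icc 1 ⌊x⌋₊, W (x / n) ≤ T) (hT0 : 0 ≤ T) :
    ∑ N ∈ Icc 1 (⌊x⌋₊ ^ k), ‖convWeight k x W h N‖ ≤ (x * T) ^ k := by
  calc _ ≤ ∑ N ∈ Icc 1 (⌊x⌋₊ ^ k), ∑ f ∈ Nat.finMulAntidiag k N, ∏ i, W (x / (f i)) := by
        refine Finset.sum_le_sum fun N _ => norm_sum_le_of_le _ fun f _ => ?_
        rw [norm_prod]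
        refine Finset.prod_le_prod (fun _ _ => norm_nonneg _) fun i _ => ?_
        rw [norm_mul, Complex.norm_real, Real.norm_of_nonneg (hW0 _)]
        exact mul_le_of_le_one_left (hW0 _) (hh _)
    _ = (∑ n ∈ Icc 1 ⌊x⌋₊, W (x / n)) ^ k :=
        sum_finMulAntidiag_eq_pow k ⌊x⌋₊ (F := fun n : ℕ => W (x / n)) hW
    _ ≤ _ := by
        refine pow_le_pow_left₀ (Finset.sum_nonneg fun _ _ => hW0 _) ?_ k
        refine (Finset.sum_le_card_nsmul _ _ _ hT).trans ?_
        rw [Nat.card_Icc, Nat.add_sub_cancel, nsmul_eq_mul]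
        exact mul_le_mul_of_nonneg_right (Nat.floor_le hx) hT0

end

section

variable {x : ℝ}

theorem logWeight_support (hx : 0 < x) (n : ℕ) (h : ⌊x⌋₊ < n) : logWeight (x / n) = 0 :=
  logWeight_div_eq_zero hx h

theorem logSqWeight_support (hx : 0 < x) (n : ℕ) (h : ⌊x⌋₊ < n) : logSqWeight (x / n) = 0 := by
  rw [logSqWeight, logWeight_div_eq_zero hx h]
  norm_num

theorem logWeight_nonneg (u : ℝ) : 0 ≤ logWeight u := le_max_right _ _

theorem logSqWeight_nonneg (u : ℝ) : 0 ≤ logSqWeight u := by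
  unfold logSqWeight; positivity

theorem logSqWeight_div_le {n : ℕ} (hx : 1 < x) (h : n ∈ Icc 1 ⌊x⌋₊) :
    logSqWeight (x / n) ≤ Real.log x ^ 2 := by
  have h1 := pow_le_pow_left₀ (le_max_right _ _) (max_log_div_le hx h) 2
  rw [logSqWeight]
  have := sq_nonneg (Real.log x)
  linarith

end

/-- The completely multiplicative function `χ(n) n^{-1/2}`. -/
noncomputable def halfTwist {q : ℕ} (χ : ZMod q →* ℂ) : ℕ →* ℂ where
  toFun n := χ (n : ZMod q) / (Real.sqrt n : ℂ)
  map_one' := by simp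
  map_mul' m n := by
    rw [Nat.cast_mul, map_mul, Nat.cast_mul, Real.sqrt_mul (Nat.cast_nonneg m)]
    push_cast
    rw [mul_div_mul_comm]

theorem halfTwist_apply {q : ℕ} (χ : ZMod q →* ℂ) (n : ℕ) :
    halfTwist χ n = χ (n : ZMod q) / (Real.sqrt n : ℂ) := rfl

section

variable {q : ℕ} (χ : DirichletCharacter ℂ q)

theorem conj_dirPoly_pow (k s : ℕ) {x : ℝ} (hx : 1 < x) :
    starRingEnd ℂ (dirPoly χ (1 / (2 * (s : ℝ))) x) ^ k * (Real.log x : ℂ) ^ k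
      = ∑ n ∈ Icc 1 (⌊x⌋₊ ^ k), convWeight k x logWeight (divCoeff (1 / (2 * (s : ℝ)))) n
          * (starRingEnd ℂ (χ (n : ZMod q)) / (Real.sqrt n : ℂ)) := by
  have hx0 : 0 < x := by linarith
  have hl : (Real.log x : ℂ) ≠ 0 := by exact_mod_cast (Real.log_pos hx).ne'
  have h := sum_convWeight_mul (k := k) (h := divCoeff (1 / (2 * (s : ℝ))))
    (logWeight_support hx0)
    (halfTwist ((starRingEnd ℂ : ℂ →* ℂ).comp χ.toMonoidHom))
  simp only [halfTwist_apply] at h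
  refine Eq.trans ?_ h
  rw [← mul_pow]
  congr 1
  rw [dirPoly, map_sum, Finset.sum_mul]
  refine Finset.sum_congr rfl fun n hn => ?_
  rw [logWeight, max_log_div_eq hx0 hn, divCoeff]
  simp only [map_mul, map_div₀, Complex.conj_ofReal]
  push_cast
  have e : ((starRingEnd ℂ : ℂ →* ℂ).comp χ.toMonoidHom) (n : ZMod q)
      = starRingEnd ℂ (χ (n : ZMod q)) := rfl
  rw [e]
  field_simp

/-- The factor 1/2 in `mollifier` is absorbed into `logSqWeight`. -/
theorem mollifier_pow (l s : ℕ) {y : ℝ} (hy : 1 < y) :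
    mollifier χ (1 / (s : ℝ)) y ^ l * (Real.log y : ℂ) ^ (2 * l)
      = ∑ n ∈ Icc 1 (⌊y⌋₊ ^ l), convWeight l y logSqWeight (divMuCoeff (1 / (s : ℝ))) n
          * (χ (n : ZMod q) / (Real.sqrt n : ℂ)) := by
  have hy0 : 0 < y := by linarith
  have hl : (Real.log y : ℂ) ≠ 0 := by exact_mod_cast (Real.log_pos hy).ne'
  have h := sum_convWeight_mul (k := l) (h := divMuCoeff (1 / (s : ℝ)))
    (logSqWeight_support hy0) (halfTwist χ.toMonoidHom)
  simp only [halfTwist_apply] at h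
  refine Eq.trans ?_ h
  rw [pow_mul, ← mul_pow]
  congr 1
  rw [mollifier, Finset.mul_sum, Finset.sum_mul]
  refine Finset.sum_congr rfl fun n hn => ?_
  rw [logSqWeight, max_log_div_eq hy0 hn, divMuCoeff]
  push_cast
  have e : χ.toMonoidHom (n : ZMod q) = χ (n : ZMod q) := rfl
  rw [e]
  field_simp

theorem conj_mollifier_pow (l s : ℕ) {y : ℝ} (hy : 1 < y) :
    starRingEnd ℂ (mollifier χ (1 / (s : ℝ)) y) ^ l * (Real.log y : ℂ) ^ (2 * l)
      = ∑ n ∈ Icc 1 (⌊y⌋₊ ^ l), convWeight l y logSqWeight (divMuCoeff (1 / (s : ℝ))) n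
          * (starRingEnd ℂ (χ (n : ZMod q)) / (Real.sqrt n : ℂ)) := by
  have hreal : ∀ n, starRingEnd ℂ (convWeight l y logSqWeight (divMuCoeff (1 / (s : ℝ))) n)
      = convWeight l y logSqWeight (divMuCoeff (1 / (s : ℝ))) n := fun n => by
    simp [convWeight, divMuCoeff, map_sum, map_prod]
  have h := congrArg (starRingEnd ℂ) (mollifier_pow χ l s hy)
  rw [map_mul, map_pow, map_pow, Complex.conj_ofReal, map_sum] at h
  rw [h]
  refine Finset.sum_congr rfl fun n _ => ?_
  rw [map_mul, map_div₀, Complex.conj_ofReal, hreal]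

end

end FracMoment

/-! ### Comparing the moment with the diagonal sum -/

namespace FracMoment

open Complex Finset Filter Topology

theorem sum_divisorsAntidiagonal_eq_sum_Icc {A B N : ℕ} {F : ℕ → ℕ → ℂ}
    (hA : ∀ n b, n ∉ Icc 1 A → F n b = 0) (hB : ∀ n b, b ∉ Icc 1 B → F n b = 0) :
    ∑ p ∈ N.divisorsAntidiagonal, F p.1 p.2
      = ∑ n ∈ Icc 1 A, ∑ b ∈ Icc 1 B, if N = n * b then F n b else 0 := by
  rw [← Finset.sum_product' (f := fun n b => if N = n * b then F n b else 0), ← Finset.sum_filter]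
  symm
  refine Finset.sum_subset (fun p hp => ?_) fun p hp hp' => ?_
  · rw [Finset.mem_filter, Finset.mem_product, Finset.mem_Icc, Finset.mem_Icc] at hp
    rw [Nat.mem_divisorsAntidiagonal, hp.2]
    exact ⟨rfl, mul_ne_zero (by omega) (by omega)⟩
  · rw [Nat.mem_divisorsAntidiagonal] at hp
    by_cases h1 : p.1 ∈ Icc 1 A
    · by_cases h2 : p.2 ∈ Icc 1 B
      · exact absurd (Finset.mem_filter.mpr ⟨Finset.mem_product.mpr ⟨h1, h2⟩, hp.1.symm⟩) hp'
      · exact hB _ _ h2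
    · exact hA _ _ h1

theorem sum_divisorsAntidiagonal_eq_sum_dvd {A N : ℕ} (hN : N ≠ 0) {F : ℕ → ℕ → ℂ}
    (hA : ∀ m a, a ∉ Icc 1 A → F m a = 0) :
    ∑ p ∈ N.divisorsAntidiagonal, F p.1 p.2
      = ∑ a ∈ Icc 1 A, if a ∣ N then F (N / a) a else 0 := by
  rw [Nat.sum_divisorsAntidiagonal' (f := F), ← Finset.sum_filter]
  symm
  refine Finset.sum_subset (fun a ha => ?_) fun a ha ha' => ?_
  · exact Nat.mem_divisors.mpr ⟨(Finset.mem_filter.mp ha).2, hN⟩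
  · refine hA _ _ fun h => ha' (Finset.mem_filter.mpr ⟨h, (Nat.mem_divisors.mp ha).1⟩)

/-- The weights have bounded support, so (n, b) ranges over a finite box and determines N = nb; then
a must divide nb, and m = nb/a. -/
theorem tsum_diagWeight {k l s : ℕ} {X x y : ℝ} (hx : 0 < x) (hy : 0 < y) :
    ∑' N, diagWeight k l s X x y N
      = ∑ n ∈ Icc 1 (⌊x⌋₊ ^ k), ∑ b ∈ Icc 1 (⌊y⌋₊ ^ l), ∑ a ∈ Icc 1 (⌊y⌋₊ ^ l),
          convWeight k x logWeight (divCoeff (1 / (2 * (s : ℝ)))) n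
            * convWeight l y logSqWeight (divMuCoeff (1 / (s : ℝ))) b
            * convWeight l y logSqWeight (divMuCoeff (1 / (s : ℝ))) a
            * ((if a ∣ n * b then (Real.exp (-(((n * b / a : ℕ) : ℝ) / X)) : ℂ) else 0)
              * ((n * b : ℕ) : ℂ)⁻¹) := by
  set cP := convWeight k x logWeight (divCoeff (1 / (2 * (s : ℝ)))) with hcP
  set cM := convWeight l y logSqWeight (divMuCoeff (1 / (s : ℝ))) with hcM
  have hP0 : ∀ n, n ∉ Icc 1 (⌊x⌋₊ ^ k) → cP n = 0 := fun n hn =>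
    convWeight_eq_zero (logWeight_support hx) hn
  have hM0 : ∀ n, n ∉ Icc 1 (⌊y⌋₊ ^ l) → cM n = 0 := fun n hn =>
    convWeight_eq_zero (logSqWeight_support hy) hn
  have hN : ∀ N, diagWeight k l s X x y N
      = ∑ n ∈ Icc 1 (⌊x⌋₊ ^ k), ∑ b ∈ Icc 1 (⌊y⌋₊ ^ l), if N = n * b then
          ∑ a ∈ Icc 1 (⌊y⌋₊ ^ l), cP n * cM b * cM a
            * ((if a ∣ n * b then (Real.exp (-(((n * b / a : ℕ) : ℝ) / X)) : ℂ) else 0)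
              * ((n * b : ℕ) : ℂ)⁻¹) else 0 := by
    intro N
    have h1 : ∀ p : ℕ × ℕ, ∑ q ∈ N.divisorsAntidiagonal, quadWeight k l s X x y p q
        = ∑ n ∈ Icc 1 (⌊x⌋₊ ^ k), ∑ b ∈ Icc 1 (⌊y⌋₊ ^ l), if N = n * b then
            (Real.exp (-(p.1 / X)) : ℂ) * (cP n * (cM p.2 * cM b)) else 0 := fun p =>
      sum_divisorsAntidiagonal_eq_sum_Icc
        (F := fun n b => (Real.exp (-(p.1 / X)) : ℂ) * (cP n * (cM p.2 * cM b)))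
        (fun n b hn => by rw [hP0 n hn]; ring) (fun n b hb => by rw [hM0 b hb]; ring)
    rw [diagWeight, Finset.sum_congr rfl fun p _ => h1 p, Finset.sum_comm, Finset.sum_mul]
    refine Finset.sum_congr rfl fun n hn => ?_
    rw [Finset.sum_comm, Finset.sum_mul]
    refine Finset.sum_congr rfl fun b hb => ?_
    rw [Finset.mem_Icc] at hn hb
    split_ifs with h
    · have hN0 : N ≠ 0 := by rw [h]; exact mul_ne_zero (by omega) (by omega)
      rw [sum_divisorsAntidiagonal_eq_sum_dvd hN0
        (F := fun m a => (Real.exp (-((m : ℝ) / X)) : ℂ) * (cP n * (cM a * cM b)))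
        (fun m a ha => by rw [hM0 a ha]; ring), Finset.sum_mul, h]
      refine Finset.sum_congr rfl fun a _ => ?_
      split_ifs <;> ring
    · simp
  rw [funext hN]
  exact (hasSum_sum fun n _ => hasSum_sum fun b _ => hasSum_ite_eq (n * b) _).tsum_eq

/-- With am = nb one has √m √(nab) = nb. This identifies the main term of the twisted moment with
the summand of I_l. -/
theorem smoothWeight_div {X : ℝ} {a n b : ℕ} (ha : 0 < a) (hn : 0 < n) (hb : 0 < b) :
    (if a ∣ n * b then smoothWeight X ((n * b / a : ℕ) : ℝ) else 0)
        * (Real.sqrt n * Real.sqrt b * Real.sqrt a)⁻¹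
      = (if a ∣ n * b then Real.exp (-(((n * b / a : ℕ) : ℝ) / X)) else 0)
        * ((n * b : ℕ) : ℝ)⁻¹ := by
  split_ifs with h
  · obtain ⟨m, hm⟩ := h
    have hm0 : 0 < m := Nat.pos_of_ne_zero fun h0 => by
      rw [h0, mul_zero] at hm
      exact (Nat.mul_pos hn hb).ne' hm
    have ha' : (0 : ℝ) < a := by exact_mod_cast ha
    have hm' : (0 : ℝ) < m := by exact_mod_cast hm0
    rw [hm, Nat.mul_div_cancel_left m ha, smoothWeight, Real.rpow_neg hm'.le, ← Real.sqrt_eq_rpow,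
      ← Real.sqrt_mul (Nat.cast_nonneg n), ← Nat.cast_mul, hm, Nat.cast_mul,
      Real.sqrt_mul ha'.le]
    have e1 := Real.mul_self_sqrt ha'.le
    have e2 := Real.mul_self_sqrt hm'.le
    have e3 : 0 < Real.sqrt a := Real.sqrt_pos.mpr ha'
    have e4 : 0 < Real.sqrt m := Real.sqrt_pos.mpr hm'
    calc _ = Real.exp (-((m : ℝ) / X)) * ((Real.sqrt a * Real.sqrt a)
          * (Real.sqrt m * Real.sqrt m))⁻¹ := by field_simp
      _ = _ := by rw [e1, e2]
  · simp

section

variable {q : ℕ} [Fact q.Prime]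

open Classical in
/-- The moment, expanded into twisted first moments. -/
theorem lowerMoment_mul_eq {r s : ℕ} (hrs : r < s) {x y : ℝ} (hx : 1 < x) (hy : 1 < y) :
    lowerMoment r s q x y * ((Real.log x : ℂ) ^ (2 * s) * (Real.log y : ℂ) ^ (4 * s - 4 * r))
      = ∑ n ∈ Icc 1 (⌊x⌋₊ ^ (2 * s)), ∑ b ∈ Icc 1 (⌊y⌋₊ ^ (s - r)), ∑ a ∈ Icc 1 (⌊y⌋₊ ^ (s - r)),
          convWeight (2 * s) x logWeight (divCoeff (1 / (2 * (s : ℝ)))) n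
            * convWeight (s - r) y logSqWeight (divMuCoeff (1 / (s : ℝ))) b
            * convWeight (s - r) y logSqWeight (divMuCoeff (1 / (s : ℝ))) a
            * ((∑ χ : DirichletCharacter ℂ q with χ ≠ 1, DirichletCharacter.LFunction χ (1 / 2)
                * (χ (a : ZMod q) * starRingEnd ℂ (χ ((n * b : ℕ) : ZMod q))))
              * (((Real.sqrt n * Real.sqrt b * Real.sqrt a)⁻¹ : ℝ) : ℂ)) := by
  set cP := convWeight (2 * s) x logWeight (divCoeff (1 / (2 * (s : ℝ)))) with hcP
  set cM := convWeight (s - r) y logSqWeight (divMuCoeff (1 / (s : ℝ))) with hcM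
  have hterm : ∀ χ : DirichletCharacter ℂ q,
      DirichletCharacter.LFunction χ (1 / 2)
        * (starRingEnd ℂ (dirPoly χ (1 / (2 * (s : ℝ))) x)) ^ (2 * s)
        * ((‖mollifier χ (1 / (s : ℝ)) y‖ ^ (2 * (s - r)) : ℝ) : ℂ)
        * ((Real.log x : ℂ) ^ (2 * s) * (Real.log y : ℂ) ^ (4 * s - 4 * r))
      = ∑ n ∈ Icc 1 (⌊x⌋₊ ^ (2 * s)), ∑ b ∈ Icc 1 (⌊y⌋₊ ^ (s - r)), ∑ a ∈ Icc 1 (⌊y⌋₊ ^ (s - r)),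
          cP n * cM b * cM a
            * ((DirichletCharacter.LFunction χ (1 / 2)
                * (χ (a : ZMod q) * starRingEnd ℂ (χ ((n * b : ℕ) : ZMod q))))
              * (((Real.sqrt n * Real.sqrt b * Real.sqrt a)⁻¹ : ℝ) : ℂ)) := by
    intro χ
    -- The even power of the modulus is a power of M times its conjugate: M contributes χ(a), while
    -- conj M and conj P together contribute conj χ(nb).
    have e1 : ((‖mollifier χ (1 / (s : ℝ)) y‖ ^ (2 * (s - r)) : ℝ) : ℂ)
        = mollifier χ (1 / (s : ℝ)) y ^ (s - r)
          * starRingEnd ℂ (mollifier χ (1 / (s : ℝ)) y) ^ (s - r) := by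
      rw [← mul_pow, Complex.mul_conj, Complex.normSq_eq_norm_sq, pow_mul]
      push_cast
      rfl
    have e2 : 4 * s - 4 * r = 2 * (s - r) + 2 * (s - r) := by omega
    rw [e1, e2, pow_add]
    calc _ = DirichletCharacter.LFunction χ (1 / 2)
          * (((starRingEnd ℂ (dirPoly χ (1 / (2 * (s : ℝ))) x)) ^ (2 * s)
              * (Real.log x : ℂ) ^ (2 * s))
            * ((starRingEnd ℂ (mollifier χ (1 / (s : ℝ)) y) ^ (s - r)
                * (Real.log y : ℂ) ^ (2 * (s - r)))
              * (mollifier χ (1 / (s : ℝ)) y ^ (s - r) * (Real.log y : ℂ) ^ (2 * (s - r))))) := by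
          ring
      _ = _ := by
          rw [conj_dirPoly_pow χ _ s hx, mollifier_pow χ _ s hy, conj_mollifier_pow χ _ s hy,
            Finset.sum_mul_sum, Finset.sum_mul, Finset.mul_sum]
          refine Finset.sum_congr rfl fun n _ => ?_
          rw [Finset.mul_sum, Finset.mul_sum]
          refine Finset.sum_congr rfl fun b _ => ?_
          rw [Finset.mul_sum, Finset.mul_sum]
          refine Finset.sum_congr rfl fun a _ => ?_
          rw [Nat.cast_mul n b, map_mul, map_mul]
          push_cast
          rw [mul_inv, mul_inv]
          ring
  rw [lowerMoment, Finset.sum_mul, Finset.sum_congr rfl fun χ _ => hterm χ, Finset.sum_comm]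
  refine Finset.sum_congr rfl fun n _ => ?_
  rw [Finset.sum_comm]
  refine Finset.sum_congr rfl fun b _ => ?_
  rw [Finset.sum_comm]
  refine Finset.sum_congr rfl fun a _ => ?_
  rw [← Finset.mul_sum, ← Finset.sum_mul]

end

theorem exists_norm_lowerMoment_sub_le {r s : ℕ} (hrs : r < s) : ∃ C : ℝ, ∀ (q : ℕ)
    [Fact q.Prime] (x y c : ℝ), 1 < y → y ≤ x → x ^ (4 * s) ≤ (q : ℝ) ^ (1 / 20 : ℝ) → 0 < c →
      ‖lowerMoment r s q x y - (Nat.totient q : ℂ) * integralL r s q x y c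
          / ((Real.log x : ℂ) ^ (2 * s) * (Real.log y : ℂ) ^ (4 * s - 4 * r))‖
        ≤ C * ((q : ℝ) / Real.log q) := by
  obtain ⟨C, hC0, hC⟩ := exists_twistedMoment_le
  -- The 50 comes from log q ≤ 50 q^(1/50), used to pass from q^(49/50) to q/log q.
  refine ⟨C * 50, fun q _ x y c hy hyx hxq hc => ?_⟩
  have hs : 0 < s := by omega
  have hq : q.Prime := Fact.out
  have hq0 : (0 : ℝ) < q := by exact_mod_cast hq.pos
  have hq1 : (1 : ℝ) < q := by exact_mod_cast hq.one_lt
  have hx : 1 < x := hy.trans_le hyx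
  have hx0 : 0 < x := by linarith
  have hy0 : 0 < y := by linarith
  have hlx := Real.log_pos hx
  have hly := Real.log_pos hy
  have hlq := Real.log_pos hq1
  set D : ℂ := (Real.log x : ℂ) ^ (2 * s) * (Real.log y : ℂ) ^ (4 * s - 4 * r) with hD
  have hDn : ‖D‖ = Real.log x ^ (2 * s) * Real.log y ^ (4 * s - 4 * r) := by
    rw [hD, norm_mul, norm_pow, norm_pow, Complex.norm_real, Complex.norm_real,
      Real.norm_of_nonneg hlx.le, Real.norm_of_nonneg hly.le]
  have hDpos : 0 < ‖D‖ := by rw [hDn]; positivity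
  have hD0 : D ≠ 0 := norm_pos_iff.mp hDpos
  set l := s - r with hl
  set cP := convWeight (2 * s) x logWeight (divCoeff (1 / (2 * (s : ℝ)))) with hcP
  set cM := convWeight l y logSqWeight (divMuCoeff (1 / (s : ℝ))) with hcM
  set X : ℝ := (q : ℝ) ^ (5 / 4 : ℝ) with hX
  set Y : ℕ → ℕ → ℕ → ℂ := fun n b a => cP n * cM b * cM a with hY
  set S : ℕ → ℕ → ℂ := fun a B => ∑ χ : DirichletCharacter ℂ q with χ ≠ 1,
    DirichletCharacter.LFunction χ (1 / 2)
      * (χ (a : ZMod q) * starRingEnd ℂ (χ (B : ZMod q))) with hS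
  set V : ℕ → ℕ → ℝ := fun a B => if a ∣ B then smoothWeight X ((B / a : ℕ) : ℝ) else 0 with hV
  set R : ℕ → ℕ → ℕ → ℝ := fun n b a => (Real.sqrt n * Real.sqrt b * Real.sqrt a)⁻¹ with hR
  have hmoment : lowerMoment r s q x y * D = ∑ n ∈ Icc 1 (⌊x⌋₊ ^ (2 * s)), ∑ b ∈ Icc 1 (⌊y⌋₊ ^ l),
      ∑ a ∈ Icc 1 (⌊y⌋₊ ^ l), Y n b a * (S a (n * b) * (R n b a : ℂ)) := by
    convert lowerMoment_mul_eq (q := q) hrs hx hy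
  have hint : integralL r s q x y c = ∑ n ∈ Icc 1 (⌊x⌋₊ ^ (2 * s)), ∑ b ∈ Icc 1 (⌊y⌋₊ ^ l),
      ∑ a ∈ Icc 1 (⌊y⌋₊ ^ l), Y n b a * ((V a (n * b) : ℂ) * (R n b a : ℂ)) := by
    rw [integralL_eq hrs hq.pos hc hx0 hy0, tsum_diagWeight hx0 hy0]
    refine Finset.sum_congr rfl fun n hn => Finset.sum_congr rfl fun b hb =>
      Finset.sum_congr rfl fun a ha => ?_
    rw [Finset.mem_Icc] at hn hb ha
    have h := congrArg (fun u : ℝ => (u : ℂ)) (smoothWeight_div (X := X) ha.1 hn.1 hb.1)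
    rw [hY, hV, hR, ← Complex.ofReal_mul]
    refine congrArg _ (Eq.trans ?_ h.symm)
    split_ifs <;> push_cast <;> ring
  have hfx : ((⌊x⌋₊ ^ (2 * s) : ℕ) : ℝ) ≤ x ^ (2 * s) := by
    push_cast
    exact pow_le_pow_left₀ (Nat.cast_nonneg _) (Nat.floor_le hx0.le) _
  have hfy : ((⌊y⌋₊ ^ l : ℕ) : ℝ) ≤ x ^ l := by
    push_cast
    exact pow_le_pow_left₀ (Nat.cast_nonneg _) ((Nat.floor_le hy0.le).trans hyx) _
  have hdiff : ‖lowerMoment r s q x y * D - (Nat.totient q : ℂ) * integralL r s q x y c‖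
      ≤ (x * Real.log x) ^ (2 * s) * ((y * Real.log y ^ 2) ^ l * (y * Real.log y ^ 2) ^ l)
        * (C * (q : ℝ) ^ (93 / 100 : ℝ)) := by
    have hterm : ∀ n ∈ Icc 1 (⌊x⌋₊ ^ (2 * s)), ∀ b ∈ Icc 1 (⌊y⌋₊ ^ l), ∀ a ∈ Icc 1 (⌊y⌋₊ ^ l),
        ‖Y n b a * (S a (n * b) * (R n b a : ℂ))
          - (Nat.totient q : ℂ) * (Y n b a * ((V a (n * b) : ℂ) * (R n b a : ℂ)))‖
        ≤ ‖cP n‖ * (‖cM b‖ * ‖cM a‖) * (C * (q : ℝ) ^ (93 / 100 : ℝ)) := by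
      intro n hn b hb a ha
      rw [Finset.mem_Icc] at hn hb ha
      -- Both twists stay below q^(1/20): a ≤ x^l and nb ≤ x^(2s+l), where 2s + l ≤ 4s since l = s -
      -- r.
      have ha' : (a : ℝ) ≤ (q : ℝ) ^ (1 / 20 : ℝ) := by
        calc (a : ℝ) ≤ x ^ l := le_trans (by exact_mod_cast ha.2) hfy
          _ ≤ x ^ (4 * s) := pow_le_pow_right₀ hx.le (by omega)
          _ ≤ _ := hxq
      have hB' : ((n * b : ℕ) : ℝ) ≤ (q : ℝ) ^ (1 / 20 : ℝ) := by
        rw [Nat.cast_mul]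
        calc (n : ℝ) * b ≤ x ^ (2 * s) * x ^ l :=
              mul_le_mul (le_trans (by exact_mod_cast hn.2) hfx)
                (le_trans (by exact_mod_cast hb.2) hfy) (by positivity) (by positivity)
          _ = x ^ (2 * s + l) := (pow_add _ _ _).symm
          _ ≤ x ^ (4 * s) := pow_le_pow_right₀ hx.le (by omega)
          _ ≤ _ := hxq
      have h := hC q a (n * b) ha.1 (Nat.mul_pos hn.1 hb.1) ha' hB'
      have hsq : ∀ {m : ℕ}, 1 ≤ m → 1 ≤ Real.sqrt m := fun {m} hm =>
        Real.one_le_sqrt.mpr (by exact_mod_cast hm)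
      have hR1 : |R n b a| ≤ 1 := by
        rw [abs_of_nonneg (by positivity)]
        exact inv_le_one_of_one_le₀ (one_le_mul_of_one_le_of_one_le
          (one_le_mul_of_one_le_of_one_le (hsq hn.1) (hsq hb.1)) (hsq ha.1))
      have hYn : ‖Y n b a‖ = ‖cP n‖ * (‖cM b‖ * ‖cM a‖) := by simp only [hY, norm_mul, mul_assoc]
      rw [show Y n b a * (S a (n * b) * (R n b a : ℂ))
          - (Nat.totient q : ℂ) * (Y n b a * ((V a (n * b) : ℂ) * (R n b a : ℂ)))
          = Y n b a * ((S a (n * b) - (Nat.totient q : ℂ) * (V a (n * b) : ℂ)) * (R n b a : ℂ)) by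
        ring, norm_mul, hYn, norm_mul (S a (n * b) - _), Complex.norm_real, Real.norm_eq_abs]
      refine mul_le_mul_of_nonneg_left ?_ (by positivity)
      refine (mul_le_of_le_one_right (norm_nonneg _) hR1).trans ?_
      convert h
    rw [hmoment, hint, Finset.mul_sum, ← Finset.sum_sub_distrib]
    simp_rw [Finset.mul_sum, ← Finset.sum_sub_distrib]
    refine (norm_sum_le_of_le _ fun n hn => norm_sum_le_of_le _ fun b hb =>
      norm_sum_le_of_le _ fun a ha => hterm n hn b hb a ha).trans ?_
    simp_rw [← Finset.sum_mul, ← Finset.mul_sum, ← Finset.sum_mul]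
    have hP := sum_norm_convWeight_le (k := 2 * s) (T := Real.log x) (logWeight_support hx0)
      logWeight_nonneg (norm_coeff_le hs).1 hx0.le (fun n hn => max_log_div_le hx hn) hlx.le
    have hM := sum_norm_convWeight_le (k := l) (T := Real.log y ^ 2) (logSqWeight_support hy0)
      logSqWeight_nonneg (norm_coeff_le hs).2 hy0.le (fun n hn => logSqWeight_div_le hy hn)
      (by positivity)
    have hn1 : 0 ≤ ∑ a ∈ Icc 1 (⌊y⌋₊ ^ l), ‖cM a‖ := Finset.sum_nonneg fun _ _ => norm_nonneg _
    refine mul_le_mul_of_nonneg_right ?_ (by positivity)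
    exact mul_le_mul hP (mul_le_mul hM hM hn1 (by positivity)) (mul_nonneg hn1 hn1) (by positivity)
  have e4 : 4 * s - 4 * r = 2 * l + 2 * l := by omega
  have hfin : ‖lowerMoment r s q x y - (Nat.totient q : ℂ) * integralL r s q x y c / D‖
      ≤ x ^ (2 * s) * (y ^ l * y ^ l) * (C * (q : ℝ) ^ (93 / 100 : ℝ)) := by
    rw [show lowerMoment r s q x y - (Nat.totient q : ℂ) * integralL r s q x y c / D
      = (lowerMoment r s q x y * D - (Nat.totient q : ℂ) * integralL r s q x y c) / D by
        field_simp, norm_div, div_le_iff₀ hDpos]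
    -- The logarithms in the coefficient bound cancel ‖D‖ exactly, so the estimate is uniform as x
    -- and y approach 1.
    refine hdiff.trans (le_of_eq ?_)
    rw [hDn, e4, pow_add]
    simp only [mul_pow, ← pow_mul]
    ring
  refine hfin.trans ?_
  have hxy : x ^ (2 * s) * (y ^ l * y ^ l) ≤ (q : ℝ) ^ (1 / 20 : ℝ) := by
    calc x ^ (2 * s) * (y ^ l * y ^ l) ≤ x ^ (2 * s) * (x ^ l * x ^ l) := by gcongr
      _ = x ^ (2 * s + (l + l)) := by rw [pow_add, pow_add]
      _ ≤ x ^ (4 * s) := pow_le_pow_right₀ hx.le (by omega)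
      _ ≤ _ := hxq
  have hlog : Real.log q ≤ (q : ℝ) ^ (1 / 50 : ℝ) / (1 / 50) :=
    Real.log_le_rpow_div hq0.le (by norm_num)
  calc _ ≤ (q : ℝ) ^ (1 / 20 : ℝ) * (C * (q : ℝ) ^ (93 / 100 : ℝ)) := by gcongr
    _ = C * (q : ℝ) ^ (49 / 50 : ℝ) := by
        rw [show (49 / 50 : ℝ) = 1 / 20 + 93 / 100 by norm_num, Real.rpow_add hq0]
        ring
    _ ≤ C * (50 * (q / Real.log q)) := by
        refine mul_le_mul_of_nonneg_left ?_ hC0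
        rw [← mul_div_assoc, le_div_iff₀ hlq]
        calc _ ≤ (q : ℝ) ^ (49 / 50 : ℝ) * ((q : ℝ) ^ (1 / 50 : ℝ) / (1 / 50)) := by gcongr
          _ = 50 * ((q : ℝ) ^ (49 / 50 : ℝ) * (q : ℝ) ^ (1 / 50 : ℝ)) := by ring
          _ = 50 * q := by rw [← Real.rpow_add hq0]; norm_num
    _ = _ := by ring

end FracMoment

theorem mainTheorem3 (r s : ℕ) (hr : 0 < r) (hrs : r < s) (hcop : Nat.Coprime r s) :
    (∀ (w₀ : ℂ) (w : Fin (2 * s) → ℂ) (z₁ z₂ : Fin (s - r) → ℂ),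
      -(3 / 16 : ℝ) ≤ w₀.re → (∀ i, -(3 / 16 : ℝ) ≤ (w i).re) →
      (∀ j, -(3 / 16 : ℝ) ≤ (z₁ j).re) → (∀ j, -(3 / 16 : ℝ) ≤ (z₂ j).re) →
        (∀ p : Nat.Primes, Summable fun e : FracMoment.DiagExp =>
          ‖FracMoment.localTerm s w₀ w z₁ z₂ p e‖) ∧
        Summable fun p : Nat.Primes => ‖FracMoment.etaFactor s w₀ w z₁ z₂ p - 1‖) ∧
    ∃ C : ℝ, ∀ (q : ℕ) [Fact q.Prime] (x y c : ℝ), 1 < y → y ≤ x →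
      x ^ (4 * s) ≤ (q : ℝ) ^ (1 / 20 : ℝ) → 0 < c →
        MeasureTheory.Integrable (FracMoment.lineIntegrand r s q x y c) ∧
        ‖FracMoment.lowerMoment r s q x y
            - (Nat.totient q : ℂ) * FracMoment.integralL r s q x y c
              / ((Real.log x : ℂ) ^ (2 * s) * (Real.log y : ℂ) ^ (4 * s - 4 * r))‖
          ≤ C * ((q : ℝ) / Real.log q) := by
  have hs : 0 < s := by omega
  refine ⟨fun w₀ w z₁ z₂ h0 hw h1 h2 => ⟨fun p => ?_, ?_⟩, ?_⟩
  · exact FracMoment.summable_norm_localTerm hs (σ := -(3 / 16)) (by norm_num) h0 hw h1 h2 p.2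
  · exact FracMoment.summable_norm_etaFactor_sub_one hs h0 hw h1 h2
  · obtain ⟨C, hC⟩ := FracMoment.exists_norm_lowerMoment_sub_le hrs
    refine ⟨C, fun q _ x y c hy hyx hxq hc => ⟨?_, hC q x y c hy hyx hxq hc⟩⟩
    exact FracMoment.integrable_lineIntegrand hs (Fact.out : q.Prime).pos hc (by linarith)
      (by linarith)
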